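/- Let $d\ge 2$, let $\Omega$ be $\mathbb{R}^d$ or the torus $\mathbb{T}^d=\mathbb{R}^d/\mathbb{Z}^d$, and let $T>0$. Let $p\in[3,\infty]$, $\theta\in(0,\tfrac13)$, $\beta\in(0,1)$, and let $$v\in L^{p}\big((0,T);B^{\theta}_{3,\infty}(\Omega)\big)\cap L^{2p/3}\big((0,T);B^{\beta}_{2,\infty}(\Omega)\big)$$ be a weak solution on $(0,T)\times\Omega$ of the incompressible Euler equations $\partial_t v+\operatorname{div}(v\otimes v)+\nabla P=0$, $\operatorname{div}v=0$. That is, $v\in L^2_{loc}$ is weakly divergence free and $\int_0^T\!\int_\Omega \big(v\cdot\partial_t\Phi+(v\otimes v):\nabla\Phi\big)\,dx\,dt=0$ for every divergence-free $\Phi\in C^\infty_c((0,T)\times\Omega;\mathbb{R}^d)$. Here, for $s\in(0,1)$, $\|f\|_{B^{s}_{q,\infty}(\Omega)}=\|f\|_{L^q(\Omega)}+\sup_{h\ne0}|h|^{-s}\|f(\cdot+h)-f\|_{L^q(\Omega)}$. Let $e_v(t)=\frac12\int_\Omega|v(x,t)|^2\,dx$ be the kinetic energy. For an open set $I\subset(0,T)$,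 say that $v$ is conservative on $I\times\Omega$ if $e_v\in L^1_{loc}(I)$ and $\int_I e_v\,\varphi'\,dt=0$ for all $\varphi\in C^\infty_c(I)$, i.e. $e_v'=0$ in $\mathcal{D}'(I)$. Suppose that there is a relatively closed set of times $S_T\subset(0,T)$ such that $v$ is conservative on $\big((0,T)\setminus S_T\big)\times\Omega$ and whose upper Minkowski dimension $$\gamma=\inf\Big\{s\ge0:\ \limsup_{\delta\to0^+}\frac{|\{t\in\mathbb{R}:\operatorname{dist}(t,S_T)\le\delta\}|}{\delta^{1-s}}=0\Big\}$$ satisfies $\gamma<1$. If $$\gamma<1-\frac{p}{p-3}\left(1-\frac{2\beta}{1-3\theta+2\beta}\right),$$ where $\frac{p}{p-3}$ is read as $1$ for $p=\infty$ and as $+\infty$ for $p=3$ (so that for $p=3$ the condition never holds), then $v$ conserves the kinetic energy, i.e. $v$ is conservative on $(0,T)\times\Omega$: $e_v'=0$ in $\mathcal{D}'((0,T))$. -/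

import Mathlib

open MeasureTheory Set Filter Topology
open scoped ENNReal ContDiff

noncomputable section

/-- The spatial domain `Ω`: the whole space `ℝᵈ` or the flat torus `𝕋ᵈ = ℝᵈ / ℤᵈ`. -/
inductive FlowDomain where
  | wholeSpace
  | torus

namespace FlowDomain

/-- The group of periods `Λ` for which `Ω = ℝᵈ / Λ`: trivial for `ℝᵈ`, and `ℤᵈ` for `𝕋ᵈ`. A function
on `Ω` is a `Λ`-periodic function on `ℝᵈ`. -/
def periods (d : ℕ) : FlowDomain → Set (EuclideanSpace ℝ (Fin d))
  | wholeSpace => {0}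
  | torus => {k | ∀ i, ∃ n : ℤ, k i = n}

/-- A fundamental cell of `Ω = ℝᵈ / Λ`. The integral over `Ω` is the Lebesgue integral over it. -/
def cell (d : ℕ) : FlowDomain → Set (EuclideanSpace ℝ (Fin d))
  | wholeSpace => univ
  | torus => {x | ∀ i, x i ∈ Ico (0 : ℝ) 1}

end FlowDomain

/-- `f : ℝᵈ → F` is a function on `Ω`, that is, `Λ`-periodic. -/
def IsFunctionOn {d : ℕ} {F : Type*} (Ω : FlowDomain) (f : EuclideanSpace ℝ (Fin d) → F) : Prop :=
  ∀ k ∈ Ω.periods d, ∀ x, f (x + k) = f x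

/-- The `B^θ_{q,∞}(Ω)` seminorm: the supremum over `h ≠ 0` of
`‖f(· + h) - f‖_{L^q(Ω)} / |h|^θ`. -/
def besovSeminorm {d : ℕ} (Ω : FlowDomain) (θ : ℝ) (q : ℝ≥0∞)
    (f : EuclideanSpace ℝ (Fin d) → EuclideanSpace ℝ (Fin d)) : ℝ≥0∞ :=
  ⨆ (h : EuclideanSpace ℝ (Fin d)) (_ : h ≠ 0),
    eLpNorm (fun x => f (x + h) - f x) q (volume.restrict (Ω.cell d)) / ENNReal.ofReal (‖h‖ ^ θ)

/-- The full `B^θ_{q,∞}(Ω)` norm. -/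
def besovNorm {d : ℕ} (Ω : FlowDomain) (θ : ℝ) (q : ℝ≥0∞)
    (f : EuclideanSpace ℝ (Fin d) → EuclideanSpace ℝ (Fin d)) : ℝ≥0∞ :=
  eLpNorm f q (volume.restrict (Ω.cell d)) + besovSeminorm Ω θ q f

/-- `v ∈ L^r((0,T); B^θ_{q,∞}(Ω))`: `v` is a measurable function of `(t, x)` and
`t ↦ ‖v(t)‖_{B^θ_{q,∞}(Ω)}` has finite `L^r(0,T)` norm. -/
def MemTimeBesov {d : ℕ} (Ω : FlowDomain) (T : ℝ) (r : ℝ≥0∞) (θ : ℝ) (q : ℝ≥0∞)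
    (v : ℝ → EuclideanSpace ℝ (Fin d) → EuclideanSpace ℝ (Fin d)) : Prop :=
  AEStronglyMeasurable (Function.uncurry v) (volume.restrict (Ioo 0 T ×ˢ univ)) ∧
    eLpNorm (fun t => besovNorm Ω θ q (v t)) r (volume.restrict (Ioo 0 T)) < ⊤

/-- `Φ ∈ C_c^∞((0,T) × Ω; F)`: a smooth function of `(t, x)`, periodic in `x`, whose support projects
into a compact subset of `(0,T) × Ω`. -/
structure IsTestFunction {d : ℕ} {F : Type*} [NormedAddCommGroup F] [NormedSpace ℝ F]
    (Ω : FlowDomain) (T : ℝ) (Φ : ℝ → EuclideanSpace ℝ (Fin d) → F) : Prop where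
  smooth : ContDiff ℝ ∞ (Function.uncurry Φ)
  periodic : ∀ t, IsFunctionOn Ω (Φ t)
  compact_support : ∃ K : Set (ℝ × EuclideanSpace ℝ (Fin d)), IsCompact K ∧ K ⊆ Ioo 0 T ×ˢ univ ∧
    ∀ t x, Φ t x ≠ 0 → ∃ k ∈ Ω.periods d, (t, x + k) ∈ K

/-- The divergence of a (differentiable) vector field on `ℝᵈ`. -/
def divergence {d : ℕ} (w : EuclideanSpace ℝ (Fin d) → EuclideanSpace ℝ (Fin d))
    (x : EuclideanSpace ℝ (Fin d)) : ℝ :=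
  ∑ i, fderiv ℝ w x (EuclideanSpace.single i 1) i

/-- `v` is a weak solution on `(0,T) × Ω` of the incompressible Euler equations
`∂ₜ v + div (v ⊗ v) + ∇p = 0`, `div v = 0`. The pressure is eliminated by testing the momentum
equation with divergence-free fields; note `⟪v, DΦ v⟫ = (v ⊗ v) : ∇Φ`. -/
structure IsWeakEulerSolution {d : ℕ} (Ω : FlowDomain) (T : ℝ)
    (v : ℝ → EuclideanSpace ℝ (Fin d) → EuclideanSpace ℝ (Fin d)) : Prop where
  periodic : ∀ t, IsFunctionOn Ω (v t)
  locally_square_integrable : ∀ K : Set (ℝ × EuclideanSpace ℝ (Fin d)), IsCompact K →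
    K ⊆ Ioo 0 T ×ˢ univ → MemLp (Function.uncurry v) 2 (volume.restrict K)
  weakly_divergence_free : ∀ ψ : ℝ → EuclideanSpace ℝ (Fin d) → ℝ, IsTestFunction Ω T ψ →
    ∫ z in Ioo 0 T ×ˢ Ω.cell d, fderiv ℝ (ψ z.1) z.2 (v z.1 z.2) = 0
  momentum : ∀ Φ : ℝ → EuclideanSpace ℝ (Fin d) → EuclideanSpace ℝ (Fin d),
    IsTestFunction Ω T Φ → (∀ t x, divergence (Φ t) x = 0) →
    ∫ z in Ioo 0 T ×ˢ Ω.cell d,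
      (inner ℝ (v z.1 z.2) (deriv (fun s => Φ s z.2) z.1) +
        inner ℝ (v z.1 z.2) (fderiv ℝ (Φ z.1) z.2 (v z.1 z.2))) = 0

/-- The kinetic energy `e_v(t) = ½ ∫_Ω |v(t,x)|² dx`. -/
def kineticEnergy {d : ℕ} (Ω : FlowDomain)
    (v : ℝ → EuclideanSpace ℝ (Fin d) → EuclideanSpace ℝ (Fin d)) (t : ℝ) : ℝ :=
  (1 / 2) * ∫ x in Ω.cell d, ‖v t x‖ ^ 2

/-- `v` is conservative on `I × Ω`, for an open set of times `I`: the kinetic energy is locally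
integrable on `I` and `e_v' = 0` in the sense of distributions on `I`. -/
def IsConservativeOn {d : ℕ} (Ω : FlowDomain)
    (v : ℝ → EuclideanSpace ℝ (Fin d) → EuclideanSpace ℝ (Fin d)) (I : Set ℝ) : Prop :=
  LocallyIntegrableOn (kineticEnergy Ω v) I ∧
    ∀ φ : ℝ → ℝ, ContDiff ℝ ∞ φ → HasCompactSupport φ → tsupport φ ⊆ I →
      ∫ t in I, kineticEnergy Ω v t * deriv φ t = 0

/-- The upper `s`-dimensional Minkowski content of a bounded set of times; `Metric.cthickening δ S`
is the closed `δ`-neighbourhood of `S`. -/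
def upperMinkowskiContent (s : ℝ) (S : Set ℝ) : ℝ≥0∞ :=
  limsup (fun δ : ℝ => volume (Metric.cthickening δ S) / ENNReal.ofReal (δ ^ (1 - s))) (𝓝[>] 0)

/-- The upper Minkowski dimension of a bounded set of times. -/
def upperMinkowskiDim (S : Set ℝ) : ℝ :=
  sInf {s : ℝ | 0 ≤ s ∧ upperMinkowskiContent s S = 0}

/-- The factor `p / (p - 3)` for `3 ≤ p ≤ ∞`, read as `∞` at `p = 3` and as `1` at `p = ∞`. -/
def dualFactor (p : ℝ≥0∞) : ℝ≥0∞ :=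
  if p = ⊤ then 1 else p / (p - 3)

end

/-!
The kinetic energy is compared with the correlations
`Q_K(t) = ∫ K(h) ∫_Ω ⟪v(t, y + h), v(t, y)⟫ dy dh` of the velocity with itself, where `K` is an even
kernel. On the one hand, `(∫ K) ∫_Ω |v|² - Q_K = ½ ∫∫ K(h) |v(y + h) - v(y)|²`
(`integral_sq_sub_cellPairing`), so that a kernel of scale `l` misses an amount of energy of order
`l ^ (2β) ‖v‖²` in the norm of `B^β_{2,∞}`. On the other hand, `Q_K` obeys a balance law of
Kármán–Howarth–Monin type, `2 Q_K' = -∫∫ DK(h)·δv |δv|²` with `δv = v(y + h) - v(y)`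
(`IsRegularField.integral_deriv_mul_cellPairing`), whose right-hand side is of order
`l ^ (3θ - 1) ‖v‖³` in the norm of `B^θ_{3,∞}` at the scale `l`. Together these give, for every scale
`l` and every test function `ψ` of time,
`(∫ K) |∫ ψ' ∫_Ω |v|²| ≤ ∫ |ψ'| O(l ^ (2β) ‖v‖²) + ∫ |ψ| O(l ^ (3θ - 1) ‖v‖³)`
(`IsRegularField.enorm_integral_deriv_energy_le`).

Since `v` is conservative away from the exceptional set `S`, a test function may be multiplied by a
cutoff to the `δ`-neighbourhood of `S` (`IsConservativeOn.setIntegral_deriv_eq_cutoff`), which costs a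
factor `1 / δ` in `ψ'`. Hölder's inequality in time gains the measure of that neighbourhood to the power
`1 - 3/p`, hence a factor `δ ^ ((1 - s) (1 - 3/p))` for some `s` as close to `γ` as needed. With
`l = δ ^ (1 / (1 - 3θ + 2β))` both `l ^ (2β) / δ` and `l ^ (3θ - 1)` equal `δ ^ (-a)`, where
`a = 1 - 2β / (1 - 3θ + 2β)`, and the assumption on `γ` says that `(1 - γ) (1 - 3/p) > a`
(`dimension_condition`). Everything tends to zero with `δ`.

Three points make the balance law available to weak solutions that are tested with solenoidal fields
only, without any use of the pressure.

* The admissible kernels are `K = -ΔG` with `G` smooth and compactly supported, for which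
  `∇(∂_w G) - (ΔG) w` is a solenoidal test field (`divergence_solenoidalField`). The additional term
  `D³G` in the balance drops out at equal times by incompressibility (`integral_cubic_eq_zero`). Such
  kernels have integral zero; the kernels used are differences of two rescalings, to the scales `l`
  and `L`, of a radial bump that is itself supported in a shell (`exists_laplacian_eq_rescale_sub`).
  As `L → ∞`, the correlation at the scale `L` tends to zero on the whole space and to a multiple of the
  square of the total momentum, which is conserved, on the torus
  (`IsRegularField.tendsto_integral_deriv_correlation`), and
  the flux at the scale `L` tends to zero.
* The velocity is not differentiable in time, so the equation cannot be tested with the velocity. It is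
  tested instead at one time against the velocity at another time, and the two times are brought
  together (`HasDiagonal.integral_deriv_mul_diag`).
* Periodic solutions are treated as solutions on `ℝᵈ`, by periodizing compactly supported test
  functions (`IsWeakEulerSolution.wholeSpace_of_torus`), while integrals of quadratic and cubic
  expressions are taken over a fundamental cell.
-/

open scoped Pointwise

/-! ### Periodic functions and the fundamental cell -/

namespace FlowDomain

variable {d : ℕ}

/-- The set of periods `Λ` as an additive subgroup of `ℝᵈ`. -/
def lattice (d : ℕ) (Ω : FlowDomain) : AddSubgroup (EuclideanSpace ℝ (Fin d)) where
  carrier := Ω.periods d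
  zero_mem' := by
    cases Ω
    · simp [periods]
    · intro i
      exact ⟨0, by simp⟩
  add_mem' := by
    intro a b ha hb
    cases Ω
    · simp only [periods, mem_singleton_iff] at *
      simp [ha, hb]
    · intro i
      obtain ⟨m, hm⟩ := ha i
      obtain ⟨n, hn⟩ := hb i
      exact ⟨m + n, by simp [hm, hn]⟩
  neg_mem' := by
    intro a ha
    cases Ω
    · simp only [periods, mem_singleton_iff] at *
      simp [ha]
    · intro i
      obtain ⟨m, hm⟩ := ha i
      exact ⟨-m, by simp [hm]⟩

instance countable_lattice (Ω : FlowDomain) : Countable (Ω.lattice d) := by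
  cases Ω
  · have : Subsingleton (wholeSpace.lattice d) := by
      refine ⟨fun a b => Subtype.ext ?_⟩
      have ha : (a : EuclideanSpace ℝ (Fin d)) = 0 := a.2
      have hb : (b : EuclideanSpace ℝ (Fin d)) = 0 := b.2
      rw [ha, hb]
    infer_instance
  · have h : ∀ k : torus.lattice d, ∀ i, ∃ n : ℤ, (k : EuclideanSpace ℝ (Fin d)) i = n :=
      fun k => k.2
    choose n hn using h
    refine Function.Injective.countable (f := n) fun a b hab => Subtype.ext ?_
    ext i
    rw [hn, hn, hab]

lemma measurableSet_cell (Ω : FlowDomain) : MeasurableSet (Ω.cell d) := by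
  cases Ω
  · exact MeasurableSet.univ
  · have : torus.cell d = ⋂ i, {x : EuclideanSpace ℝ (Fin d) | x i ∈ Ico (0 : ℝ) 1} := by
      ext x; simp [cell]
    rw [this]
    exact MeasurableSet.iInter fun i =>
      measurableSet_Ico.preimage (EuclideanSpace.proj (𝕜 := ℝ) i).continuous.measurable

/-- The cell meets every orbit of the periods exactly once: the integer parts are the unique
translation on the torus. -/
lemma isAddFundamentalDomain_cell (Ω : FlowDomain) :
    IsAddFundamentalDomain (Ω.lattice d) (Ω.cell d)
      (volume : Measure (EuclideanSpace ℝ (Fin d))) := by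
  refine IsAddFundamentalDomain.mk' (measurableSet_cell Ω).nullMeasurableSet fun x => ?_
  cases Ω
  · refine ⟨0, by simp [cell], fun k _ => Subtype.ext k.2⟩
  · refine ⟨⟨WithLp.toLp 2 fun i => -(⌊x i⌋ : ℝ), fun i => ⟨-⌊x i⌋, by simp⟩⟩, ?_, ?_⟩
    · intro i
      change -(⌊x i⌋ : ℝ) + x i ∈ Ico (0 : ℝ) 1
      constructor
      · linarith [Int.floor_le (x i)]
      · linarith [Int.lt_floor_add_one (x i)]
    · rintro ⟨k, hk⟩ hkx
      refine Subtype.ext ?_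
      ext i
      obtain ⟨n, hn⟩ := hk i
      have h := hkx i
      simp only [AddSubgroup.mk_vadd, vadd_eq_add, PiLp.add_apply, hn] at h
      have : ⌊x i⌋ = -n := by
        rw [Int.floor_eq_iff]
        push_cast
        constructor <;> linarith [h.1, h.2]
      simp [hn, this]

lemma preimage_sub_cell_eq (Ω : FlowDomain) (h : EuclideanSpace ℝ (Fin d)) :
    (fun x => x - h) ⁻¹' (Ω.cell d) = h +ᵥ (Ω.cell d) := by
  ext x
  rw [mem_vadd_set_iff_neg_vadd_mem, vadd_eq_add, mem_preimage, neg_add_eq_sub]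

/-- The integral of a periodic function over a cell is translation invariant. -/
lemma setIntegral_cell_add {F : Type*} [NormedAddCommGroup F] [NormedSpace ℝ F]
    {Ω : FlowDomain} {f : EuclideanSpace ℝ (Fin d) → F} (hf : IsFunctionOn Ω f)
    (h : EuclideanSpace ℝ (Fin d)) :
    ∫ y in Ω.cell d, f (y + h) = ∫ y in Ω.cell d, f y := by
  have h1 := (measurePreserving_add_right (volume : Measure (EuclideanSpace ℝ (Fin d)))
    h).setIntegral_preimage_emb (measurableEmbedding_addRight h) f
    ((fun x => x - h) ⁻¹' (Ω.cell d))
  rw [← preimage_comp] at h1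
  simp only [Function.comp_def, add_sub_cancel_right, preimage_id'] at h1
  rw [h1, preimage_sub_cell_eq]
  refine ((isAddFundamentalDomain_cell (d := d) Ω).vadd_of_comm h).setIntegral_eq
    (isAddFundamentalDomain_cell Ω) fun k x => ?_
  rw [AddSubgroup.vadd_def, vadd_eq_add, add_comm]
  exact hf k k.2 x

lemma setLIntegral_cell_add
    {Ω : FlowDomain} {f : EuclideanSpace ℝ (Fin d) → ℝ≥0∞} (hf : IsFunctionOn Ω f)
    (h : EuclideanSpace ℝ (Fin d)) :
    ∫⁻ y in Ω.cell d, f (y + h) = ∫⁻ y in Ω.cell d, f y := by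
  have h1 := (measurePreserving_add_right (volume : Measure (EuclideanSpace ℝ (Fin d)))
    h).setLIntegral_comp_preimage_emb (measurableEmbedding_addRight h) f
    ((fun x => x - h) ⁻¹' (Ω.cell d))
  rw [← preimage_comp] at h1
  simp only [Function.comp_def, add_sub_cancel_right, preimage_id'] at h1
  rw [h1, preimage_sub_cell_eq]
  refine ((isAddFundamentalDomain_cell (d := d) Ω).vadd_of_comm h).setLIntegral_eq
    (isAddFundamentalDomain_cell Ω) f fun k x => ?_
  rw [AddSubgroup.vadd_def, vadd_eq_add, add_comm]
  exact hf k k.2 x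

/-- `L^q(Ω)` norms of periodic functions are translation invariant. -/
lemma eLpNorm_cell_add {F : Type*} [NormedAddCommGroup F]
    {Ω : FlowDomain} {f : EuclideanSpace ℝ (Fin d) → F} (hf : IsFunctionOn Ω f)
    {q : ℝ≥0∞} (hq0 : q ≠ 0) (hq : q ≠ ⊤) (h : EuclideanSpace ℝ (Fin d)) :
    eLpNorm (fun y => f (y + h)) q (volume.restrict (Ω.cell d)) =
      eLpNorm f q (volume.restrict (Ω.cell d)) := by
  rw [eLpNorm_eq_lintegral_rpow_enorm_toReal hq0 hq, eLpNorm_eq_lintegral_rpow_enorm_toReal hq0 hq]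
  congr 1
  refine setLIntegral_cell_add (f := fun y => ‖f y‖ₑ ^ q.toReal) (fun k hk x => ?_) h
  simp only [hf k hk x]

end FlowDomain

/-! ### Test functions and the passage from the torus to the whole space -/

section SliceDerivatives

variable {d : ℕ} {F : Type*} [NormedAddCommGroup F] [NormedSpace ℝ F]

lemma fderiv_slice {Φ : ℝ → EuclideanSpace ℝ (Fin d) → F}
    (hΦ : ContDiff ℝ ∞ (Function.uncurry Φ)) (z : ℝ × EuclideanSpace ℝ (Fin d)) :
    fderiv ℝ (Φ z.1) z.2 =
      (fderiv ℝ (Function.uncurry Φ) z).comp (ContinuousLinearMap.inr ℝ ℝ _) := by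
  have h1 : HasFDerivAt (Function.uncurry Φ) (fderiv ℝ (Function.uncurry Φ) z) (z.1, z.2) :=
    (hΦ.differentiable (by simp) z).hasFDerivAt
  exact (h1.comp z.2 (hasFDerivAt_prodMk_right z.1 z.2)).fderiv

lemma deriv_slice {Φ : ℝ → EuclideanSpace ℝ (Fin d) → F}
    (hΦ : ContDiff ℝ ∞ (Function.uncurry Φ)) (z : ℝ × EuclideanSpace ℝ (Fin d)) :
    deriv (fun s => Φ s z.2) z.1 = fderiv ℝ (Function.uncurry Φ) z (1, 0) := by
  have h1 : HasFDerivAt (Function.uncurry Φ) (fderiv ℝ (Function.uncurry Φ) z) (z.1, z.2) :=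
    (hΦ.differentiable (by simp) z).hasFDerivAt
  have := (h1.comp z.1 (hasFDerivAt_prodMk_left z.1 z.2)).hasDerivAt.deriv
  simpa [Function.comp_def, Function.uncurry] using this

lemma contDiff_slice {Φ : ℝ → EuclideanSpace ℝ (Fin d) → F}
    (hΦ : ContDiff ℝ ∞ (Function.uncurry Φ)) (t : ℝ) : ContDiff ℝ ∞ (Φ t) :=
  hΦ.comp (contDiff_const.prodMk contDiff_id)

lemma fderiv_eq_zero_of_notMem {X : Type*} [NormedAddCommGroup X] [NormedSpace ℝ X] {f : X → F}
    {K : Set X} (hK : IsClosed K)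
    (hf : ∀ z ∉ K, f z = 0) {z : X} (hz : z ∉ K) : fderiv ℝ f z = 0 := by
  have : f =ᶠ[𝓝 z] fun _ => 0 := by
    filter_upwards [hK.isOpen_compl.mem_nhds hz] with w hw using hf w hw
  rw [this.fderiv_eq]
  simp

end SliceDerivatives

section Integrability

variable {X E : Type*} [NormedAddCommGroup E] [InnerProductSpace ℝ E] [TopologicalSpace X]
  [T2Space X] [MeasurableSpace X] [OpensMeasurableSpace X] [SecondCountableTopology X]
  {μ : Measure X}

lemma integrableOn_clm_apply_of_memLp [IsFiniteMeasureOnCompacts μ] {F : Type*}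
    [NormedAddCommGroup F] [NormedSpace ℝ F] {v : X → E} {K : Set X}
    (hK : IsCompact K) (hv : MemLp v 2 (μ.restrict K)) {c : X → E →L[ℝ] F} (hc : Continuous c) :
    IntegrableOn (fun z => c z (v z)) K μ := by
  have hfin : IsFiniteMeasure (μ.restrict K) := ⟨by simpa using hK.measure_lt_top⟩
  obtain ⟨C, hC⟩ := hK.exists_bound_of_continuousOn hc.continuousOn
  refine Integrable.mono' (g := fun z => C * ‖v z‖) ?_ ?_ ?_
  · exact ((hv.integrable (by norm_num)).norm).const_mul C
  · exact isBoundedBilinearMap_apply.continuous.comp_aestronglyMeasurable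
      (hc.aestronglyMeasurable.prodMk hv.1)
  · filter_upwards [ae_restrict_mem hK.measurableSet] with z hz
    exact ((c z).le_opNorm _).trans (by gcongr; exact hC z hz)

lemma integrable_clm_apply_of_memLp [IsFiniteMeasureOnCompacts μ] {F : Type*}
    [NormedAddCommGroup F] [NormedSpace ℝ F] {v : X → E} {K : Set X} (hK : IsCompact K)
    (hv : MemLp v 2 (μ.restrict K)) {c : X → E →L[ℝ] F} (hc : Continuous c)
    (hcK : ∀ z ∉ K, c z = 0) : Integrable (fun z => c z (v z)) μ := by
  rw [← integrableOn_iff_integrable_of_support_subset (s := K)]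
  · exact integrableOn_clm_apply_of_memLp hK hv hc
  · intro z hz
    by_contra hzK
    exact hz (by simp [hcK z hzK])

lemma integrable_inner_clm_apply_of_memLp {v : X → E} {K : Set X} (hK : IsCompact K)
    (hv : MemLp v 2 (μ.restrict K)) {c : X → E →L[ℝ] E} (hc : Continuous c)
    (hcK : ∀ z ∉ K, c z = 0) : Integrable (fun z => (inner ℝ (v z) (c z (v z)) : ℝ)) μ := by
  rw [← integrableOn_iff_integrable_of_support_subset (s := K)]
  swap
  · intro z hz
    by_contra hzK
    exact hz (by simp [hcK z hzK])
  obtain ⟨C, hC⟩ := hK.exists_bound_of_continuousOn hc.continuousOn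
  refine Integrable.mono' (g := fun z => C * ‖v z‖ ^ 2) ?_ ?_ ?_
  · exact (hv.integrable_norm_pow (by norm_num)).const_mul C
  · exact hv.1.inner (isBoundedBilinearMap_apply.continuous.comp_aestronglyMeasurable
      (hc.aestronglyMeasurable.prodMk hv.1))
  · filter_upwards [ae_restrict_mem hK.measurableSet] with z hz
    refine (norm_inner_le_norm _ _).trans ?_
    have h1 : ‖c z (v z)‖ ≤ C * ‖v z‖ :=
      ((c z).le_opNorm _).trans (by gcongr; exact hC z hz)
    nlinarith [norm_nonneg (v z)]

end Integrability

namespace IsTestFunction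

variable {d : ℕ} {F : Type*} [NormedAddCommGroup F] [NormedSpace ℝ F] {T : ℝ}

lemma exists_isCompact_support {Φ : ℝ → EuclideanSpace ℝ (Fin d) → F}
    (hΦ : IsTestFunction .wholeSpace T Φ) :
    ∃ K : Set (ℝ × EuclideanSpace ℝ (Fin d)), IsCompact K ∧ K ⊆ Ioo 0 T ×ˢ univ ∧
      ∀ z ∉ K, Function.uncurry Φ z = 0 := by
  obtain ⟨K, hK, hKs, h⟩ := hΦ.compact_support
  refine ⟨K, hK, hKs, fun z hz => ?_⟩
  by_contra hne
  obtain ⟨k, hk, hkK⟩ := h z.1 z.2 hne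
  have : k = 0 := hk
  subst this
  exact hz (by simpa using hkK)

/-- The integrand of the weak divergence condition is integrable. -/
lemma integrable_fderiv_apply {ψ : ℝ → EuclideanSpace ℝ (Fin d) → ℝ}
    (hψ : IsTestFunction .wholeSpace T ψ)
    {v : ℝ → EuclideanSpace ℝ (Fin d) → EuclideanSpace ℝ (Fin d)}
    (hv : ∀ K : Set (ℝ × EuclideanSpace ℝ (Fin d)), IsCompact K →
      K ⊆ Ioo 0 T ×ˢ univ → MemLp (Function.uncurry v) 2 (volume.restrict K)) :
    Integrable (fun z : ℝ × EuclideanSpace ℝ (Fin d) => fderiv ℝ (ψ z.1) z.2 (v z.1 z.2)) := by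
  obtain ⟨K, hK, hKs, h⟩ := hψ.exists_isCompact_support
  simp_rw [fderiv_slice hψ.smooth]
  refine integrable_clm_apply_of_memLp hK (hv K hK hKs) (c := fun z =>
    (fderiv ℝ (Function.uncurry ψ) z).comp (ContinuousLinearMap.inr ℝ ℝ _)) ?_ ?_
  · exact (hψ.smooth.continuous_fderiv (by simp)).clm_comp continuous_const
  · intro z hz
    rw [fderiv_eq_zero_of_notMem hK.isClosed h hz, ContinuousLinearMap.zero_comp]

/-- The integrand of the weak momentum equation is integrable. -/
lemma integrable_momentum {Φ : ℝ → EuclideanSpace ℝ (Fin d) → EuclideanSpace ℝ (Fin d)}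
    (hΦ : IsTestFunction .wholeSpace T Φ)
    {v : ℝ → EuclideanSpace ℝ (Fin d) → EuclideanSpace ℝ (Fin d)}
    (hv : ∀ K : Set (ℝ × EuclideanSpace ℝ (Fin d)), IsCompact K →
      K ⊆ Ioo 0 T ×ˢ univ → MemLp (Function.uncurry v) 2 (volume.restrict K)) :
    Integrable (fun z : ℝ × EuclideanSpace ℝ (Fin d) =>
      (inner ℝ (v z.1 z.2) (deriv (fun s => Φ s z.2) z.1) +
        inner ℝ (v z.1 z.2) (fderiv ℝ (Φ z.1) z.2 (v z.1 z.2)) : ℝ)) := by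
  obtain ⟨K, hK, hKs, h⟩ := hΦ.exists_isCompact_support
  simp_rw [fderiv_slice hΦ.smooth, deriv_slice hΦ.smooth]
  refine Integrable.add ?_ ?_
  · have := integrable_clm_apply_of_memLp hK (hv K hK hKs) (c := fun z =>
      innerSL ℝ (fderiv ℝ (Function.uncurry Φ) z (1, 0))) ?_ ?_
    · refine this.congr (ae_of_all _ fun z => ?_)
      simp only [innerSL_apply_apply]
      exact real_inner_comm _ _
    · exact (innerSL ℝ).continuous.comp
        ((hΦ.smooth.continuous_fderiv (by simp)).clm_apply continuous_const)
    · intro z hz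
      rw [fderiv_eq_zero_of_notMem hK.isClosed h hz]
      simp
  · refine integrable_inner_clm_apply_of_memLp hK (hv K hK hKs) (c := fun z =>
      (fderiv ℝ (Function.uncurry Φ) z).comp (ContinuousLinearMap.inr ℝ ℝ _)) ?_ ?_
    · exact (hΦ.smooth.continuous_fderiv (by simp)).clm_comp continuous_const
    · intro z hz
      rw [fderiv_eq_zero_of_notMem hK.isClosed h hz, ContinuousLinearMap.zero_comp]

end IsTestFunction

section Periodization

open FlowDomain

variable {d : ℕ} {F : Type*} [NormedAddCommGroup F] [NormedSpace ℝ F] {T : ℝ}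

lemma finite_lattice_norm_le (R : ℝ) :
    {k : FlowDomain.torus.lattice d | ‖(k : EuclideanSpace ℝ (Fin d))‖ ≤ R}.Finite := by
  have h : ∀ k : torus.lattice d, ∀ i, ∃ n : ℤ, (k : EuclideanSpace ℝ (Fin d)) i = n :=
    fun k => k.2
  choose n hn using h
  have hinj : Function.Injective n := fun a b hab => Subtype.ext (by ext i; rw [hn, hn, hab])
  refine ((Set.finite_Icc (fun _ : Fin d => -⌈R⌉) (fun _ => ⌈R⌉)).preimage
    hinj.injOn).subset fun k hk => ?_
  have hi : ∀ i, |n k i| ≤ ⌈R⌉ := fun i => by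
    have h1 : ‖(k : EuclideanSpace ℝ (Fin d)) i‖ ≤ R := (PiLp.norm_apply_le _ i).trans hk
    rw [hn, Real.norm_eq_abs] at h1
    exact_mod_cast h1.trans (Int.le_ceil R)
  exact ⟨fun i => (abs_le.1 (hi i)).1, fun i => (abs_le.1 (hi i)).2⟩

/-- The `ℤᵈ`-periodization of a function on `ℝᵈ`. -/
noncomputable def periodization {E : Type*} [AddCommMonoid E]
    (Φ : ℝ → EuclideanSpace ℝ (Fin d) → E) (t : ℝ) (x : EuclideanSpace ℝ (Fin d)) : E :=
  ∑ᶠ k : FlowDomain.torus.lattice d, Φ t (x + k)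

/-- Over a bounded region only finitely many terms of the periodization are nonzero, uniformly in
time. -/
lemma IsTestFunction.exists_finset {Φ : ℝ → EuclideanSpace ℝ (Fin d) → F}
    (hΦ : IsTestFunction .wholeSpace T Φ) (R : ℝ) :
    ∃ s : Finset (FlowDomain.torus.lattice d), ∀ k ∉ s, ∀ t, ∀ x ∈ Metric.ball 0 R,
      Φ t (x + k) = 0 := by
  obtain ⟨K, hK, hKs, h⟩ := hΦ.exists_isCompact_support
  obtain ⟨C, hC⟩ := hK.isBounded.exists_norm_le
  refine ⟨(finite_lattice_norm_le (C + R)).toFinset, fun k hk t x hx => ?_⟩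
  by_contra hne
  have hz : (t, x + (k : EuclideanSpace ℝ (Fin d))) ∈ K := by
    by_contra hz
    exact hne (h _ hz)
  have h1 : ‖x + (k : EuclideanSpace ℝ (Fin d))‖ ≤ C := (norm_snd_le _).trans (hC _ hz)
  have h2 : ‖x‖ < R := by simpa using hx
  have h3 : ‖(k : EuclideanSpace ℝ (Fin d))‖ ≤ C + R := by
    calc ‖(k : EuclideanSpace ℝ (Fin d))‖ = ‖(x + k) - x‖ := by simp
      _ ≤ ‖x + (k : EuclideanSpace ℝ (Fin d))‖ + ‖x‖ := norm_sub_le _ _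
      _ ≤ C + R := by linarith
  exact hk (by simpa using h3)

lemma periodization_eq_sum {E : Type*} [AddCommMonoid E]
    {Φ : ℝ → EuclideanSpace ℝ (Fin d) → E} {R : ℝ}
    {s : Finset (FlowDomain.torus.lattice d)}
    (hs : ∀ k ∉ s, ∀ t, ∀ x ∈ Metric.ball 0 R, Φ t (x + k) = 0) (t : ℝ)
    {x : EuclideanSpace ℝ (Fin d)} (hx : x ∈ Metric.ball 0 R) :
    periodization Φ t x = ∑ k ∈ s, Φ t (x + k) := by
  refine finsum_eq_sum_of_support_subset _ fun k hk => ?_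
  by_contra hks
  exact hk (hs k hks t x hx)

lemma IsTestFunction.periodization {Φ : ℝ → EuclideanSpace ℝ (Fin d) → F}
    (hΦ : IsTestFunction .wholeSpace T Φ) : IsTestFunction .torus T (periodization Φ) where
  smooth := by
    rw [contDiff_iff_contDiffAt]
    rintro ⟨t, x⟩
    obtain ⟨s, hs⟩ := hΦ.exists_finset (‖x‖ + 1)
    have hev : Function.uncurry (_root_.periodization Φ) =ᶠ[𝓝 (t, x)]
        fun z => ∑ k ∈ s, Function.uncurry Φ (z.1, z.2 + k) := by
      have hx : (t, x) ∈ (univ : Set ℝ) ×ˢ Metric.ball (0 : EuclideanSpace ℝ (Fin d)) (‖x‖ + 1) := by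
        simp
      filter_upwards [(isOpen_univ.prod Metric.isOpen_ball).mem_nhds hx] with z hz
      exact periodization_eq_sum hs z.1 hz.2
    refine ContDiffAt.congr_of_eventuallyEq ?_ hev
    refine ContDiff.contDiffAt (ContDiff.sum fun k _ => hΦ.smooth.comp ?_)
    exact contDiff_fst.prodMk (contDiff_snd.add contDiff_const)
  periodic := by
    intro t k hk x
    let k' : FlowDomain.torus.lattice d := ⟨k, hk⟩
    unfold _root_.periodization
    refine Eq.trans (finsum_congr fun j => ?_) (finsum_comp_equiv (Equiv.addLeft k')
      (f := fun j : FlowDomain.torus.lattice d => Φ t (x + j)))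
    simp [k', add_assoc]
  compact_support := by
    obtain ⟨K, hK, hKs, h⟩ := hΦ.exists_isCompact_support
    refine ⟨K, hK, hKs, fun t x hne => ?_⟩
    by_contra hcon
    push Not at hcon
    refine hne ((finsum_congr fun k => ?_).trans finsum_zero)
    exact h _ (hcon k k.2)

lemma fderiv_periodization {Φ : ℝ → EuclideanSpace ℝ (Fin d) → F}
    (hΦ : IsTestFunction .wholeSpace T Φ) {R : ℝ}
    {s : Finset (FlowDomain.torus.lattice d)}
    (hs : ∀ k ∉ s, ∀ t, ∀ x ∈ Metric.ball 0 R, Φ t (x + k) = 0) (t : ℝ)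
    {x : EuclideanSpace ℝ (Fin d)} (hx : x ∈ Metric.ball 0 R) :
    fderiv ℝ (periodization Φ t) x = ∑ k ∈ s, fderiv ℝ (Φ t) (x + k) := by
  have hev : periodization Φ t =ᶠ[𝓝 x] fun y => ∑ k ∈ s, Φ t (y + k) := by
    filter_upwards [Metric.isOpen_ball.mem_nhds hx] with y hy using periodization_eq_sum hs t hy
  rw [hev.fderiv_eq, fderiv_fun_sum]
  · simp_rw [fderiv_comp_add_right]
  · intro k _
    exact ((contDiff_slice hΦ.smooth t).comp
      (contDiff_id.add contDiff_const)).differentiable (by simp) x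

lemma deriv_periodization {Φ : ℝ → EuclideanSpace ℝ (Fin d) → F}
    (hΦ : IsTestFunction .wholeSpace T Φ) {R : ℝ}
    {s : Finset (FlowDomain.torus.lattice d)}
    (hs : ∀ k ∉ s, ∀ t, ∀ x ∈ Metric.ball 0 R, Φ t (x + k) = 0) (t : ℝ)
    {x : EuclideanSpace ℝ (Fin d)} (hx : x ∈ Metric.ball 0 R) :
    deriv (fun r => periodization Φ r x) t = ∑ k ∈ s, deriv (fun r => Φ r (x + k)) t := by
  simp_rw [periodization_eq_sum hs _ hx]
  rw [deriv_fun_sum]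
  intro k _
  exact (hΦ.smooth.comp (contDiff_id.prodMk contDiff_const)).differentiable (by simp) t

/-- Unfolding: the integral over the torus of a periodized function is the integral over `ℝᵈ`. -/
lemma integral_prod_cell_sum {g : ℝ × EuclideanSpace ℝ (Fin d) → ℝ} (hg : Integrable g)
    (s : Finset (FlowDomain.torus.lattice d))
    (hs : ∀ k ∉ s, ∀ t, ∀ x ∈ FlowDomain.torus.cell d, g (t, x + k) = 0) :
    ∫ z in Ioo 0 T ×ˢ FlowDomain.torus.cell d, ∑ k ∈ s, g (z.1, z.2 + k) =
      ∫ z in Ioo 0 T ×ˢ univ, g z := by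
  have hg' : Integrable g ((volume.restrict (Ioo 0 T)).prod
      (volume : Measure (EuclideanSpace ℝ (Fin d)))) := by
    have := hg.integrableOn (s := Ioo 0 T ×ˢ univ)
    rwa [IntegrableOn, Measure.volume_eq_prod, ← Measure.prod_restrict, Measure.restrict_univ] at this
  have htr : ∀ k : EuclideanSpace ℝ (Fin d), Integrable (fun z => g (z.1, z.2 + k))
      ((volume.restrict (Ioo 0 T)).prod (volume : Measure (EuclideanSpace ℝ (Fin d)))) := fun k =>
    ((MeasurePreserving.id _).prod (measurePreserving_add_right volume k)).integrable_comp_of_integrable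
      hg'
  rw [Measure.volume_eq_prod, ← Measure.prod_restrict, ← Measure.prod_restrict,
    Measure.restrict_univ, integral_prod _ hg', integral_prod]
  · refine integral_congr_ae ?_
    have hslice := hg'.prod_right_ae
    filter_upwards [hslice] with t ht
    rw [(isAddFundamentalDomain_cell FlowDomain.torus).integral_eq_tsum'' _ ht,
      tsum_eq_sum (s := s), integral_finsetSum]
    · refine Finset.sum_congr rfl fun k _ => ?_
      simp [AddSubgroup.vadd_def, add_comm]
    · intro k _
      exact (ht.comp_add_right (k : EuclideanSpace ℝ (Fin d))).integrableOn
    · intro k hk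
      refine setIntegral_eq_zero_of_forall_eq_zero fun x hx => ?_
      rw [AddSubgroup.vadd_def, vadd_eq_add, add_comm]
      exact hs k hk t x hx
  · refine integrable_finsetSum _ fun k _ => ?_
    refine (htr k).mono_measure ?_
    exact Measure.prod_mono le_rfl Measure.restrict_le_self

lemma exists_torus_cell_subset_ball :
    ∃ R : ℝ, FlowDomain.torus.cell d ⊆ Metric.ball (0 : EuclideanSpace ℝ (Fin d)) R := by
  refine ⟨Real.sqrt d + 1, fun x hx => ?_⟩
  rw [mem_ball_zero_iff, EuclideanSpace.norm_eq]
  have : ∑ i, ‖x i‖ ^ 2 ≤ d := by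
    calc ∑ i, ‖x i‖ ^ 2 ≤ ∑ _i : Fin d, (1 : ℝ) := by
          refine Finset.sum_le_sum fun i _ => ?_
          have := hx i
          rw [Real.norm_eq_abs, sq_abs]
          nlinarith [this.1, this.2]
      _ = d := by simp
  linarith [Real.sqrt_le_sqrt this]

lemma fderiv_eq_zero_and_deriv_eq_zero_of_forall_ball {Φ : ℝ → EuclideanSpace ℝ (Fin d) → F}
    {R : ℝ} {s : Finset (FlowDomain.torus.lattice d)}
    (hs : ∀ k ∉ s, ∀ t, ∀ x ∈ Metric.ball 0 R, Φ t (x + k) = 0)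
    {k : FlowDomain.torus.lattice d} (hk : k ∉ s) (t : ℝ) {x : EuclideanSpace ℝ (Fin d)}
    (hx : x ∈ Metric.ball 0 R) :
    fderiv ℝ (Φ t) (x + k) = 0 ∧ deriv (fun r => Φ r (x + k)) t = 0 := by
  constructor
  · have hev : (fun y => Φ t (y + k)) =ᶠ[𝓝 x] fun _ => 0 := by
      filter_upwards [Metric.isOpen_ball.mem_nhds hx] with y hy using hs k hk t y hy
    rw [← fderiv_comp_add_right, hev.fderiv_eq]
    simp
  · simp [hs k hk _ x hx]

/-- A weak solution on the torus, seen as a periodic field on `ℝᵈ`, is a weak solution on `ℝᵈ`: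
periodize the test functions and unfold the integrals. -/
lemma IsWeakEulerSolution.wholeSpace_of_torus
    {v : ℝ → EuclideanSpace ℝ (Fin d) → EuclideanSpace ℝ (Fin d)}
    (hv : IsWeakEulerSolution .torus T v) : IsWeakEulerSolution .wholeSpace T v where
  periodic := by
    intro t k hk x
    have : k = 0 := hk
    simp [this]
  locally_square_integrable := hv.locally_square_integrable
  weakly_divergence_free := by
    intro ψ hψ
    obtain ⟨R, hR⟩ := exists_torus_cell_subset_ball (d := d)
    obtain ⟨s, hs⟩ := hψ.exists_finset R
    have h1 := hv.weakly_divergence_free _ hψ.periodization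
    have h2 := integral_prod_cell_sum (T := T)
      (hψ.integrable_fderiv_apply hv.locally_square_integrable) s fun k hk t x hx => by
        simp only [(fderiv_eq_zero_and_deriv_eq_zero_of_forall_ball hs hk t (hR hx)).1]
        simp
    change ∫ z in Ioo 0 T ×ˢ univ, _ = 0
    refine h2.symm.trans (Eq.trans ?_ h1)
    refine setIntegral_congr_fun (measurableSet_Ioo.prod (measurableSet_cell _)) fun z hz => ?_
    dsimp only
    rw [fderiv_periodization hψ hs z.1 (hR hz.2), sum_apply]
    refine Finset.sum_congr rfl fun k _ => ?_
    rw [hv.periodic z.1 k k.2]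
  momentum := by
    intro Φ hΦ hdiv
    obtain ⟨R, hR⟩ := exists_torus_cell_subset_ball (d := d)
    obtain ⟨s, hs⟩ := hΦ.exists_finset R
    have h1 := hv.momentum _ hΦ.periodization fun t x => by
      obtain ⟨s', hs'⟩ := hΦ.exists_finset (‖x‖ + 1)
      unfold divergence at hdiv ⊢
      rw [fderiv_periodization hΦ hs' t (by simp)]
      simp only [sum_apply, WithLp.ofLp_sum, Finset.sum_apply]
      rw [Finset.sum_comm]
      exact Finset.sum_eq_zero fun k _ => hdiv t _
    have h2 := integral_prod_cell_sum (T := T)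
      (hΦ.integrable_momentum hv.locally_square_integrable) s fun k hk t x hx => by
        simp only [(fderiv_eq_zero_and_deriv_eq_zero_of_forall_ball hs hk t (hR hx)).1,
          (fderiv_eq_zero_and_deriv_eq_zero_of_forall_ball hs hk t (hR hx)).2]
        simp
    change ∫ z in Ioo 0 T ×ˢ univ, _ = 0
    refine h2.symm.trans (Eq.trans ?_ h1)
    refine setIntegral_congr_fun (measurableSet_Ioo.prod (measurableSet_cell _)) fun z hz => ?_
    dsimp only
    rw [fderiv_periodization hΦ hs z.1 (hR hz.2), deriv_periodization hΦ hs z.1 (hR hz.2),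
      sum_apply, inner_sum, inner_sum, ← Finset.sum_add_distrib]
    refine Finset.sum_congr rfl fun k _ => ?_
    rw [hv.periodic z.1 k k.2]

end Periodization

/-! ### Shell kernels and their Laplacian potentials -/

section Kernel

/-- A smooth step from `0` (on `r ≤ 1`) to `1` (on `r ≥ 2`). -/
noncomputable def shellStep (r : ℝ) : ℝ := Real.smoothTransition (r - 1)

lemma contDiff_shellStep : ContDiff ℝ ∞ shellStep :=
  Real.smoothTransition.contDiff.comp (contDiff_id.sub contDiff_const)

lemma shellStep_of_le_one {r : ℝ} (hr : r ≤ 1) : shellStep r = 0 :=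
  Real.smoothTransition.zero_of_nonpos (by linarith)

lemma shellStep_of_two_le {r : ℝ} (hr : 2 ≤ r) : shellStep r = 1 :=
  Real.smoothTransition.one_of_one_le (by linarith)

lemma monotone_shellStep : Monotone shellStep :=
  fun _ _ h => Real.smoothTransition.monotone (by linarith)

lemma deriv_shellStep_of_lt_one {r : ℝ} (hr : r < 1) : deriv shellStep r = 0 := by
  have : shellStep =ᶠ[𝓝 r] fun _ => 0 := by
    filter_upwards [Iio_mem_nhds hr] with s hs using shellStep_of_le_one (le_of_lt hs)
  rw [this.deriv_eq]
  simp

lemma deriv_shellStep_of_two_lt {r : ℝ} (hr : 2 < r) : deriv shellStep r = 0 := by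
  have : shellStep =ᶠ[𝓝 r] fun _ => 1 := by
    filter_upwards [Ioi_mem_nhds hr] with s hs using shellStep_of_two_le (le_of_lt hs)
  rw [this.deriv_eq]
  simp

lemma contDiff_deriv_shellStep : ContDiff ℝ ∞ (deriv shellStep) :=
  (contDiff_infty_iff_deriv.1 contDiff_shellStep).2

/-- Away from the origin real powers do no harm to smoothness. -/
lemma contDiff_rpow_mul {f : ℝ → ℝ} (hf : ContDiff ℝ ∞ f) {a : ℝ} (ha : 0 < a)
    (hfa : ∀ r < a, f r = 0) (α : ℝ) : ContDiff ℝ ∞ fun r => r ^ α * f r := by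
  rw [contDiff_iff_contDiffAt]
  intro r
  rcases lt_or_ge r a with hr | hr
  · have : (fun r => r ^ α * f r) =ᶠ[𝓝 r] fun _ => 0 := by
      filter_upwards [Iio_mem_nhds hr] with s hs
      rw [hfa s hs, mul_zero]
    exact contDiffAt_const.congr_of_eventuallyEq this
  · exact (Real.contDiffAt_rpow_const_of_ne (by linarith : r ≠ 0)).mul hf.contDiffAt

variable (d : ℕ)

/-- A nonnegative radial bump supported in the shell `1 ≤ |z| ≤ √2`. It is the divergence of
`z ↦ shellStep |z|² • z / |z|ᵈ`, and this is what makes the difference of two of its rescalings the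
Laplacian of a compactly supported function. -/
noncomputable def shellKernel (z : EuclideanSpace ℝ (Fin d)) : ℝ :=
  2 * ((‖z‖ ^ 2) ^ (1 - (d : ℝ) / 2) * deriv shellStep (‖z‖ ^ 2))

lemma contDiff_shellKernel : ContDiff ℝ ∞ (shellKernel d) := by
  refine contDiff_const.mul ?_
  exact (contDiff_rpow_mul contDiff_deriv_shellStep one_pos
    (fun r hr => deriv_shellStep_of_lt_one hr) _).comp (contDiff_norm_sq ℝ)

lemma shellKernel_nonneg (z : EuclideanSpace ℝ (Fin d)) : 0 ≤ shellKernel d z := by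
  have : 0 ≤ deriv shellStep (‖z‖ ^ 2) := monotone_shellStep.deriv_nonneg
  unfold shellKernel
  positivity

lemma shellKernel_neg (z : EuclideanSpace ℝ (Fin d)) : shellKernel d (-z) = shellKernel d z := by
  simp [shellKernel]

lemma shellKernel_eq_zero {z : EuclideanSpace ℝ (Fin d)} (hz : 2 < ‖z‖) : shellKernel d z = 0 := by
  rw [shellKernel, deriv_shellStep_of_two_lt (by nlinarith), mul_zero, mul_zero]

lemma hasCompactSupport_shellKernel : HasCompactSupport (shellKernel d) := by
  refine HasCompactSupport.intro (isCompact_closedBall 0 2) fun z hz => ?_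
  exact shellKernel_eq_zero d (by simpa using hz)

variable {d}

/-- The rescaled kernel `K_s(z) = s⁻ᵈ K(z / s)`. -/
noncomputable def rescale (s : ℝ) (K : EuclideanSpace ℝ (Fin d) → ℝ)
    (z : EuclideanSpace ℝ (Fin d)) : ℝ :=
  (s ^ d)⁻¹ * K (s⁻¹ • z)

lemma integral_shellKernel_pos (hd : 1 ≤ d) : 0 < ∫ z, shellKernel d z := by
  obtain ⟨r, hr, hr0⟩ : ∃ r ∈ Ioo (1 : ℝ) 2, deriv shellStep r = (1 - 0) / (2 - 1) := by
    have := exists_deriv_eq_slope shellStep (by norm_num : (1 : ℝ) < 2)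
      contDiff_shellStep.continuous.continuousOn
      (contDiff_shellStep.differentiable (by simp)).differentiableOn
    simpa [shellStep_of_le_one le_rfl, shellStep_of_two_le le_rfl] using this
  have hr1 : (0 : ℝ) < r := by linarith [hr.1]
  refine (contDiff_shellKernel d).continuous.integral_pos_of_hasCompactSupport_nonneg_nonzero
    (hasCompactSupport_shellKernel d) (shellKernel_nonneg d)
    (x := Real.sqrt r • EuclideanSpace.single ⟨0, hd⟩ 1) ?_
  have hn : ‖Real.sqrt r • (EuclideanSpace.single ⟨0, hd⟩ 1 : EuclideanSpace ℝ (Fin d))‖ ^ 2 = r := by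
    rw [norm_smul, PiLp.norm_single, norm_one, mul_one, Real.norm_eq_abs, sq_abs,
      Real.sq_sqrt hr1.le]
  rw [shellKernel, hn, hr0]
  positivity

lemma rescale_shellKernel {s : ℝ} (hs : 0 < s) {z : EuclideanSpace ℝ (Fin d)} (hz : z ≠ 0) :
    rescale s (shellKernel d) z =
      2 * ((‖z‖ ^ 2) ^ (1 - (d : ℝ) / 2) * (deriv shellStep (‖z‖ ^ 2 / s ^ 2) / s ^ 2)) := by
  have hz' : 0 < ‖z‖ ^ 2 := by positivity
  have h1 : ‖s⁻¹ • z‖ ^ 2 = ‖z‖ ^ 2 / s ^ 2 := by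
    rw [norm_smul, norm_inv, Real.norm_eq_abs, abs_of_pos hs]
    field_simp
  have h2 : (s ^ 2) ^ (1 - (d : ℝ) / 2) = s ^ 2 / s ^ d := by
    rw [← Real.rpow_natCast s 2, ← Real.rpow_mul hs.le, ← Real.rpow_natCast s d,
      ← Real.rpow_sub hs]
    congr 1
    push_cast
    ring
  rw [rescale, shellKernel, h1, Real.div_rpow hz'.le (by positivity), h2]
  field_simp

/-- The derivative, as a function of `r = |z|²`, of a potential of the difference of two rescaled
shell kernels. -/
noncomputable def shellPotentialDeriv (d : ℕ) (l L r : ℝ) : ℝ :=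
  r ^ (-(d : ℝ) / 2) * ((shellStep (r / L ^ 2) - shellStep (r / l ^ 2)) / 2)

lemma contDiff_shellPotentialDeriv {l L : ℝ} (hl : 0 < l) (hL : l ≤ L) :
    ContDiff ℝ ∞ (shellPotentialDeriv d l L) := by
  refine contDiff_rpow_mul (f := fun r => (shellStep (r / L ^ 2) - shellStep (r / l ^ 2)) / 2)
    ?_ (a := l ^ 2) (by positivity) ?_ _
  · exact (((contDiff_shellStep.comp (contDiff_id.div_const _)).sub
      (contDiff_shellStep.comp (contDiff_id.div_const _))).div_const _)
  · intro r hr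
    have h1 : r / l ^ 2 ≤ 1 := by rw [div_le_one (by positivity)]; exact hr.le
    have h2 : r / L ^ 2 ≤ 1 := by
      have : 0 < L := by linarith
      rw [div_le_one (by positivity)]
      exact hr.le.trans (by gcongr)
    rw [shellStep_of_le_one h1, shellStep_of_le_one h2]
    simp

lemma shellPotentialDeriv_of_ge {l L r : ℝ} (hl : 0 < l) (hL : l ≤ L) (hr : 2 * L ^ 2 ≤ r) :
    shellPotentialDeriv d l L r = 0 := by
  have hL0 : 0 < L := by linarith
  have h2 : 2 ≤ r / L ^ 2 := by rw [le_div_iff₀ (by positivity)]; exact hr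
  have h1 : 2 ≤ r / l ^ 2 := by
    rw [le_div_iff₀ (by positivity)]
    exact le_trans (by gcongr) hr
  rw [shellPotentialDeriv, shellStep_of_two_le h1, shellStep_of_two_le h2]
  simp

/-- The Laplacian of `z ↦ g(|z|²)` is `4 r g''(r) + 2 d g'(r)` at `r = |z|²`; for `g'` equal to
`shellPotentialDeriv` it is the difference of two rescaled shell kernels. -/
lemma shellPotentialDeriv_ode {l L r : ℝ} (hr : 0 < r) :
    4 * r * deriv (shellPotentialDeriv d l L) r + 2 * d * shellPotentialDeriv d l L r =
      2 * (r ^ (1 - (d : ℝ) / 2) *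
        (deriv shellStep (r / L ^ 2) / L ^ 2 - deriv shellStep (r / l ^ 2) / l ^ 2)) := by
  have hP : ∀ a : ℝ, HasDerivAt (fun r => shellStep (r / a ^ 2))
      (deriv shellStep (r / a ^ 2) * (1 / a ^ 2)) r := fun a => by
    have h1 : HasDerivAt shellStep (deriv shellStep (r / a ^ 2)) (r / a ^ 2) :=
      (contDiff_shellStep.differentiable (by simp) _).hasDerivAt
    exact HasDerivAt.comp (h₂ := shellStep) (h := fun r => r / a ^ 2) r h1
      ((hasDerivAt_id r).div_const _)
  have h := ((Real.hasDerivAt_rpow_const (x := r) (p := -(d : ℝ) / 2) (Or.inl hr.ne')).mul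
    (((hP L).sub (hP l)).div_const 2)).deriv
  have h' : deriv (shellPotentialDeriv d l L) r = _ := h
  rw [h', shellPotentialDeriv]
  have e1 : r ^ (-(d : ℝ) / 2) = r * r ^ (-(d : ℝ) / 2 - 1) := by
    rw [Real.rpow_sub_one hr.ne']; field_simp
  have e2 : r ^ (1 - (d : ℝ) / 2) = r * (r * r ^ (-(d : ℝ) / 2 - 1)) := by
    rw [← e1, show (1 - (d : ℝ) / 2) = 1 + -(d : ℝ) / 2 by ring, Real.rpow_add hr, Real.rpow_one]
  rw [e2, e1]
  simp only [Pi.sub_apply]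
  ring

/-- The difference of two rescaled shell kernels is the Laplacian of a compactly supported smooth
function. -/
lemma exists_laplacian_eq_rescale_sub {l L : ℝ} (hl : 0 < l) (hL : l ≤ L) :
    ∃ G : EuclideanSpace ℝ (Fin d) → ℝ, ContDiff ℝ ∞ G ∧ HasCompactSupport G ∧
      ∀ z, ∑ i, fderiv ℝ (fun y => fderiv ℝ G y (EuclideanSpace.single i 1)) z
        (EuclideanSpace.single i 1) =
          rescale L (shellKernel d) z - rescale l (shellKernel d) z := by
  set q := shellPotentialDeriv d l L with hq
  have hqs : ContDiff ℝ ∞ q := contDiff_shellPotentialDeriv hl hL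
  have hL0 : 0 < L := by linarith
  set g : ℝ → ℝ := fun r => ∫ x in (2 * L ^ 2)..r, q x with hg
  have hgd : ∀ r, HasDerivAt g (q r) r := fun r =>
    (hqs.continuous.integral_hasStrictDerivAt _ r).hasDerivAt
  have hgs : ContDiff ℝ ∞ g := by
    rw [contDiff_infty_iff_deriv]
    exact ⟨fun r => (hgd r).differentiableAt, by rwa [funext fun r => (hgd r).deriv]⟩
  have hg0 : ∀ r, 2 * L ^ 2 ≤ r → g r = 0 := fun r hr => by
    refine intervalIntegral.integral_zero_ae (ae_of_all _ fun x hx => ?_)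
    rw [uIoc_of_le hr] at hx
    exact shellPotentialDeriv_of_ge hl hL hx.1.le
  have hnd : ∀ z : EuclideanSpace ℝ (Fin d), HasFDerivAt (fun z : EuclideanSpace ℝ (Fin d) =>
      ‖z‖ ^ 2) (2 • innerSL ℝ z) z := fun z => (hasStrictFDerivAt_norm_sq z).hasFDerivAt
  have hG1 : ∀ z w : EuclideanSpace ℝ (Fin d),
      fderiv ℝ (fun z => g (‖z‖ ^ 2)) z w = q (‖z‖ ^ 2) * (2 * inner ℝ z w) := fun z w => by
    have := ((hgd (‖z‖ ^ 2)).comp_hasFDerivAt z (hnd z)).fderiv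
    rw [Function.comp_def] at this
    rw [this]
    simp
  refine ⟨fun z => g (‖z‖ ^ 2), hgs.comp (contDiff_norm_sq ℝ), ?_, fun z => ?_⟩
  · refine HasCompactSupport.intro (isCompact_closedBall 0 (2 * L)) fun z hz => hg0 _ ?_
    have : 2 * L < ‖z‖ := by simpa using hz
    nlinarith
  · have hq' : HasDerivAt q (deriv q (‖z‖ ^ 2)) (‖z‖ ^ 2) :=
      (hqs.differentiable (by simp) _).hasDerivAt
    have hG2 : ∀ w : EuclideanSpace ℝ (Fin d),
        fderiv ℝ (fun y => fderiv ℝ (fun z => g (‖z‖ ^ 2)) y w) z w =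
          deriv q (‖z‖ ^ 2) * (4 * inner ℝ z w ^ 2) + 2 * q (‖z‖ ^ 2) * ‖w‖ ^ 2 := fun w => by
      simp_rw [hG1]
      have h1 := hq'.comp_hasFDerivAt z (hnd z)
      have h2 : HasFDerivAt (fun y : EuclideanSpace ℝ (Fin d) => 2 * (inner ℝ y w : ℝ))
          ((2 : ℝ) • innerSL ℝ w) z := by
        have := ((innerSL ℝ w).hasFDerivAt (x := z)).const_mul (2 : ℝ)
        refine this.congr_of_eventuallyEq (Eventually.of_forall fun y => ?_)
        simp [real_inner_comm]
      have h3 : fderiv ℝ (fun y : EuclideanSpace ℝ (Fin d) => q (‖y‖ ^ 2) * (2 * inner ℝ y w)) z = _ :=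
        (h1.mul h2).fderiv
      rw [h3]
      simp
      ring
    simp_rw [hG2]
    rw [Finset.sum_add_distrib, ← Finset.mul_sum, ← Finset.mul_sum]
    have hsum : ∑ i, (inner ℝ z (EuclideanSpace.single i (1 : ℝ)) : ℝ) ^ 2 = ‖z‖ ^ 2 := by
      rw [EuclideanSpace.norm_sq_eq]
      refine Finset.sum_congr rfl fun i _ => ?_
      simp [EuclideanSpace.inner_single_right]
    simp only [PiLp.norm_single, norm_one, one_pow, Finset.sum_const, Finset.card_univ,
      Fintype.card_fin, nsmul_eq_mul, mul_one, hsum]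
    rcases eq_or_ne z 0 with rfl | hz
    · have hq0 : q 0 = 0 := by
        rw [hq, shellPotentialDeriv, zero_div, zero_div, sub_self, zero_div, mul_zero]
      simp [rescale, shellKernel, deriv_shellStep_of_lt_one, hq0]
    · rw [rescale_shellKernel hL0 hz, rescale_shellKernel hl hz]
      have := shellPotentialDeriv_ode (d := d) (l := l) (L := L) (r := ‖z‖ ^ 2) (by positivity)
      rw [← hq] at this
      linear_combination this

end Kernel

/-! ### Solenoidal test fields -/

section ThirdDerivative

variable {E : Type*} [NormedAddCommGroup E] [NormedSpace ℝ E] {G : E → ℝ}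

lemma ContDiff.fderiv_infty {F : Type*} [NormedAddCommGroup F] [NormedSpace ℝ F] {f : E → F}
    (hf : ContDiff ℝ ∞ f) : ContDiff ℝ ∞ (fderiv ℝ f) :=
  hf.fderiv_right (by simp)

lemma ContDiff.snd_fderiv_comm {F : Type*} [NormedAddCommGroup F] [NormedSpace ℝ F] {f : E → F}
    (hf : ContDiff ℝ ∞ f) (z a b : E) :
    fderiv ℝ (fderiv ℝ f) z a b = fderiv ℝ (fderiv ℝ f) z b a :=
  (hf.contDiffAt.isSymmSndFDerivAt (by simp; exact WithTop.coe_le_coe.2 (le_top : (2 : ℕ∞) ≤ ⊤))).eq a b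

lemma ContDiff.fderiv_clm_apply_const {F : Type*} [NormedAddCommGroup F] [NormedSpace ℝ F]
    {f : E → E →L[ℝ] F}
    (hf : ContDiff ℝ ∞ f) (z a b : E) : fderiv ℝ (fun y => f y a) z b = fderiv ℝ f z b a := by
  have := ((hf.differentiable (by simp) z).hasFDerivAt.clm_apply (hasFDerivAt_const a z)).fderiv
  rw [this]
  simp

/-- The third derivative is symmetric; only the rotation of its arguments is needed. -/
lemma ContDiff.third_fderiv_rotate (hG : ContDiff ℝ ∞ G) (z a b c : E) :
    fderiv ℝ (fderiv ℝ (fderiv ℝ G)) z a b c = fderiv ℝ (fderiv ℝ (fderiv ℝ G)) z c a b := by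
  have h1 : ∀ a b c, fderiv ℝ (fderiv ℝ (fderiv ℝ G)) z a b c =
      fderiv ℝ (fderiv ℝ (fderiv ℝ G)) z a c b := fun a b c => by
    have e : ∀ b c : E, fderiv ℝ (fun y => fderiv ℝ (fderiv ℝ G) y b c) z a =
        fderiv ℝ (fderiv ℝ (fderiv ℝ G)) z a b c := fun b c => by
      have h2 : ContDiff ℝ ∞ fun y => fderiv ℝ (fderiv ℝ G) y b :=
        hG.fderiv_infty.fderiv_infty.clm_apply contDiff_const
      rw [h2.fderiv_clm_apply_const, hG.fderiv_infty.fderiv_infty.fderiv_clm_apply_const]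
    rw [← e, ← e]
    simp_rw [hG.snd_fderiv_comm _ b c]
  rw [h1, hG.fderiv_infty.snd_fderiv_comm]

end ThirdDerivative

lemma fderiv_sub_right {E F : Type*} [NormedAddCommGroup E] [NormedSpace ℝ E]
    [NormedAddCommGroup F] [NormedSpace ℝ F] (f : E → F) (x y : E) :
    fderiv ℝ (fun x => f (x - y)) x = fderiv ℝ f (x - y) := by
  simp_rw [sub_eq_add_neg]
  exact fderiv_comp_add_right _

section WeakIdentities

variable {d : ℕ} {T : ℝ}

lemma isTestFunction_smul {F : Type*} [NormedAddCommGroup F] [NormedSpace ℝ F] {θ : ℝ → ℝ}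
    (hθ : ContDiff ℝ ∞ θ) (hθc : HasCompactSupport θ) (hθT : tsupport θ ⊆ Ioo 0 T)
    {M : EuclideanSpace ℝ (Fin d) → F} (hM : ContDiff ℝ ∞ M) (hMc : HasCompactSupport M)
    (y : EuclideanSpace ℝ (Fin d)) :
    IsTestFunction .wholeSpace T fun t x => θ t • M (x - y) where
  smooth := (hθ.comp contDiff_fst).smul (hM.comp (contDiff_snd.sub contDiff_const))
  periodic := by
    intro t k hk x
    have : k = 0 := hk
    simp [this]
  compact_support := by
    refine ⟨tsupport θ ×ˢ ((fun z => z + y) '' tsupport M),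
      hθc.isCompact.prod (hMc.isCompact.image (by fun_prop)),
      prod_mono hθT (subset_univ _), fun t x hne => ⟨0, rfl, ?_⟩⟩
    refine ⟨subset_tsupport _ fun h => hne (by simp [h]), x - y,
      subset_tsupport _ fun h => hne (by simp [h]), by simp⟩

variable {v : ℝ → EuclideanSpace ℝ (Fin d) → EuclideanSpace ℝ (Fin d)}

/-- The field `∇(∂_w G) - (ΔG) w`, where `K` stands for `-ΔG`; it is divergence free when this
holds. It turns the multiple `K w` of a constant vector into a solenoidal field, at the price of second
derivatives of `G` whose contribution disappears since the velocity is itself divergence free. -/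
noncomputable def solenoidalField (G K : EuclideanSpace ℝ (Fin d) → ℝ)
    (w z : EuclideanSpace ℝ (Fin d)) : EuclideanSpace ℝ (Fin d) :=
  ∑ i, fderiv ℝ (fderiv ℝ G) z (EuclideanSpace.single i 1) w •
    (EuclideanSpace.single i 1 : EuclideanSpace ℝ (Fin d)) + K z • w

variable {G K : EuclideanSpace ℝ (Fin d) → ℝ}

lemma clm_apply_eq_sum {F : Type*} [NormedAddCommGroup F] [NormedSpace ℝ F]
    (A : EuclideanSpace ℝ (Fin d) →L[ℝ] F) (a : EuclideanSpace ℝ (Fin d)) :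
    A a = ∑ i, a i • A (EuclideanSpace.single i 1) := by
  have : a = ∑ i, a i • (EuclideanSpace.single i 1 : EuclideanSpace ℝ (Fin d)) := by
    ext j
    simp [Finset.sum_apply, Pi.single_apply]
  conv_lhs => rw [this]
  simp

lemma inner_solenoidalField (a w z : EuclideanSpace ℝ (Fin d)) :
    inner ℝ a (solenoidalField G K w z) =
      fderiv ℝ (fderiv ℝ G) z a w + K z * inner ℝ a w := by
  rw [solenoidalField, inner_add_right, inner_sum, real_inner_smul_right,
    clm_apply_eq_sum (fderiv ℝ (fderiv ℝ G) z) a, sum_apply]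
  congr 1
  refine Finset.sum_congr rfl fun i _ => ?_
  simp [real_inner_smul_right, EuclideanSpace.inner_single_right, mul_comm]

lemma contDiff_solenoidalField (hG : ContDiff ℝ ∞ G) (hK : ContDiff ℝ ∞ K)
    (w : EuclideanSpace ℝ (Fin d)) : ContDiff ℝ ∞ (solenoidalField G K w) := by
  refine ContDiff.add (ContDiff.sum fun i _ => ?_) (hK.smul contDiff_const)
  exact ((hG.fderiv_infty.fderiv_infty.clm_apply contDiff_const).clm_apply contDiff_const).smul
    contDiff_const

lemma hasCompactSupport_solenoidalField (hG : HasCompactSupport G) (hK : HasCompactSupport K)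
    (w : EuclideanSpace ℝ (Fin d)) : HasCompactSupport (solenoidalField G K w) := by
  refine HasCompactSupport.intro ((hG.fderiv ℝ).fderiv ℝ |>.isCompact.union hK.isCompact)
    fun z hz => ?_
  have h1 : fderiv ℝ (fderiv ℝ G) z = 0 :=
    image_eq_zero_of_notMem_tsupport fun h => hz (Or.inl h)
  have h2 : K z = 0 := image_eq_zero_of_notMem_tsupport fun h => hz (Or.inr h)
  simp [solenoidalField, h1, h2]

lemma inner_fderiv_solenoidalField (hG : ContDiff ℝ ∞ G) (hK : ContDiff ℝ ∞ K)
    (a b w z : EuclideanSpace ℝ (Fin d)) :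
    inner ℝ a (fderiv ℝ (solenoidalField G K w) z b) =
      fderiv ℝ (fderiv ℝ (fderiv ℝ G)) z b a w + fderiv ℝ K z b * inner ℝ a w := by
  have h1 : fderiv ℝ (fun y => inner ℝ a (solenoidalField G K w y)) z b =
      inner ℝ a (fderiv ℝ (solenoidalField G K w) z b) := by
    have := ((hasFDerivAt_const a z).inner ℝ
      ((contDiff_solenoidalField hG hK w).differentiable (by simp) z).hasFDerivAt).fderiv
    rw [this]
    simp [fderivInnerCLM_apply]
  have h2 : ContDiff ℝ ∞ fun y => fderiv ℝ (fderiv ℝ G) y a :=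
    hG.fderiv_infty.fderiv_infty.clm_apply contDiff_const
  have h3 : ContDiff ℝ ∞ fun y => fderiv ℝ (fderiv ℝ G) y a w := h2.clm_apply contDiff_const
  rw [← h1]
  simp_rw [inner_solenoidalField]
  rw [fderiv_fun_add (h3.differentiable (by simp) z)
    ((hK.differentiable (by simp) z).mul_const _), add_apply, h2.fderiv_clm_apply_const,
    hG.fderiv_infty.fderiv_infty.fderiv_clm_apply_const,
    fderiv_mul_const (hK.differentiable (by simp) z)]
  simp [mul_comm]

lemma divergence_solenoidalField (hG : ContDiff ℝ ∞ G) (hK : ContDiff ℝ ∞ K)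
    (hGK : ∀ z, K z = -∑ i, fderiv ℝ (fderiv ℝ G) z (EuclideanSpace.single i 1)
      (EuclideanSpace.single i 1))
    (w z : EuclideanSpace ℝ (Fin d)) : divergence (solenoidalField G K w) z = 0 := by
  have hc : ∀ i, fderiv ℝ (solenoidalField G K w) z (EuclideanSpace.single i 1) i =
      fderiv ℝ (fderiv ℝ (fderiv ℝ G)) z w (EuclideanSpace.single i 1) (EuclideanSpace.single i 1)
        + w i * fderiv ℝ K z (EuclideanSpace.single i 1) := fun i => by
    have := inner_fderiv_solenoidalField hG hK (EuclideanSpace.single i 1)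
      (EuclideanSpace.single i 1) w z
    rw [hG.third_fderiv_rotate] at this
    simpa [EuclideanSpace.inner_single_left, mul_comm] using this
  have hKd : fderiv ℝ K z w = -∑ i, fderiv ℝ (fderiv ℝ (fderiv ℝ G)) z w
      (EuclideanSpace.single i 1) (EuclideanSpace.single i 1) := by
    have h2 : ∀ i, ContDiff ℝ ∞ fun y => fderiv ℝ (fderiv ℝ G) y (EuclideanSpace.single i 1) :=
      fun i => hG.fderiv_infty.fderiv_infty.clm_apply contDiff_const
    rw [funext hGK, fderiv_fun_neg, fderiv_fun_sum]
    · simp only [neg_apply, sum_apply]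
      congr 1
      refine Finset.sum_congr rfl fun i _ => ?_
      rw [(h2 i).fderiv_clm_apply_const, hG.fderiv_infty.fderiv_infty.fderiv_clm_apply_const]
    · exact fun i _ => ((h2 i).clm_apply contDiff_const).differentiable (by simp) z
  unfold divergence
  simp_rw [hc]
  rw [Finset.sum_add_distrib]
  have := clm_apply_eq_sum (fderiv ℝ K z) w
  simp only [smul_eq_mul] at this
  rw [← this, hKd]
  ring

/-- The momentum equation tested with the fields `solenoidalField G K w (· - y)`. -/
lemma IsWeakEulerSolution.integral_solenoidalField
    (hv : IsWeakEulerSolution .wholeSpace T v) (hG : ContDiff ℝ ∞ G) (hK : ContDiff ℝ ∞ K)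
    (hGc : HasCompactSupport G) (hKc : HasCompactSupport K)
    (hGK : ∀ z, K z = -∑ i, fderiv ℝ (fderiv ℝ G) z (EuclideanSpace.single i 1)
      (EuclideanSpace.single i 1))
    {θ : ℝ → ℝ} (hθ : ContDiff ℝ ∞ θ) (hθc : HasCompactSupport θ) (hθT : tsupport θ ⊆ Ioo 0 T)
    (y w : EuclideanSpace ℝ (Fin d)) :
    ∫ z in Ioo 0 T ×ˢ univ, (deriv θ z.1 * (K (z.2 - y) * inner ℝ (v z.1 z.2) w) +
      θ z.1 * (fderiv ℝ K (z.2 - y) (v z.1 z.2) * inner ℝ (v z.1 z.2) w +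
        fderiv ℝ (fderiv ℝ (fderiv ℝ G)) (z.2 - y) (v z.1 z.2) (v z.1 z.2) w)) = 0 := by
  have hM := contDiff_solenoidalField hG hK w
  have hΦ := isTestFunction_smul hθ hθc hθT hM (hasCompactSupport_solenoidalField hGc hKc w) y
  have hg : ContDiff ℝ ∞ fun z => fderiv ℝ G z w := hG.fderiv_infty.clm_apply contDiff_const
  have hgc : HasCompactSupport fun z => fderiv ℝ G z w := hGc.fderiv_apply ℝ w
  have hθ' : ContDiff ℝ ∞ (deriv θ) := (contDiff_infty_iff_deriv.1 hθ).2
  have hψ := isTestFunction_smul hθ' hθc.deriv ((tsupport_deriv_subset).trans hθT) hg hgc y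
  have h1 := hv.momentum _ hΦ fun t x => by
    have hd : Differentiable ℝ fun x => solenoidalField G K w (x - y) :=
      (hM.comp (contDiff_id.sub contDiff_const)).differentiable (by simp)
    have := divergence_solenoidalField hG hK hGK w (x - y)
    unfold divergence at this ⊢
    rw [fderiv_fun_const_smul (hd x), fderiv_sub_right (solenoidalField G K w)]
    simp only [smul_apply, PiLp.smul_apply, smul_eq_mul]
    rw [← Finset.mul_sum, this, mul_zero]
  have h2 := hv.weakly_divergence_free _ hψ
  have i1 := (hΦ.integrable_momentum hv.locally_square_integrable).integrableOn
    (s := Ioo 0 T ×ˢ univ)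
  have i2 := (hψ.integrable_fderiv_apply hv.locally_square_integrable).integrableOn
    (s := Ioo 0 T ×ˢ univ)
  change ∫ z in Ioo 0 T ×ˢ univ, _ = 0 at h1 h2
  have h3 := integral_sub i1 i2
  rw [h1, h2, sub_zero] at h3
  refine Eq.trans (integral_congr_ae (ae_of_all _ fun z => ?_)) h3
  dsimp only
  have hd : DifferentiableAt ℝ (fun x => solenoidalField G K w (x - y)) z.2 :=
    (hM.comp (contDiff_id.sub contDiff_const)).differentiable (by simp) z.2
  have hd2 : DifferentiableAt ℝ (fun x => fderiv ℝ G (x - y) w) z.2 :=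
    (hg.comp (contDiff_id.sub contDiff_const)).differentiable (by simp) z.2
  rw [deriv_smul_const (hθ.differentiable (by simp) z.1), fderiv_fun_const_smul hd,
    fderiv_sub_right (f := solenoidalField G K w), smul_apply, real_inner_smul_right,
    real_inner_smul_right,
    inner_solenoidalField, inner_fderiv_solenoidalField hG hK, fderiv_fun_const_smul hd2,
    fderiv_sub_right (f := fun z => fderiv ℝ G z w), smul_apply,
    hG.fderiv_infty.fderiv_clm_apply_const, smul_eq_mul]
  ring

/-- The weak divergence condition for vector-valued test functions `θ(t) g(x - y)`, obtained from
the scalar one by duality. -/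
lemma IsWeakEulerSolution.setIntegral_smul_fderiv
    (hv : IsWeakEulerSolution .wholeSpace T v) {F : Type*} [NormedAddCommGroup F]
    [NormedSpace ℝ F] [CompleteSpace F]
    {g : EuclideanSpace ℝ (Fin d) → F} (hg : ContDiff ℝ ∞ g) (hgc : HasCompactSupport g)
    {θ : ℝ → ℝ} (hθ : ContDiff ℝ ∞ θ) (hθc : HasCompactSupport θ) (hθT : tsupport θ ⊆ Ioo 0 T)
    (y : EuclideanSpace ℝ (Fin d)) :
    Integrable (fun z : ℝ × EuclideanSpace ℝ (Fin d) =>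
      θ z.1 • fderiv ℝ g (z.2 - y) (v z.1 z.2)) ∧
    ∫ z in Ioo 0 T ×ˢ univ, θ z.1 • fderiv ℝ g (z.2 - y) (v z.1 z.2) = 0 := by
  have hK : IsCompact (tsupport θ ×ˢ ((fun z => z + y) '' tsupport g)) :=
    hθc.isCompact.prod (hgc.isCompact.image (by fun_prop))
  have hint : Integrable (fun z : ℝ × EuclideanSpace ℝ (Fin d) =>
      θ z.1 • fderiv ℝ g (z.2 - y) (v z.1 z.2)) := by
    refine integrable_clm_apply_of_memLp hK (hv.locally_square_integrable _ hK
      (prod_mono hθT (subset_univ _))) (c := fun z => θ z.1 • fderiv ℝ g (z.2 - y)) ?_ ?_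
    · exact (hθ.continuous.comp continuous_fst).smul
        ((hg.continuous_fderiv (by simp)).comp (by fun_prop))
    · rintro ⟨t, x⟩ hz
      by_cases ht : t ∈ tsupport θ
      · have hx : x - y ∉ tsupport g := fun hx => hz ⟨ht, x - y, hx, by simp⟩
        have : fderiv ℝ g (x - y) = 0 :=
          image_eq_zero_of_notMem_tsupport fun h => hx (tsupport_fderiv_subset ℝ h)
        simp [this]
      · simp [image_eq_zero_of_notMem_tsupport ht]
  refine ⟨hint, SeparatingDual.eq_zero_of_forall_dual_eq_zero (R := ℝ) fun f => ?_⟩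
  rw [← f.integral_comp_comm hint.integrableOn]
  have hfg : ContDiff ℝ ∞ fun z => f (g z) := f.contDiff.comp hg
  have hψ := isTestFunction_smul hθ hθc hθT hfg (hgc.comp_left (g := f) (map_zero f)) y
  have h2 := hv.weakly_divergence_free _ hψ
  change ∫ z in Ioo 0 T ×ˢ univ, _ = 0 at h2
  refine Eq.trans (integral_congr_ae (ae_of_all _ fun z => ?_)) h2
  dsimp only
  have hd2 : DifferentiableAt ℝ (fun x => f (g (x - y))) z.2 :=
    (hfg.comp (contDiff_id.sub contDiff_const)).differentiable (by simp) z.2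
  rw [fderiv_fun_const_smul hd2, fderiv_sub_right (f := fun z => f (g z)), smul_apply]
  have hfd : fderiv ℝ (fun z => f (g z)) (z.2 - y) = f.comp (fderiv ℝ g (z.2 - y)) :=
    (f.hasFDerivAt.comp _ (hg.differentiable (by simp) (z.2 - y)).hasFDerivAt).fderiv
  rw [hfd]
  simp

/-- The weak divergence condition at almost every time, tested with vector-valued functions. -/
lemma IsWeakEulerSolution.ae_integral_fderiv_eq_zero
    (hv : IsWeakEulerSolution .wholeSpace T v) {F : Type*} [NormedAddCommGroup F]
    [NormedSpace ℝ F] [CompleteSpace F]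
    {g : EuclideanSpace ℝ (Fin d) → F} (hg : ContDiff ℝ ∞ g) (hgc : HasCompactSupport g)
    (y : EuclideanSpace ℝ (Fin d)) :
    ∀ᵐ t, t ∈ Ioo 0 T → ∫ x, fderiv ℝ g (x - y) (v t x) = 0 := by
  refine isOpen_Ioo.ae_eq_zero_of_integral_contDiff_smul_eq_zero ?_ fun θ hθ hθc hθT => ?_
  · rw [locallyIntegrableOn_iff isOpen_Ioo.isLocallyClosed]
    intro k hkT hk
    have hK : IsCompact (k ×ˢ ((fun z => z + y) '' tsupport g)) :=
      hk.prod (hgc.isCompact.image (by fun_prop))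
    have h1 := integrableOn_clm_apply_of_memLp hK (hv.locally_square_integrable _ hK
      (prod_mono hkT (subset_univ _)))
      (c := fun z : ℝ × EuclideanSpace ℝ (Fin d) => fderiv ℝ g (z.2 - y))
      ((hg.continuous_fderiv (by simp)).comp (by fun_prop))
    have h2 : IntegrableOn (fun z : ℝ × EuclideanSpace ℝ (Fin d) =>
        fderiv ℝ g (z.2 - y) (Function.uncurry v z)) (k ×ˢ univ) volume := by
      refine h1.of_forall_sdiff_eq_zero (hk.measurableSet.prod MeasurableSet.univ) ?_
      rintro ⟨t, x⟩ hz
      have hx : x - y ∉ tsupport g := fun hx => hz.2 ⟨hz.1.1, x - y, hx, by simp⟩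
      have : fderiv ℝ g (x - y) = 0 :=
        image_eq_zero_of_notMem_tsupport fun h => hx (tsupport_fderiv_subset ℝ h)
      simp [this]
    rw [IntegrableOn, Measure.volume_eq_prod, ← Measure.prod_restrict, Measure.restrict_univ] at h2
    exact h2.integral_prod_left
  · obtain ⟨hint, h0⟩ := hv.setIntegral_smul_fderiv hg hgc hθ hθc hθT y
    have hint' := hint.integrableOn (s := Ioo 0 T ×ˢ univ)
    rw [IntegrableOn, Measure.volume_eq_prod, ← Measure.prod_restrict,
      Measure.restrict_univ] at hint'
    rw [Measure.volume_eq_prod, ← Measure.prod_restrict, Measure.restrict_univ,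
      integral_prod _ hint'] at h0
    simp_rw [integral_smul] at h0
    rw [← h0, setIntegral_eq_integral_of_forall_compl_eq_zero]
    intro t ht
    rw [image_eq_zero_of_notMem_tsupport fun h => ht (hθT h), zero_smul]

end WeakIdentities

/-! ### Pairings of two velocity fields -/

section Holder

variable {α : Type*} [MeasurableSpace α] {ν : Measure α}

/-- Hölder's inequality with exponents `(m + 1) / m` and `m + 1`, in a form valid for `m = 0`. -/
lemma lintegral_pow_mul_le (m : ℕ) {f g : α → ℝ≥0∞} (hf : AEMeasurable f ν)
    (hg : AEMeasurable g ν) :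
    ∫⁻ x, f x ^ m * g x ∂ν ≤
      ((∫⁻ x, f x ^ (m + 1) ∂ν) ^ (1 / ((m : ℝ) + 1))) ^ m *
        (∫⁻ x, g x ^ (m + 1) ∂ν) ^ (1 / ((m : ℝ) + 1)) := by
  have hm : (0 : ℝ) < m + 1 := by positivity
  have h := ENNReal.lintegral_mul_norm_pow_le (μ := ν) (f := fun x => f x ^ (m + 1))
    (g := fun x => g x ^ (m + 1)) (hf.pow_const _) (hg.pow_const _)
    (p := m / ((m : ℝ) + 1)) (q := 1 / ((m : ℝ) + 1)) (by positivity) (by positivity)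
    (by field_simp)
  have e1 : ∀ a : ℝ≥0∞, (a ^ (m + 1)) ^ (m / ((m : ℝ) + 1)) = a ^ m := fun a => by
    rw [← ENNReal.rpow_natCast, ← ENNReal.rpow_mul, ← ENNReal.rpow_natCast a m]
    congr 1
    push_cast
    field_simp
  have e2 : ∀ a : ℝ≥0∞, (a ^ (m + 1)) ^ (1 / ((m : ℝ) + 1)) = a := fun a => by
    rw [← ENNReal.rpow_natCast, ← ENNReal.rpow_mul]
    push_cast
    rw [mul_one_div_cancel hm.ne', ENNReal.rpow_one]
  have e3 : ∀ a : ℝ≥0∞, a ^ (m / ((m : ℝ) + 1)) = (a ^ (1 / ((m : ℝ) + 1))) ^ m := fun a => by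
    rw [← ENNReal.rpow_natCast (a ^ (1 / ((m : ℝ) + 1))), ← ENNReal.rpow_mul]
    congr 1
    ring
  simp_rw [e1, e2, e3] at h
  exact h

lemma eLpNorm_natCast_add_one {F : Type*} [NormedAddCommGroup F] (m : ℕ) (f : α → F) :
    eLpNorm f (m + 1 : ℕ) ν = (∫⁻ x, ‖f x‖ₑ ^ (m + 1) ∂ν) ^ (1 / ((m : ℝ) + 1)) := by
  rw [eLpNorm_eq_lintegral_rpow_enorm_toReal (by simp) (by simp)]
  simp only [ENNReal.toReal_natCast, ENNReal.rpow_natCast]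
  push_cast
  rfl

lemma lintegral_enorm_pow_eq {F : Type*} [NormedAddCommGroup F] (m : ℕ) (f : α → F) :
    ∫⁻ x, ‖f x‖ₑ ^ (m + 1) ∂ν = eLpNorm f (m + 1 : ℕ) ν ^ (m + 1) := by
  have hm : (0 : ℝ) < m + 1 := by positivity
  rw [eLpNorm_natCast_add_one, ← ENNReal.rpow_natCast, ← ENNReal.rpow_mul]
  push_cast
  rw [one_div_mul_cancel hm.ne', ENNReal.rpow_one]

lemma lintegral_enorm_pow_mul_le {F F' : Type*} [NormedAddCommGroup F] [NormedAddCommGroup F']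
    (m : ℕ) {f : α → F} {g : α → F'} (hf : AEStronglyMeasurable f ν)
    (hg : AEStronglyMeasurable g ν) :
    ∫⁻ x, ‖f x‖ₑ ^ m * ‖g x‖ₑ ∂ν ≤ eLpNorm f (m + 1 : ℕ) ν ^ m * eLpNorm g (m + 1 : ℕ) ν := by
  rw [eLpNorm_natCast_add_one, eLpNorm_natCast_add_one]
  exact lintegral_pow_mul_le m hf.enorm hg.enorm

end Holder

section Pairing

variable {d : ℕ}

/-- A kernel `Ψ(h, a)` with values in the linear functionals on `ℝᵈ`, of order `m` in `a` and
integrable in `h`. Only the orders `m = 1` (correlation) and `m = 2` (its weak time derivative)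
occur, and the fields are then in `L^{m + 1}`. -/
structure IsPairingKernel (m : ℕ)
    (Ψ : EuclideanSpace ℝ (Fin d) → EuclideanSpace ℝ (Fin d) → EuclideanSpace ℝ (Fin d) →L[ℝ] ℝ)
    (k : EuclideanSpace ℝ (Fin d) → ℝ) : Prop where
  continuous : Continuous (Function.uncurry Ψ)
  norm_le : ∀ h a, ‖Ψ h a‖ ≤ k h * ‖a‖ ^ m
  integrable : Integrable k

/-- The pairing `∫_h ∫_{y ∈ Ω} Ψ(h, f(y + h)) (g(y))` of two fields on `Ω`. -/
noncomputable def cellPairing (Ω : FlowDomain)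
    (Ψ : EuclideanSpace ℝ (Fin d) → EuclideanSpace ℝ (Fin d) → EuclideanSpace ℝ (Fin d) →L[ℝ] ℝ)
    (f g : EuclideanSpace ℝ (Fin d) → EuclideanSpace ℝ (Fin d)) : ℝ :=
  ∫ h, ∫ y in Ω.cell d, Ψ h (f (y + h)) (g y)

lemma quasiMeasurePreserving_add_swap (Ω : FlowDomain) :
    Measure.QuasiMeasurePreserving
      (fun p : EuclideanSpace ℝ (Fin d) × EuclideanSpace ℝ (Fin d) => p.2 + p.1)
      (volume.prod (volume.restrict (Ω.cell d))) volume := by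
  have h1 : Measure.QuasiMeasurePreserving
      (fun p : EuclideanSpace ℝ (Fin d) × EuclideanSpace ℝ (Fin d) => p.2 + p.1)
      (volume.prod volume) volume := by
    have h2 := (measurePreserving_prod_add (volume : Measure (EuclideanSpace ℝ (Fin d)))
      volume).quasiMeasurePreserving
    have h3 := Measure.quasiMeasurePreserving_snd.comp h2
    simpa [Function.comp_def, add_comm] using h3
  exact h1.mono_left (Measure.AbsolutelyContinuous.prod (Measure.AbsolutelyContinuous.refl _)
    Measure.restrict_le_self.absolutelyContinuous)

variable {Ω : FlowDomain} {m : ℕ}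
  {Ψ : EuclideanSpace ℝ (Fin d) → EuclideanSpace ℝ (Fin d) → EuclideanSpace ℝ (Fin d) →L[ℝ] ℝ}
  {k : EuclideanSpace ℝ (Fin d) → ℝ} {f g : EuclideanSpace ℝ (Fin d) → EuclideanSpace ℝ (Fin d)}

namespace IsPairingKernel

lemma aestronglyMeasurable_comp (hΨ : IsPairingKernel m Ψ k) {X : Type*} [MeasurableSpace X]
    {ν : Measure X} {a b c : X → EuclideanSpace ℝ (Fin d)} (ha : AEStronglyMeasurable a ν)
    (hb : AEStronglyMeasurable b ν) (hc : AEStronglyMeasurable c ν) :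
    AEStronglyMeasurable (fun x => Ψ (a x) (b x) (c x)) ν :=
  isBoundedBilinearMap_apply.continuous.comp_aestronglyMeasurable
    ((hΨ.continuous.comp_aestronglyMeasurable (ha.prodMk hb)).prodMk hc)

lemma enorm_apply_le (hΨ : IsPairingKernel m Ψ k) (h a b : EuclideanSpace ℝ (Fin d)) :
    ‖Ψ h a b‖ₑ ≤ ‖k h‖ₑ * (‖a‖ₑ ^ m * ‖b‖ₑ) := by
  have h1 : ‖Ψ h a b‖ ≤ ‖k h‖ * (‖a‖ ^ m * ‖b‖) := by
    refine ((Ψ h a).le_opNorm b).trans ?_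
    rw [← mul_assoc]
    gcongr
    refine (hΨ.norm_le h a).trans ?_
    gcongr
    exact le_abs_self _
  rw [← ofReal_norm, ← ofReal_norm, ← ofReal_norm, ← ofReal_norm,
    ← ENNReal.ofReal_pow (norm_nonneg _), ← ENNReal.ofReal_mul (by positivity),
    ← ENNReal.ofReal_mul (by positivity)]
  exact ENNReal.ofReal_le_ofReal h1

lemma aestronglyMeasurable_prod (hΨ : IsPairingKernel m Ψ k) (hf : AEStronglyMeasurable f volume)
    (hg : AEStronglyMeasurable g (volume.restrict (Ω.cell d))) :
    AEStronglyMeasurable (fun p : EuclideanSpace ℝ (Fin d) × EuclideanSpace ℝ (Fin d) =>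
      Ψ p.1 (f (p.2 + p.1)) (g p.2)) (volume.prod (volume.restrict (Ω.cell d))) :=
  hΨ.aestronglyMeasurable_comp continuous_fst.aestronglyMeasurable
    (hf.comp_quasiMeasurePreserving (quasiMeasurePreserving_add_swap Ω)) hg.comp_snd

lemma lintegral_le (hΨ : IsPairingKernel m Ψ k) (hfp : IsFunctionOn Ω f)
    (hf : AEStronglyMeasurable f volume)
    (hg : AEStronglyMeasurable g (volume.restrict (Ω.cell d))) :
    ∫⁻ h, ∫⁻ y in Ω.cell d, ‖Ψ h (f (y + h)) (g y)‖ₑ ≤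
      (∫⁻ h, ‖k h‖ₑ) * (eLpNorm f (m + 1 : ℕ) (volume.restrict (Ω.cell d)) ^ m *
        eLpNorm g (m + 1 : ℕ) (volume.restrict (Ω.cell d))) := by
  rw [← lintegral_mul_const'' _ hΨ.integrable.1.enorm]
  refine lintegral_mono fun h => ?_
  have hfh : AEStronglyMeasurable (fun y => f (y + h)) (volume.restrict (Ω.cell d)) :=
    (hf.comp_measurePreserving (measurePreserving_add_right volume h)).restrict
  calc ∫⁻ y in Ω.cell d, ‖Ψ h (f (y + h)) (g y)‖ₑ
      ≤ ∫⁻ y in Ω.cell d, ‖k h‖ₑ * (‖f (y + h)‖ₑ ^ m * ‖g y‖ₑ) :=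
        lintegral_mono fun y => hΨ.enorm_apply_le _ _ _
    _ = ‖k h‖ₑ * ∫⁻ y in Ω.cell d, ‖f (y + h)‖ₑ ^ m * ‖g y‖ₑ :=
        lintegral_const_mul' _ _ enorm_ne_top
    _ ≤ _ := by
        gcongr
        rw [← FlowDomain.eLpNorm_cell_add hfp (by simp) (by simp) h]
        exact lintegral_enorm_pow_mul_le m hfh hg

lemma integrable_prod (hΨ : IsPairingKernel m Ψ k) (hfp : IsFunctionOn Ω f)
    (hf : AEStronglyMeasurable f volume) (hf' : MemLp f (m + 1 : ℕ) (volume.restrict (Ω.cell d)))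
    (hg : MemLp g (m + 1 : ℕ) (volume.restrict (Ω.cell d))) :
    Integrable (fun p : EuclideanSpace ℝ (Fin d) × EuclideanSpace ℝ (Fin d) =>
      Ψ p.1 (f (p.2 + p.1)) (g p.2)) (volume.prod (volume.restrict (Ω.cell d))) := by
  have hm := hΨ.aestronglyMeasurable_prod hf hg.1
  refine ⟨hm, ?_⟩
  rw [HasFiniteIntegral, lintegral_prod _ hm.enorm]
  refine (hΨ.lintegral_le hfp hf hg.1).trans_lt ?_
  exact ENNReal.mul_lt_top hΨ.integrable.2
    (ENNReal.mul_lt_top (ENNReal.pow_lt_top hf'.2) hg.2)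

lemma cellPairing_eq_integral_prod (hΨ : IsPairingKernel m Ψ k) (hfp : IsFunctionOn Ω f)
    (hf : AEStronglyMeasurable f volume) (hf' : MemLp f (m + 1 : ℕ) (volume.restrict (Ω.cell d)))
    (hg : MemLp g (m + 1 : ℕ) (volume.restrict (Ω.cell d))) :
    cellPairing Ω Ψ f g = ∫ p, Ψ p.1 (f (p.2 + p.1)) (g p.2)
      ∂((volume : Measure (EuclideanSpace ℝ (Fin d))).prod (volume.restrict (Ω.cell d))) :=
  (integral_prod _ (hΨ.integrable_prod hfp hf hf' hg)).symm

lemma enorm_cellPairing_le (hΨ : IsPairingKernel m Ψ k) (hfp : IsFunctionOn Ω f)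
    (hf : AEStronglyMeasurable f volume)
    (hg : AEStronglyMeasurable g (volume.restrict (Ω.cell d))) :
    ‖cellPairing Ω Ψ f g‖ₑ ≤
      (∫⁻ h, ‖k h‖ₑ) * (eLpNorm f (m + 1 : ℕ) (volume.restrict (Ω.cell d)) ^ m *
        eLpNorm g (m + 1 : ℕ) (volume.restrict (Ω.cell d))) :=
  (enorm_integral_le_lintegral_enorm _).trans
    ((lintegral_mono fun _ => enorm_integral_le_lintegral_enorm _).trans
      (hΨ.lintegral_le hfp hf hg))

lemma cellPairing_sub (hΨ : IsPairingKernel m Ψ k) (hfp : IsFunctionOn Ω f)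
    (hf : AEStronglyMeasurable f volume) (hf' : MemLp f (m + 1 : ℕ) (volume.restrict (Ω.cell d)))
    {g₁ g₂ : EuclideanSpace ℝ (Fin d) → EuclideanSpace ℝ (Fin d)}
    (hg₁ : MemLp g₁ (m + 1 : ℕ) (volume.restrict (Ω.cell d)))
    (hg₂ : MemLp g₂ (m + 1 : ℕ) (volume.restrict (Ω.cell d))) :
    cellPairing Ω Ψ f (g₁ - g₂) = cellPairing Ω Ψ f g₁ - cellPairing Ω Ψ f g₂ := by
  rw [hΨ.cellPairing_eq_integral_prod hfp hf hf' hg₁, hΨ.cellPairing_eq_integral_prod hfp hf hf' hg₂,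
    hΨ.cellPairing_eq_integral_prod hfp hf hf' (hg₁.sub hg₂),
    ← integral_sub (hΨ.integrable_prod hfp hf hf' hg₁) (hΨ.integrable_prod hfp hf hf' hg₂)]
  simp

end IsPairingKernel

end Pairing

section TimeDependent

variable {d : ℕ}

/-- Velocity fields on `(0,T) × Ω`, extended by zero to all times, with *every* time slice in
`L² ∩ L³(Ω)`, and in `L² ∩ L³` as functions of `(t, x)`. The exponents `2` and `3` are written
`m + 1` with `m = 1, 2`, the orders of the pairing kernels. -/
structure IsRegularField (Ω : FlowDomain) (T : ℝ)
    (u : ℝ → EuclideanSpace ℝ (Fin d) → EuclideanSpace ℝ (Fin d)) : Prop where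
  periodic : ∀ t, IsFunctionOn Ω (u t)
  aestronglyMeasurable_slice : ∀ t, AEStronglyMeasurable (u t) volume
  memLp_slice : ∀ m : ℕ, m = 1 ∨ m = 2 → ∀ t, MemLp (u t) (m + 1 : ℕ) (volume.restrict (Ω.cell d))
  aestronglyMeasurable : AEStronglyMeasurable (Function.uncurry u)
    ((volume : Measure ℝ).prod volume)
  memLp : ∀ m : ℕ, m = 1 ∨ m = 2 → MemLp (Function.uncurry u) (m + 1 : ℕ)
    ((volume : Measure ℝ).prod (volume.restrict (Ω.cell d)))
  eq_zero : ∀ t ∉ Ioo 0 T, u t = 0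

namespace IsRegularField

variable {Ω : FlowDomain} {T : ℝ} {m : ℕ}
  {u : ℝ → EuclideanSpace ℝ (Fin d) → EuclideanSpace ℝ (Fin d)}
  {Ψ : EuclideanSpace ℝ (Fin d) → EuclideanSpace ℝ (Fin d) → EuclideanSpace ℝ (Fin d) →L[ℝ] ℝ}
  {k : EuclideanSpace ℝ (Fin d) → ℝ}

lemma aestronglyMeasurable_cell (hu : IsRegularField Ω T u) :
    AEStronglyMeasurable (Function.uncurry u)
      ((volume : Measure ℝ).prod (volume.restrict (Ω.cell d))) :=
  (hu.memLp 1 (Or.inl rfl)).1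

lemma aemeasurable_eLpNorm_slice (hu : IsRegularField Ω T u) (m : ℕ) :
    AEMeasurable (fun t => eLpNorm (u t) (m + 1 : ℕ) (volume.restrict (Ω.cell d))) := by
  simp_rw [eLpNorm_natCast_add_one]
  exact ((hu.aestronglyMeasurable_cell.enorm.pow_const (m + 1)).lintegral_prod_right').pow_const _

lemma lintegral_eLpNorm_slice (hu : IsRegularField Ω T u) (m : ℕ) :
    ∫⁻ t, eLpNorm (u t) (m + 1 : ℕ) (volume.restrict (Ω.cell d)) ^ (m + 1) =
      eLpNorm (Function.uncurry u) (m + 1 : ℕ)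
        ((volume : Measure ℝ).prod (volume.restrict (Ω.cell d))) ^ (m + 1) := by
  rw [← lintegral_enorm_pow_eq, lintegral_prod _ (hu.aestronglyMeasurable_cell.enorm.pow_const _)]
  simp_rw [← lintegral_enorm_pow_eq]
  rfl

/-- The lower powers of the slice norms are integrable, since the field lives on a bounded time
interval. -/
lemma lintegral_eLpNorm_slice_pow_lt_top (hu : IsRegularField Ω T u) (hm : m = 1 ∨ m = 2) {j : ℕ}
    (hj0 : j ≠ 0) (hj : j ≤ m + 1) :
    ∫⁻ t, eLpNorm (u t) (m + 1 : ℕ) (volume.restrict (Ω.cell d)) ^ j < ⊤ := by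
  have hle : ∀ t, eLpNorm (u t) (m + 1 : ℕ) (volume.restrict (Ω.cell d)) ^ j ≤
      (Ioo 0 T).indicator 1 t +
        eLpNorm (u t) (m + 1 : ℕ) (volume.restrict (Ω.cell d)) ^ (m + 1) := fun t => by
    by_cases ht : t ∈ Ioo 0 T
    · rw [indicator_of_mem ht]
      rcases le_total (eLpNorm (u t) (m + 1 : ℕ) (volume.restrict (Ω.cell d))) 1 with h | h
      · exact (pow_le_one₀ zero_le h).trans (le_add_right le_rfl)
      · exact (pow_le_pow_right₀ h hj).trans (le_add_left le_rfl)
    · rw [hu.eq_zero t ht]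
      simp [hj0]
  refine (lintegral_mono hle).trans_lt ?_
  rw [lintegral_add_left (measurable_one.indicator measurableSet_Ioo), hu.lintegral_eLpNorm_slice,
    lintegral_indicator_one measurableSet_Ioo]
  exact ENNReal.add_lt_top.2 ⟨by simp, ENNReal.pow_lt_top (hu.memLp m hm).2⟩

lemma aestronglyMeasurable_quad (hu : IsRegularField Ω T u) (hΨ : IsPairingKernel m Ψ k) :
    AEStronglyMeasurable (fun p : (ℝ × ℝ) × (EuclideanSpace ℝ (Fin d) × EuclideanSpace ℝ (Fin d)) =>
      Ψ p.2.1 (u p.1.1 (p.2.2 + p.2.1)) (u p.1.2 p.2.2))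
      (((volume : Measure ℝ).prod (volume : Measure ℝ)).prod
        (volume.prod (volume.restrict (Ω.cell d)))) := by
  have h1 : AEStronglyMeasurable
      (fun p : (ℝ × ℝ) × (EuclideanSpace ℝ (Fin d) × EuclideanSpace ℝ (Fin d)) =>
        Function.uncurry u (p.1.1, p.2.2 + p.2.1)) (((volume : Measure ℝ).prod
          (volume : Measure ℝ)).prod (volume.prod (volume.restrict (Ω.cell d)))) :=
    hu.aestronglyMeasurable.comp_quasiMeasurePreserving
      (QuasiMeasurePreserving.prodMap Measure.quasiMeasurePreserving_fst
        (quasiMeasurePreserving_add_swap Ω))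
  have h2 : AEStronglyMeasurable
      (fun p : (ℝ × ℝ) × (EuclideanSpace ℝ (Fin d) × EuclideanSpace ℝ (Fin d)) =>
        Function.uncurry u (p.1.2, p.2.2)) (((volume : Measure ℝ).prod
          (volume : Measure ℝ)).prod (volume.prod (volume.restrict (Ω.cell d)))) :=
    hu.aestronglyMeasurable_cell.comp_quasiMeasurePreserving
      (QuasiMeasurePreserving.prodMap Measure.quasiMeasurePreserving_snd
        Measure.quasiMeasurePreserving_snd)
  exact hΨ.aestronglyMeasurable_comp
    (continuous_fst.comp continuous_snd).aestronglyMeasurable h1 h2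

lemma cellPairing_eq (hu : IsRegularField Ω T u) (hm : m = 1 ∨ m = 2)
    (hΨ : IsPairingKernel m Ψ k) (t s : ℝ) :
    cellPairing Ω Ψ (u t) (u s) = ∫ p, Ψ p.1 (u t (p.2 + p.1)) (u s p.2)
      ∂((volume : Measure (EuclideanSpace ℝ (Fin d))).prod (volume.restrict (Ω.cell d))) :=
  hΨ.cellPairing_eq_integral_prod (hu.periodic t) (hu.aestronglyMeasurable_slice t)
    (hu.memLp_slice m hm t) (hu.memLp_slice m hm s)

lemma aestronglyMeasurable_cellPairing (hu : IsRegularField Ω T u) (hm : m = 1 ∨ m = 2)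
    (hΨ : IsPairingKernel m Ψ k) :
    AEStronglyMeasurable (fun z : ℝ × ℝ => cellPairing Ω Ψ (u z.1) (u z.2))
      ((volume : Measure ℝ).prod (volume : Measure ℝ)) := by
  simp_rw [hu.cellPairing_eq hm hΨ]
  exact (hu.aestronglyMeasurable_quad hΨ).integral_prod_right'

lemma enorm_cellPairing_le (hu : IsRegularField Ω T u)
    (hΨ : IsPairingKernel m Ψ k) (t s : ℝ) :
    ‖cellPairing Ω Ψ (u t) (u s)‖ₑ ≤
      (∫⁻ h, ‖k h‖ₑ) * (eLpNorm (u t) (m + 1 : ℕ) (volume.restrict (Ω.cell d)) ^ m *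
        eLpNorm (u s) (m + 1 : ℕ) (volume.restrict (Ω.cell d))) :=
  hΨ.enorm_cellPairing_le (hu.periodic t) (hu.aestronglyMeasurable_slice t)
    (hu.aestronglyMeasurable_slice s).restrict

lemma integrable_cellPairing (hu : IsRegularField Ω T u) (hm : m = 1 ∨ m = 2)
    (hΨ : IsPairingKernel m Ψ k) :
    Integrable (fun z : ℝ × ℝ => cellPairing Ω Ψ (u z.1) (u z.2))
      ((volume : Measure ℝ).prod (volume : Measure ℝ)) := by
  have hmeas := hu.aestronglyMeasurable_cellPairing hm hΨ
  refine ⟨hmeas, ?_⟩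
  rw [HasFiniteIntegral]
  refine lt_of_le_of_lt (lintegral_mono fun z => hu.enorm_cellPairing_le hΨ z.1 z.2) ?_
  have h1 := hu.lintegral_eLpNorm_slice_pow_lt_top hm (j := m) (by omega) (by omega)
  have h2 := hu.lintegral_eLpNorm_slice_pow_lt_top hm (j := 1) (by omega) (by omega)
  simp_rw [pow_one] at h2
  have h3 := lintegral_prod_mul ((hu.aemeasurable_eLpNorm_slice m).pow_const m)
    (hu.aemeasurable_eLpNorm_slice m)
  rw [lintegral_const_mul' _ _ hΨ.integrable.2.ne, h3]
  exact ENNReal.mul_lt_top hΨ.integrable.2 (ENNReal.mul_lt_top h1 h2)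

end IsRegularField

end TimeDependent

/-! ### Doubling of the time variable -/

section Doubling

/-- A function of two times that has a well-behaved restriction to the diagonal `s = t`: averages
along nearby diagonals `s = t + τ` converge as `τ → 0`. -/
structure HasDiagonal (J : ℝ → ℝ → ℝ) : Prop where
  integrable : Integrable (Function.uncurry J) ((volume : Measure ℝ).prod volume)
  tendsto : ∀ F : ℝ × ℝ → ℝ, Continuous F → (∃ C, ∀ z, ‖F z‖ ≤ C) →
    Tendsto (fun τ => ∫ t, F (t, t + τ) * J t (t + τ)) (𝓝 0) (𝓝 (∫ t, F (t, t) * J t t))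

variable {J Q B : ℝ → ℝ → ℝ}

lemma HasDiagonal.integrable_mul (hJ : HasDiagonal J) {F : ℝ × ℝ → ℝ} (hF : Continuous F)
    {C : ℝ} (hFC : ∀ z, ‖F z‖ ≤ C) :
    Integrable (fun z : ℝ × ℝ => F z * J z.1 z.2) ((volume : Measure ℝ).prod volume) :=
  hJ.integrable.bdd_mul hF.aestronglyMeasurable (ae_of_all _ hFC)

lemma HasDiagonal.exists_mollify (hJ : HasDiagonal J) {F : ℝ × ℝ → ℝ} (hF : Continuous F)
    {C : ℝ} (hFC : ∀ z, ‖F z‖ ≤ C) {ε : ℝ} (hε : 0 < ε) :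
    ∃ δ > 0, ∀ η : ℝ → ℝ, Continuous η → HasCompactSupport η → (∀ τ, 0 ≤ η τ) → ∫ τ, η τ = 1 →
      (∀ τ, δ ≤ |τ| → η τ = 0) →
      |(∫ z : ℝ × ℝ, η (z.2 - z.1) * (F z * J z.1 z.2)) - ∫ t, F (t, t) * J t t| ≤ ε := by
  obtain ⟨δ, hδ, h⟩ := Metric.tendsto_nhds_nhds.1 (hJ.tendsto F hF ⟨C, hFC⟩) ε hε
  refine ⟨δ, hδ, fun η hη hηc hη0 hη1 hηs => ?_⟩
  obtain ⟨M, hM⟩ := hηc.exists_bound_of_continuous hη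
  have hint : Integrable (fun z : ℝ × ℝ => η (z.2 - z.1) * (F z * J z.1 z.2))
      ((volume : Measure ℝ).prod volume) :=
    (hJ.integrable_mul hF hFC).bdd_mul (c := M)
      (hη.comp (continuous_snd.sub continuous_fst)).aestronglyMeasurable
      (ae_of_all _ fun z => hM _)
  have hshear := measurePreserving_prod_add (volume : Measure ℝ) (volume : Measure ℝ)
  have hint' := hshear.integrable_comp_of_integrable hint
  have heq := hshear.integral_comp (MeasurableEquiv.shearAddRight ℝ).measurableEmbedding
    (fun z : ℝ × ℝ => η (z.2 - z.1) * (F z * J z.1 z.2))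
  simp only [Function.comp_def, add_sub_cancel_left] at hint' heq
  have hin2 := hint'.integral_prod_right
  rw [Measure.volume_eq_prod, ← heq, integral_prod_symm _ hint']
  simp only [integral_const_mul] at hin2 ⊢
  have hηi : Integrable η := hη.integrable_of_hasCompactSupport hηc
  have e1 : ∫ t, F (t, t) * J t t = ∫ τ, η τ * ∫ t, F (t, t) * J t t := by
    rw [integral_mul_const, hη1, one_mul]
  rw [e1, ← integral_sub hin2 (hηi.mul_const _), ← Real.norm_eq_abs]
  calc ‖∫ τ, ((η τ * ∫ t, F (t, t + τ) * J t (t + τ)) - η τ * ∫ t, F (t, t) * J t t)‖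
      ≤ ∫ τ, η τ * ε := by
        refine norm_integral_le_of_norm_le (hηi.mul_const _) (ae_of_all _ fun τ => ?_)
        rw [← mul_sub, norm_mul, Real.norm_of_nonneg (hη0 τ)]
        rcases lt_or_ge |τ| δ with hτ | hτ
        · gcongr
          · exact hη0 τ
          · have := h (x := τ) (by simpa [Real.dist_eq] using hτ)
            simpa [Real.dist_eq] using this.le
        · simp [hηs τ hτ]
    _ = ε := by rw [integral_mul_const, hη1, one_mul]

/-- Doubling of the time variable: if `Q` is symmetric and `∂_t Q(t, s) = B(t, s)` weakly for each
`s`, then `d/dt Q(t, t) = 2 B(t, t)` weakly. The test functions `η(s - t)(ψ(t) + ψ(s))` with `η`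
even are used, so that the singular term `η'(s - t)` drops out by antisymmetry. -/
lemma HasDiagonal.integral_deriv_mul_diag (hQ : HasDiagonal Q) (hB : HasDiagonal B)
    (hsymm : ∀ t s, Q t s = Q s t) {T : ℝ}
    (hweak : ∀ s, ∀ θ : ℝ → ℝ, ContDiff ℝ ∞ θ → HasCompactSupport θ → tsupport θ ⊆ Ioo 0 T →
      ∫ t, (deriv θ t * Q t s + θ t * B t s) = 0)
    {ψ : ℝ → ℝ} (hψ : ContDiff ℝ ∞ ψ) (hψc : HasCompactSupport ψ) (hψT : tsupport ψ ⊆ Ioo 0 T) :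
    ∫ t, deriv ψ t * Q t t = -(2 * ∫ t, ψ t * B t t) := by
  have hψ' : Continuous (deriv ψ) := hψ.continuous_deriv (by simp)
  obtain ⟨C₁, hC₁⟩ := hψc.deriv.exists_bound_of_continuous hψ'
  obtain ⟨C₂, hC₂⟩ := hψc.exists_bound_of_continuous hψ.continuous
  have hF₁ : Continuous fun z : ℝ × ℝ => deriv ψ z.1 := hψ'.comp continuous_fst
  have hF₂ : Continuous fun z : ℝ × ℝ => ψ z.1 + ψ z.2 :=
    (hψ.continuous.comp continuous_fst).add (hψ.continuous.comp continuous_snd)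
  have hF₂C : ∀ z : ℝ × ℝ, ‖ψ z.1 + ψ z.2‖ ≤ C₂ + C₂ := fun z =>
    (norm_add_le _ _).trans (add_le_add (hC₂ _) (hC₂ _))
  obtain ⟨δ₀, hδ₀, hδ₀T⟩ := hψc.isCompact.exists_cthickening_subset_open isOpen_Ioo hψT
  have key : ∀ ε > 0, |(∫ t, deriv ψ t * Q t t) + 2 * ∫ t, ψ t * B t t| ≤ ε + ε := by
    intro ε hε
    obtain ⟨δ₁, hδ₁, h₁⟩ := hQ.exists_mollify hF₁ (fun z => hC₁ z.1) hε
    obtain ⟨δ₂, hδ₂, h₂⟩ := hB.exists_mollify hF₂ hF₂C hε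
    set δ := min δ₀ (min δ₁ δ₂) with hδ
    have hδpos : 0 < δ := by positivity
    let b : ContDiffBump (0 : ℝ) := ⟨δ / 4, δ / 2, by positivity, by linarith⟩
    set η := b.normed volume with hη
    have hηs : ContDiff ℝ ∞ η := b.contDiff_normed
    have hηc : HasCompactSupport η := b.hasCompactSupport_normed
    have hη0 : ∀ τ, δ ≤ |τ| → η τ = 0 := fun τ hτ => by
      have : τ ∉ Function.support η := by
        rw [b.support_normed_eq]
        simp only [Metric.mem_ball, dist_zero_right, Real.norm_eq_abs, not_lt]
        change δ / 2 ≤ |τ|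
        linarith
      simpa using this
    have hηe : ∀ τ, η (-τ) = η τ := b.normed_neg
    have hη' : Continuous (deriv η) := hηs.continuous_deriv (by simp)
    have hηo : ∀ τ, deriv η (-τ) = -deriv η τ := fun τ => by
      have := deriv_comp_neg η τ
      rw [funext hηe] at this
      linarith
    obtain ⟨M₀, hM₀⟩ := hηc.exists_bound_of_continuous hηs.continuous
    obtain ⟨M₁, hM₁⟩ := hηc.deriv.exists_bound_of_continuous hη'
    have hsub : Continuous fun z : ℝ × ℝ => z.2 - z.1 := continuous_snd.sub continuous_fst
    have h₁' := h₁ η hηs.continuous hηc b.nonneg_normed b.integral_normed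
      fun τ hτ => hη0 τ (le_trans (by simp [hδ]) hτ)
    have h₂' := h₂ η hηs.continuous hηc b.nonneg_normed b.integral_normed
      fun τ hτ => hη0 τ (le_trans (by simp [hδ]) hτ)
    have iX := (hQ.integrable_mul hF₁ fun z => hC₁ z.1).bdd_mul (c := M₀)
      (hηs.continuous.comp hsub).aestronglyMeasurable (ae_of_all _ fun z => hM₀ _)
    have iY := (hB.integrable_mul hF₂ hF₂C).bdd_mul (c := M₀)
      (hηs.continuous.comp hsub).aestronglyMeasurable (ae_of_all _ fun z => hM₀ _)
    have iI := (hQ.integrable_mul hF₂ hF₂C).bdd_mul (c := M₁)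
      (hη'.comp hsub).aestronglyMeasurable (ae_of_all _ fun z => hM₁ _)
    simp only [Function.comp_def] at iX iY iI
    -- the singular term is antisymmetric under exchange of the two times
    have hI : ∫ z : ℝ × ℝ, deriv η (z.2 - z.1) * ((ψ z.1 + ψ z.2) * Q z.1 z.2)
        ∂((volume : Measure ℝ).prod volume) = 0 := by
      have h := integral_prod_swap (μ := (volume : Measure ℝ)) (ν := (volume : Measure ℝ))
        fun z : ℝ × ℝ => deriv η (z.2 - z.1) * ((ψ z.1 + ψ z.2) * Q z.1 z.2)
      have h' : ∀ z : ℝ × ℝ, deriv η (z.swap.2 - z.swap.1) *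
          ((ψ z.swap.1 + ψ z.swap.2) * Q z.swap.1 z.swap.2) =
            -(deriv η (z.2 - z.1) * ((ψ z.1 + ψ z.2) * Q z.1 z.2)) := fun z => by
        simp only [Prod.fst_swap, Prod.snd_swap]
        rw [← neg_sub z.2 z.1, hηo, hsymm z.2 z.1]
        ring
      simp_rw [h'] at h
      rw [integral_neg] at h
      linarith
    -- the weak equation at fixed `s`, tested with `t ↦ η (s - t) * (ψ t + ψ s)`
    have hs : ∀ s, ∫ t, (-(deriv η (s - t) * ((ψ t + ψ s) * Q t s)) +
        η (s - t) * (deriv ψ t * Q t s) + η (s - t) * ((ψ t + ψ s) * B t s)) = 0 := fun s => by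
      have hθ : ContDiff ℝ ∞ fun t => η (s - t) * (ψ t + ψ s) :=
        (hηs.comp (contDiff_const.sub contDiff_id)).mul (hψ.add contDiff_const)
      have hθsupp : Function.support (fun t => η (s - t) * (ψ t + ψ s)) ⊆
          Metric.cthickening δ₀ (tsupport ψ) := fun t ht => by
        have ht1 : |s - t| < δ := by
          by_contra hcon
          exact ht (by simp [hη0 _ (not_lt.1 hcon)])
        have hδδ : δ ≤ δ₀ := by simp [hδ]
        by_cases h1 : ψ t = 0
        · have h2 : ψ s ≠ 0 := fun h2 => ht (by simp [h1, h2])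
          exact Metric.mem_cthickening_of_dist_le t s _ _ (subset_tsupport _ h2)
            (by rw [dist_comm, Real.dist_eq]; linarith)
        · exact Metric.self_subset_cthickening _ (subset_tsupport _ h1)
      have hθT : tsupport (fun t => η (s - t) * (ψ t + ψ s)) ⊆
          Metric.cthickening δ₀ (tsupport ψ) :=
        closure_minimal hθsupp Metric.isClosed_cthickening
      have hθc : HasCompactSupport fun t => η (s - t) * (ψ t + ψ s) :=
        hψc.isCompact.cthickening.of_isClosed_subset (isClosed_tsupport _) hθT
      refine Eq.trans ?_ (hweak s _ hθ hθc (hθT.trans hδ₀T))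
      congr 1
      ext t
      have hd1 : HasDerivAt (fun t => η (s - t)) (deriv η (s - t) * (-1)) t :=
        HasDerivAt.comp (h₂ := η) (h := fun t => s - t) t
          (hηs.differentiable (by simp) _).hasDerivAt ((hasDerivAt_id t).const_sub s)
      have hd2 : HasDerivAt (fun t => ψ t + ψ s) (deriv ψ t) t :=
        (hψ.differentiable (by simp) t).hasDerivAt.add_const _
      have hd3 : deriv (fun t => η (s - t) * (ψ t + ψ s)) t = _ := (hd1.mul hd2).deriv
      rw [hd3]
      ring
    have htot := integral_prod_symm _ ((iI.neg.add iX).add iY)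
    simp only [Pi.add_apply, Pi.neg_apply] at htot
    simp_rw [hs] at htot
    rw [integral_zero] at htot
    have a1 := integral_add (iI.neg.add iX) iY
    have a2 := integral_add iI.neg iX
    simp only [Pi.add_apply, Pi.neg_apply, integral_neg, hI] at a1 a2
    rw [a1, a2] at htot
    rw [Measure.volume_eq_prod] at h₁' h₂'
    have e2 : ∫ t, (ψ t + ψ t) * B t t = 2 * ∫ t, ψ t * B t t := by
      rw [← integral_const_mul]
      congr 1
      ext t
      ring
    dsimp only at h₁' h₂'
    rw [e2] at h₂'
    rw [abs_le] at h₁' h₂' ⊢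
    constructor <;> linarith [h₁'.1, h₁'.2, h₂'.1, h₂'.2]
  have h0 : |(∫ t, deriv ψ t * Q t t) + 2 * ∫ t, ψ t * B t t| ≤ 0 := by
    refine le_of_forall_pos_le_add fun ε hε => ?_
    have := key (ε / 2) (by positivity)
    linarith
  have := abs_nonpos_iff.1 h0
  linarith

end Doubling

/-! ### The diagonal of the pairings -/

namespace IsRegularField

variable {d : ℕ} {Ω : FlowDomain} {T : ℝ} {m : ℕ}
  {u : ℝ → EuclideanSpace ℝ (Fin d) → EuclideanSpace ℝ (Fin d)}
  {Ψ : EuclideanSpace ℝ (Fin d) → EuclideanSpace ℝ (Fin d) → EuclideanSpace ℝ (Fin d) →L[ℝ] ℝ}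
  {k : EuclideanSpace ℝ (Fin d) → ℝ}

lemma measurePreserving_time_translate (ν : Measure (EuclideanSpace ℝ (Fin d))) [SFinite ν]
    (τ : ℝ) : MeasurePreserving (fun z : ℝ × EuclideanSpace ℝ (Fin d) => (z.1 + τ, z.2))
      ((volume : Measure ℝ).prod ν) ((volume : Measure ℝ).prod ν) :=
  (measurePreserving_add_right volume τ).prod (MeasurePreserving.id ν)

lemma memLp_time_translate_sub (hu : IsRegularField Ω T u) (hm : m = 1 ∨ m = 2) (τ : ℝ) :
    MemLp (fun z => Function.uncurry u (z.1 + τ, z.2) - Function.uncurry u z) (m + 1 : ℕ)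
      ((volume : Measure ℝ).prod (volume.restrict (Ω.cell d))) :=
  ((hu.memLp m hm).comp_measurePreserving (measurePreserving_time_translate _ τ)).sub
    (hu.memLp m hm)

/-- Continuity of translations in time in `L^{m + 1}`. -/
lemma tendsto_eLpNorm_time_translate (hu : IsRegularField Ω T u) (hm : m = 1 ∨ m = 2) :
    Tendsto (fun τ : ℝ => eLpNorm
      (fun z => Function.uncurry u (z.1 + τ, z.2) - Function.uncurry u z) (m + 1 : ℕ)
      ((volume : Measure ℝ).prod (volume.restrict (Ω.cell d)))) (𝓝 0) (𝓝 0) := by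
  have : Fact (1 ≤ ((m + 1 : ℕ) : ℝ≥0∞)) := ⟨by exact_mod_cast Nat.le_add_left 1 m⟩
  have hL := hu.memLp m hm
  let g : ℝ → C(ℝ × EuclideanSpace ℝ (Fin d), ℝ × EuclideanSpace ℝ (Fin d)) := fun τ =>
    ⟨fun z => (z.1 + τ, z.2), by fun_prop⟩
  have hg : Continuous g := by
    refine ContinuousMap.continuous_of_continuous_uncurry _ ?_
    simp only [g, Function.uncurry_def, ContinuousMap.coe_mk]
    fun_prop
  have hgm : ∀ τ, MeasurePreserving (g τ)
      ((volume : Measure ℝ).prod (volume.restrict (Ω.cell d)))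
      ((volume : Measure ℝ).prod (volume.restrict (Ω.cell d))) := fun τ =>
    measurePreserving_time_translate _ τ
  have h := Filter.Tendsto.compMeasurePreservingLp (f := fun _ : ℝ => hL.toLp _)
    (tendsto_const_nhds) (hg.tendsto 0) hgm (hgm 0) (by simp)
  rw [tendsto_iff_edist_tendsto_0] at h
  simp_rw [Lp.toLp_compMeasurePreserving, Lp.edist_toLp_toLp] at h
  refine h.congr fun τ => ?_
  congr 1
  ext z : 1
  simp [g]

/-- `L^q(Ω)` norms of slices assemble to the `L^q` norm in space-time. -/
lemma lintegral_eLpNorm_slice_pow {w : ℝ × EuclideanSpace ℝ (Fin d) → EuclideanSpace ℝ (Fin d)}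
    (hw : AEStronglyMeasurable w ((volume : Measure ℝ).prod (volume.restrict (Ω.cell d)))) (m : ℕ) :
    ∫⁻ t, eLpNorm (fun y => w (t, y)) (m + 1 : ℕ) (volume.restrict (Ω.cell d)) ^ (m + 1) =
      eLpNorm w (m + 1 : ℕ) ((volume : Measure ℝ).prod (volume.restrict (Ω.cell d))) ^ (m + 1) := by
  rw [← lintegral_enorm_pow_eq, lintegral_prod _ (hw.enorm.pow_const _)]
  simp_rw [← lintegral_enorm_pow_eq]

lemma aemeasurable_eLpNorm_slice_of
    {w : ℝ × EuclideanSpace ℝ (Fin d) → EuclideanSpace ℝ (Fin d)}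
    (hw : AEStronglyMeasurable w ((volume : Measure ℝ).prod (volume.restrict (Ω.cell d)))) (m : ℕ) :
    AEMeasurable fun t => eLpNorm (fun y => w (t, y)) (m + 1 : ℕ) (volume.restrict (Ω.cell d)) := by
  simp_rw [eLpNorm_natCast_add_one]
  exact ((hw.enorm.pow_const (m + 1)).lintegral_prod_right').pow_const _

lemma lintegral_enorm_cellPairing_sub_le (hu : IsRegularField Ω T u) (hm : m = 1 ∨ m = 2)
    (hΨ : IsPairingKernel m Ψ k) (τ : ℝ) :
    ∫⁻ t, ‖cellPairing Ω Ψ (u t) (u (t + τ)) - cellPairing Ω Ψ (u t) (u t)‖ₑ ≤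
      (∫⁻ h, ‖k h‖ₑ) * (eLpNorm (Function.uncurry u) (m + 1 : ℕ)
        ((volume : Measure ℝ).prod (volume.restrict (Ω.cell d))) ^ m * eLpNorm
      (fun z => Function.uncurry u (z.1 + τ, z.2) - Function.uncurry u z) (m + 1 : ℕ)
      ((volume : Measure ℝ).prod (volume.restrict (Ω.cell d)))) := by
  have hw := (hu.memLp_time_translate_sub hm τ).1
  calc ∫⁻ t, ‖cellPairing Ω Ψ (u t) (u (t + τ)) - cellPairing Ω Ψ (u t) (u t)‖ₑ
      ≤ ∫⁻ t, (∫⁻ h, ‖k h‖ₑ) * (eLpNorm (u t) (m + 1 : ℕ) (volume.restrict (Ω.cell d)) ^ m *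
        eLpNorm (u (t + τ) - u t) (m + 1 : ℕ) (volume.restrict (Ω.cell d))) := by
        refine lintegral_mono fun t => ?_
        rw [← hΨ.cellPairing_sub (hu.periodic t) (hu.aestronglyMeasurable_slice t)
          (hu.memLp_slice m hm t) (hu.memLp_slice m hm _) (hu.memLp_slice m hm t)]
        exact hΨ.enorm_cellPairing_le (hu.periodic t) (hu.aestronglyMeasurable_slice t)
          ((hu.memLp_slice m hm _).sub (hu.memLp_slice m hm t)).1
    _ = (∫⁻ h, ‖k h‖ₑ) * ∫⁻ t, (eLpNorm (u t) (m + 1 : ℕ) (volume.restrict (Ω.cell d)) ^ m *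
        eLpNorm (u (t + τ) - u t) (m + 1 : ℕ) (volume.restrict (Ω.cell d))) :=
        lintegral_const_mul' _ _ hΨ.integrable.2.ne
    _ ≤ _ := by
        gcongr
        refine (lintegral_pow_mul_le m (hu.aemeasurable_eLpNorm_slice m)
          (aemeasurable_eLpNorm_slice_of hw m)).trans (le_of_eq ?_)
        have e : ∀ a : ℝ≥0∞, (a ^ (m + 1)) ^ (1 / ((m : ℝ) + 1)) = a := fun a => by
          have hm' : (0 : ℝ) < m + 1 := by positivity
          rw [← ENNReal.rpow_natCast, ← ENNReal.rpow_mul]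
          push_cast
          rw [mul_one_div_cancel hm'.ne', ENNReal.rpow_one]
        rw [hu.lintegral_eLpNorm_slice, e]
        congr 1
        have := lintegral_eLpNorm_slice_pow hw m
        exact (congrArg (· ^ (1 / ((m : ℝ) + 1))) this).trans (e _)

lemma aestronglyMeasurable_cellPairing_shift (hu : IsRegularField Ω T u) (hm : m = 1 ∨ m = 2)
    (hΨ : IsPairingKernel m Ψ k) (τ : ℝ) :
    AEStronglyMeasurable fun t => cellPairing Ω Ψ (u t) (u (t + τ)) := by
  simp_rw [hu.cellPairing_eq hm hΨ]
  have h1 : AEStronglyMeasurable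
      (fun p : ℝ × (EuclideanSpace ℝ (Fin d) × EuclideanSpace ℝ (Fin d)) =>
        Function.uncurry u (p.1, p.2.2 + p.2.1))
      ((volume : Measure ℝ).prod (volume.prod (volume.restrict (Ω.cell d)))) :=
    hu.aestronglyMeasurable.comp_quasiMeasurePreserving
      (QuasiMeasurePreserving.prodMap (Measure.QuasiMeasurePreserving.id _)
        (quasiMeasurePreserving_add_swap Ω))
  have h2 : AEStronglyMeasurable
      (fun p : ℝ × (EuclideanSpace ℝ (Fin d) × EuclideanSpace ℝ (Fin d)) =>
        Function.uncurry u (p.1 + τ, p.2.2))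
      ((volume : Measure ℝ).prod (volume.prod (volume.restrict (Ω.cell d)))) :=
    hu.aestronglyMeasurable_cell.comp_quasiMeasurePreserving
      (QuasiMeasurePreserving.prodMap
        (measurePreserving_add_right volume τ).quasiMeasurePreserving
        Measure.quasiMeasurePreserving_snd)
  have h3 : AEStronglyMeasurable
      (fun p : ℝ × (EuclideanSpace ℝ (Fin d) × EuclideanSpace ℝ (Fin d)) =>
        Ψ p.2.1 (Function.uncurry u (p.1, p.2.2 + p.2.1)) (Function.uncurry u (p.1 + τ, p.2.2)))
      ((volume : Measure ℝ).prod (volume.prod (volume.restrict (Ω.cell d)))) :=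
    hΨ.aestronglyMeasurable_comp (continuous_fst.comp continuous_snd).aestronglyMeasurable h1 h2
  exact h3.integral_prod_right'

lemma integrable_cellPairing_diag (hu : IsRegularField Ω T u) (hm : m = 1 ∨ m = 2)
    (hΨ : IsPairingKernel m Ψ k) : Integrable fun t => cellPairing Ω Ψ (u t) (u t) := by
  have hmeas := hu.aestronglyMeasurable_cellPairing_shift hm hΨ 0
  simp only [add_zero] at hmeas
  refine ⟨hmeas, ?_⟩
  rw [HasFiniteIntegral]
  refine lt_of_le_of_lt (lintegral_mono fun t => hu.enorm_cellPairing_le hΨ t t) ?_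
  rw [lintegral_const_mul' _ _ hΨ.integrable.2.ne]
  refine ENNReal.mul_lt_top hΨ.integrable.2 ?_
  simp_rw [← pow_succ]
  exact hu.lintegral_eLpNorm_slice_pow_lt_top hm (j := m + 1) (by omega) le_rfl

/-- Pairings of `u(t)` with `u(s)` restrict to the diagonal: by translation continuity, the pairing
of `u(t)` with `u(t + τ)` converges in `L¹` in time as `τ → 0`. -/
lemma hasDiagonal_cellPairing (hu : IsRegularField Ω T u) (hm : m = 1 ∨ m = 2)
    (hΨ : IsPairingKernel m Ψ k) : HasDiagonal fun t s => cellPairing Ω Ψ (u t) (u s) where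
  integrable := hu.integrable_cellPairing hm hΨ
  tendsto := by
    rintro F hF ⟨C, hC⟩
    have hdiag := hu.integrable_cellPairing_diag hm hΨ
    have hfin : ∀ τ, ∫⁻ t, ‖cellPairing Ω Ψ (u t) (u (t + τ)) - cellPairing Ω Ψ (u t) (u t)‖ₑ
        < ⊤ := fun τ =>
      (hu.lintegral_enorm_cellPairing_sub_le hm hΨ τ).trans_lt
        (ENNReal.mul_lt_top hΨ.integrable.2 (ENNReal.mul_lt_top
          (ENNReal.pow_lt_top (hu.memLp m hm).2) (hu.memLp_time_translate_sub hm τ).2))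
    have hdiff : ∀ τ, Integrable fun t =>
        cellPairing Ω Ψ (u t) (u (t + τ)) - cellPairing Ω Ψ (u t) (u t) := fun τ =>
      ⟨(hu.aestronglyMeasurable_cellPairing_shift hm hΨ τ).sub hdiag.1, hfin τ⟩
    have hFτ : ∀ τ, Continuous fun t => F (t, t + τ) := fun τ => hF.comp (by fun_prop)
    have i1 : ∀ τ, Integrable fun t => F (t, t + τ) *
        (cellPairing Ω Ψ (u t) (u (t + τ)) - cellPairing Ω Ψ (u t) (u t)) := fun τ =>
      (hdiff τ).bdd_mul (c := C) (hFτ τ).aestronglyMeasurable (ae_of_all _ fun t => hC _)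
    have i2 : ∀ τ, Integrable fun t => F (t, t + τ) * cellPairing Ω Ψ (u t) (u t) := fun τ =>
      hdiag.bdd_mul (c := C) (hFτ τ).aestronglyMeasurable (ae_of_all _ fun t => hC _)
    have heq : ∀ τ, ∫ t, F (t, t + τ) * cellPairing Ω Ψ (u t) (u (t + τ)) =
        (∫ t, F (t, t + τ) *
          (cellPairing Ω Ψ (u t) (u (t + τ)) - cellPairing Ω Ψ (u t) (u t))) +
        ∫ t, F (t, t + τ) * cellPairing Ω Ψ (u t) (u t) := fun τ => by
      rw [← integral_add (i1 τ) (i2 τ)]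
      congr 1
      ext t
      ring
    simp_rw [heq]
    rw [← zero_add (∫ t, F (t, t) * _)]
    refine Tendsto.add ?_ ?_
    · have hb : ∀ τ, ‖∫ t, F (t, t + τ) *
          (cellPairing Ω Ψ (u t) (u (t + τ)) - cellPairing Ω Ψ (u t) (u t))‖ₑ ≤
          ENNReal.ofReal C * ((∫⁻ h, ‖k h‖ₑ) * (eLpNorm (Function.uncurry u) (m + 1 : ℕ)
          ((volume : Measure ℝ).prod (volume.restrict (Ω.cell d))) ^ m * eLpNorm
          (fun z => Function.uncurry u (z.1 + τ, z.2) - Function.uncurry u z) (m + 1 : ℕ)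
          ((volume : Measure ℝ).prod (volume.restrict (Ω.cell d))))) := fun τ => by
        refine (enorm_integral_le_lintegral_enorm _).trans ?_
        refine le_trans ?_ (mul_le_mul_right (hu.lintegral_enorm_cellPairing_sub_le hm hΨ τ) _)
        rw [← lintegral_const_mul' _ _ ENNReal.ofReal_ne_top]
        refine lintegral_mono fun t => ?_
        rw [enorm_mul]
        gcongr
        rw [← ofReal_norm]
        exact ENNReal.ofReal_le_ofReal (hC _)
      have hlim : Tendsto (fun τ : ℝ => ENNReal.ofReal C * ((∫⁻ h, ‖k h‖ₑ) *
          (eLpNorm (Function.uncurry u) (m + 1 : ℕ)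
          ((volume : Measure ℝ).prod (volume.restrict (Ω.cell d))) ^ m * eLpNorm
          (fun z => Function.uncurry u (z.1 + τ, z.2) - Function.uncurry u z) (m + 1 : ℕ)
          ((volume : Measure ℝ).prod (volume.restrict (Ω.cell d)))))) (𝓝 0) (𝓝 0) := by
        have h0 := hu.tendsto_eLpNorm_time_translate hm
        have h1 := ENNReal.Tendsto.const_mul h0 (a := eLpNorm (Function.uncurry u) (m + 1 : ℕ)
          ((volume : Measure ℝ).prod (volume.restrict (Ω.cell d))) ^ m)
          (Or.inr (ENNReal.pow_lt_top (hu.memLp m hm).2).ne)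
        have h2 := ENNReal.Tendsto.const_mul h1 (a := ∫⁻ h, ‖k h‖ₑ) (Or.inr hΨ.integrable.2.ne)
        have h3 := ENNReal.Tendsto.const_mul h2 (a := ENNReal.ofReal C)
          (Or.inr ENNReal.ofReal_ne_top)
        simpa using h3
      rw [tendsto_zero_iff_norm_tendsto_zero]
      have := tendsto_of_tendsto_of_tendsto_of_le_of_le tendsto_const_nhds hlim
        (fun _ => zero_le) hb
      have h' := (ENNReal.tendsto_toReal ENNReal.zero_ne_top).comp this
      simpa [Function.comp_def] using h'
    · refine tendsto_integral_filter_of_dominated_convergence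
        (fun t => C * ‖cellPairing Ω Ψ (u t) (u t)‖)
        (Eventually.of_forall fun τ => (i2 τ).1) (Eventually.of_forall fun τ => ae_of_all _ fun t => ?_)
        (hdiag.norm.const_mul C) (ae_of_all _ fun t => ?_)
      · rw [norm_mul]
        gcongr
        exact hC _
      · refine Tendsto.mul_const _ ?_
        have : Continuous fun τ : ℝ => F (t, t + τ) := hF.comp (by fun_prop)
        simpa using this.tendsto 0

end IsRegularField

/-! ### The weak time derivative of the correlation -/

section Kernels

variable {d : ℕ}

/-- The kernel of the correlation `∫∫ K(h) ⟪f(y + h), g(y)⟫`. -/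
noncomputable def correlationKernel (K : EuclideanSpace ℝ (Fin d) → ℝ)
    (h a : EuclideanSpace ℝ (Fin d)) : EuclideanSpace ℝ (Fin d) →L[ℝ] ℝ :=
  K h • innerSL ℝ a

/-- The kernel of the cubic form which is the weak time derivative of the correlation with kernel
`K = -ΔG`: an energy flux and a pressure term. -/
noncomputable def fluxKernel (G K : EuclideanSpace ℝ (Fin d) → ℝ)
    (h a : EuclideanSpace ℝ (Fin d)) : EuclideanSpace ℝ (Fin d) →L[ℝ] ℝ :=
  fderiv ℝ K h a • innerSL ℝ a + fderiv ℝ (fderiv ℝ (fderiv ℝ G)) h a a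

variable {G K : EuclideanSpace ℝ (Fin d) → ℝ}

lemma isPairingKernel_correlation (hK : Continuous K) (hKc : HasCompactSupport K) :
    IsPairingKernel 1 (correlationKernel K) fun h => ‖K h‖ where
  continuous := by
    simp only [correlationKernel, Function.uncurry_def]
    exact (hK.comp continuous_fst).smul ((innerSL ℝ).continuous.comp continuous_snd)
  norm_le := fun h a => by
    rw [correlationKernel, norm_smul, innerSL_apply_norm, pow_one]
  integrable := (hK.integrable_of_hasCompactSupport hKc).norm

set_option maxSynthPendingDepth 4 in
set_option synthInstance.maxHeartbeats 100000 in
lemma isPairingKernel_flux (hG : ContDiff ℝ ∞ G) (hGc : HasCompactSupport G)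
    (hK : ContDiff ℝ ∞ K) (hKc : HasCompactSupport K) :
    IsPairingKernel 2 (fluxKernel G K)
      fun h => ‖fderiv ℝ K h‖ + ‖fderiv ℝ (fderiv ℝ (fderiv ℝ G)) h‖ where
  continuous := by
    simp only [fluxKernel, Function.uncurry_def]
    have h1 := (hK.continuous_fderiv (by simp)).comp
      (continuous_fst (X := EuclideanSpace ℝ (Fin d)) (Y := EuclideanSpace ℝ (Fin d)))
    have h2 := (hG.fderiv_infty.fderiv_infty.continuous_fderiv (by simp)).comp
      (continuous_fst (X := EuclideanSpace ℝ (Fin d)) (Y := EuclideanSpace ℝ (Fin d)))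
    exact ((h1.clm_apply continuous_snd).smul ((innerSL ℝ).continuous.comp continuous_snd)).add
      ((h2.clm_apply continuous_snd).clm_apply continuous_snd)
  norm_le := fun h a => by
    refine (norm_add_le _ _).trans ?_
    rw [add_mul]
    refine add_le_add ?_ ?_
    · rw [norm_smul, innerSL_apply_norm, pow_two, ← mul_assoc]
      gcongr
      exact (fderiv ℝ K h).le_opNorm a
    · rw [pow_two, ← mul_assoc]
      exact (fderiv ℝ (fderiv ℝ (fderiv ℝ G)) h).le_opNorm₂ a a
  integrable := by
    refine Integrable.add (Integrable.norm ?_) (Integrable.norm ?_)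
    · exact (hK.continuous_fderiv (by simp)).integrable_of_hasCompactSupport (hKc.fderiv ℝ)
    · exact (hG.fderiv_infty.fderiv_infty.continuous_fderiv
        (by simp)).integrable_of_hasCompactSupport (((hGc.fderiv ℝ).fderiv ℝ).fderiv ℝ)

end Kernels

namespace IsRegularField

variable {d : ℕ} {Ω : FlowDomain} {T : ℝ} {m : ℕ}
  {u : ℝ → EuclideanSpace ℝ (Fin d) → EuclideanSpace ℝ (Fin d)}
  {Ψ : EuclideanSpace ℝ (Fin d) → EuclideanSpace ℝ (Fin d) → EuclideanSpace ℝ (Fin d) →L[ℝ] ℝ}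
  {k : EuclideanSpace ℝ (Fin d) → ℝ}

lemma integrable_weight (hu : IsRegularField Ω T u) (hm : m = 1 ∨ m = 2)
    (hΨ : IsPairingKernel m Ψ k) {θ : ℝ → ℝ} (hθ : Continuous θ) {C : ℝ} (hC : ∀ t, ‖θ t‖ ≤ C)
    (s : ℝ) :
    Integrable (fun p : (ℝ × EuclideanSpace ℝ (Fin d)) × EuclideanSpace ℝ (Fin d) =>
      θ p.1.1 * Ψ p.1.2 (u p.1.1 (p.2 + p.1.2)) (u s p.2))
      (((volume : Measure ℝ).prod volume).prod (volume.restrict (Ω.cell d))) := by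
  have h1 : AEStronglyMeasurable
      (fun p : ℝ × (EuclideanSpace ℝ (Fin d) × EuclideanSpace ℝ (Fin d)) =>
        Function.uncurry u (p.1, p.2.2 + p.2.1))
      ((volume : Measure ℝ).prod (volume.prod (volume.restrict (Ω.cell d)))) :=
    hu.aestronglyMeasurable.comp_quasiMeasurePreserving
      (QuasiMeasurePreserving.prodMap (Measure.QuasiMeasurePreserving.id _)
        (quasiMeasurePreserving_add_swap Ω))
  have hassoc := measurePreserving_prodAssoc (volume : Measure ℝ)
    (volume : Measure (EuclideanSpace ℝ (Fin d))) (volume.restrict (Ω.cell d))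
  have h1' := h1.comp_measurePreserving hassoc
  have h2 : AEStronglyMeasurable
      (fun p : (ℝ × EuclideanSpace ℝ (Fin d)) × EuclideanSpace ℝ (Fin d) => u s p.2)
      (((volume : Measure ℝ).prod volume).prod (volume.restrict (Ω.cell d))) :=
    (hu.aestronglyMeasurable_slice s).restrict.comp_snd
  have hmeas : AEStronglyMeasurable
      (fun p : (ℝ × EuclideanSpace ℝ (Fin d)) × EuclideanSpace ℝ (Fin d) =>
      Ψ p.1.2 (u p.1.1 (p.2 + p.1.2)) (u s p.2))
      (((volume : Measure ℝ).prod volume).prod (volume.restrict (Ω.cell d))) :=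
    hΨ.aestronglyMeasurable_comp (continuous_snd.comp continuous_fst).aestronglyMeasurable h1' h2
  refine Integrable.bdd_mul (c := C) ⟨hmeas, ?_⟩
    (hθ.comp (continuous_fst.comp continuous_fst)).aestronglyMeasurable (ae_of_all _ fun p => hC _)
  rw [HasFiniteIntegral, lintegral_prod _ hmeas.enorm,
    lintegral_prod _ hmeas.enorm.lintegral_prod_right']
  refine lt_of_le_of_lt (lintegral_mono fun t => hΨ.lintegral_le (hu.periodic t)
    (hu.aestronglyMeasurable_slice t) (hu.aestronglyMeasurable_slice s).restrict) ?_
  rw [lintegral_const_mul' _ _ hΨ.integrable.2.ne, lintegral_mul_const' _ _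
    (hu.memLp_slice m hm s).2.ne]
  exact ENNReal.mul_lt_top hΨ.integrable.2 (ENNReal.mul_lt_top
    (hu.lintegral_eLpNorm_slice_pow_lt_top hm (by omega) (by omega)) (hu.memLp_slice m hm s).2)

/-- Fubini for a pairing weighted in time: the integral over time and increments may be done first,
at fixed `y`, where the weak formulation applies with the constant vector `u(s, y)`. -/
lemma integral_weight (hu : IsRegularField Ω T u) (hm : m = 1 ∨ m = 2)
    (hΨ : IsPairingKernel m Ψ k) {θ : ℝ → ℝ} (hθ : Continuous θ) {C : ℝ} (hC : ∀ t, ‖θ t‖ ≤ C)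
    (s : ℝ) :
    Integrable (fun t => θ t * cellPairing Ω Ψ (u t) (u s)) ∧
    ∫ t, θ t * cellPairing Ω Ψ (u t) (u s) = ∫ y in Ω.cell d,
      ∫ z : ℝ × EuclideanSpace ℝ (Fin d), θ z.1 * Ψ z.2 (u z.1 (y + z.2)) (u s y)
        ∂((volume : Measure ℝ).prod volume) := by
  have hint := hu.integrable_weight hm hΨ hθ hC s
  have h1 := hint.integral_prod_left
  have e : ∀ t, ∫ h, ∫ y in Ω.cell d, θ t * Ψ h (u t (y + h)) (u s y) =
      θ t * cellPairing Ω Ψ (u t) (u s) := fun t => by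
    simp_rw [integral_const_mul]
    rfl
  constructor
  · have h2 := h1.integral_prod_left
    simp only [e] at h2
    exact h2
  · rw [← integral_prod_symm _ hint, integral_prod _ hint, integral_prod _ h1]
    simp_rw [e]

end IsRegularField

section WeakDerivative

variable {d : ℕ} {Ω : FlowDomain} {T : ℝ}
  {u v : ℝ → EuclideanSpace ℝ (Fin d) → EuclideanSpace ℝ (Fin d)}
  {G K : EuclideanSpace ℝ (Fin d) → ℝ}

/-- The weak identity for the field `u`, in the form used for the pairings. -/
lemma integral_correlation_add_flux_eq_zero
    (hv : IsWeakEulerSolution .wholeSpace T v) (huv : ∀ᵐ t, t ∈ Ioo 0 T → u t = v t)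
    (hG : ContDiff ℝ ∞ G) (hK : ContDiff ℝ ∞ K)
    (hGc : HasCompactSupport G) (hKc : HasCompactSupport K)
    (hGK : ∀ z, K z = -∑ i, fderiv ℝ (fderiv ℝ G) z (EuclideanSpace.single i 1)
      (EuclideanSpace.single i 1))
    {θ : ℝ → ℝ} (hθ : ContDiff ℝ ∞ θ) (hθc : HasCompactSupport θ) (hθT : tsupport θ ⊆ Ioo 0 T)
    (y w : EuclideanSpace ℝ (Fin d)) :
    ∫ z : ℝ × EuclideanSpace ℝ (Fin d), (deriv θ z.1 * correlationKernel K z.2 (u z.1 (y + z.2)) w +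
      θ z.1 * fluxKernel G K z.2 (u z.1 (y + z.2)) w) ∂((volume : Measure ℝ).prod volume) = 0 := by
  have h := hv.integral_solenoidalField hG hK hGc hKc hGK hθ hθc hθT y w
  have hmp : MeasurePreserving (fun z : ℝ × EuclideanSpace ℝ (Fin d) => (z.1, y + z.2))
      ((volume : Measure ℝ).prod volume) ((volume : Measure ℝ).prod volume) :=
    (MeasurePreserving.id _).prod (measurePreserving_add_left volume y)
  have hemb : MeasurableEmbedding (fun z : ℝ × EuclideanSpace ℝ (Fin d) => (z.1, y + z.2)) :=
    MeasurableEmbedding.id.prodMap (measurableEmbedding_addLeft y)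
  have hsub := hmp.integral_comp hemb fun z : ℝ × EuclideanSpace ℝ (Fin d) =>
    deriv θ z.1 * correlationKernel K (z.2 - y) (u z.1 z.2) w +
      θ z.1 * fluxKernel G K (z.2 - y) (u z.1 z.2) w
  simp only [add_sub_cancel_left] at hsub
  rw [hsub, ← h, ← setIntegral_eq_integral_of_forall_compl_eq_zero (s := Ioo 0 T ×ˢ univ)]
  · rw [← Measure.volume_eq_prod]
    refine integral_congr_ae ?_
    have hae : ∀ᵐ z : ℝ × EuclideanSpace ℝ (Fin d), z.1 ∈ Ioo 0 T → u z.1 = v z.1 :=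
      Measure.quasiMeasurePreserving_fst.ae huv
    filter_upwards [ae_restrict_of_ae hae,
      ae_restrict_mem (measurableSet_Ioo.prod MeasurableSet.univ)] with z hz hzm
    rw [hz hzm.1]
    simp [correlationKernel, fluxKernel]
  · intro z hz
    have hz1 : z.1 ∉ Ioo 0 T := fun h => hz ⟨h, mem_univ _⟩
    have h1 : θ z.1 = 0 := image_eq_zero_of_notMem_tsupport fun h => hz1 (hθT h)
    have h2 : deriv θ z.1 = 0 :=
      image_eq_zero_of_notMem_tsupport fun h => hz1 (hθT (tsupport_deriv_subset h))
    rw [h1, h2]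
    simp

/-- For each time `s`, the correlation of `u(t)` and `u(s)` has a weak derivative in `t`. -/
lemma integral_deriv_correlation_add_flux (hu : IsRegularField Ω T u)
    (hv : IsWeakEulerSolution .wholeSpace T v) (huv : ∀ᵐ t, t ∈ Ioo 0 T → u t = v t)
    (hG : ContDiff ℝ ∞ G) (hK : ContDiff ℝ ∞ K)
    (hGc : HasCompactSupport G) (hKc : HasCompactSupport K)
    (hGK : ∀ z, K z = -∑ i, fderiv ℝ (fderiv ℝ G) z (EuclideanSpace.single i 1)
      (EuclideanSpace.single i 1))
    {θ : ℝ → ℝ} (hθ : ContDiff ℝ ∞ θ) (hθc : HasCompactSupport θ) (hθT : tsupport θ ⊆ Ioo 0 T)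
    (s : ℝ) :
    ∫ t, (deriv θ t * cellPairing Ω (correlationKernel K) (u t) (u s) +
      θ t * cellPairing Ω (fluxKernel G K) (u t) (u s)) = 0 := by
  have hQ := isPairingKernel_correlation hK.continuous hKc
  have hB := isPairingKernel_flux hG hGc hK hKc
  have hθ' : Continuous (deriv θ) := hθ.continuous_deriv (by simp)
  obtain ⟨C₁, hC₁⟩ := hθc.deriv.exists_bound_of_continuous hθ'
  obtain ⟨C₂, hC₂⟩ := hθc.exists_bound_of_continuous hθ.continuous
  obtain ⟨i1, e1⟩ := hu.integral_weight (Or.inl rfl) hQ hθ' hC₁ s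
  obtain ⟨i2, e2⟩ := hu.integral_weight (Or.inr rfl) hB hθ.continuous hC₂ s
  have j1 := hu.integrable_weight (Or.inl rfl) hQ hθ' hC₁ s
  have j2 := hu.integrable_weight (Or.inr rfl) hB hθ.continuous hC₂ s
  rw [integral_add i1 i2, e1, e2, ← integral_add j1.integral_prod_right j2.integral_prod_right]
  -- for almost every `y` the weak formulation applies with the vector `w = u s y`
  refine integral_eq_zero_of_ae ?_
  filter_upwards [j1.prod_left_ae, j2.prod_left_ae] with y hy1 hy2
  have h3 := integral_add hy1 hy2
  refine h3.symm.trans ?_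
  exact integral_correlation_add_flux_eq_zero hv huv hG hK hGc hKc hGK hθ hθc hθT y (u s y)

/-- The correlation with an even kernel is symmetric: substitute `h ↦ -h` and translate by `h`. -/
lemma cellPairing_correlation_symm {f g : EuclideanSpace ℝ (Fin d) → EuclideanSpace ℝ (Fin d)}
    (hf : IsFunctionOn Ω f) (hg : IsFunctionOn Ω g) (hKe : ∀ z, K (-z) = K z) :
    cellPairing Ω (correlationKernel K) f g = cellPairing Ω (correlationKernel K) g f := by
  unfold cellPairing
  rw [← integral_neg_eq_self]
  congr 1
  ext h
  rw [← FlowDomain.setIntegral_cell_add (h := h)]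
  · refine integral_congr_ae (ae_of_all _ fun y => ?_)
    simp [correlationKernel, hKe, real_inner_comm]
  · intro l hl x
    simp only [add_right_comm x l, hf l hl, hg l hl]

end WeakDerivative

/-! ### The Kármán–Howarth–Monin identity -/

section TwoPoint

variable {d : ℕ} {Ω : FlowDomain} {f : EuclideanSpace ℝ (Fin d) → EuclideanSpace ℝ (Fin d)}

/-- Functions of the increment `h` and of the two values `f(y + h)`, `f(y)` are integrable when they
have an integrable weight in `h` and the growth of the integrability exponent of `f`. -/
lemma integrable_twoPoint {F : Type*} [NormedAddCommGroup F]
    {P : EuclideanSpace ℝ (Fin d) → EuclideanSpace ℝ (Fin d) → EuclideanSpace ℝ (Fin d) → F}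
    (hP : Continuous fun p : EuclideanSpace ℝ (Fin d) × EuclideanSpace ℝ (Fin d) ×
      EuclideanSpace ℝ (Fin d) => P p.1 p.2.1 p.2.2) {k : EuclideanSpace ℝ (Fin d) → ℝ}
    (hk : Integrable k) (m : ℕ) (hPk : ∀ h a b, ‖P h a b‖ ≤ k h * (‖a‖ ^ (m + 1) + ‖b‖ ^ (m + 1)))
    (hfp : IsFunctionOn Ω f) (hf : AEStronglyMeasurable f volume)
    (hf' : MemLp f (m + 1 : ℕ) (volume.restrict (Ω.cell d))) :
    Integrable (fun p : EuclideanSpace ℝ (Fin d) × EuclideanSpace ℝ (Fin d) =>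
      P p.1 (f (p.2 + p.1)) (f p.2)) (volume.prod (volume.restrict (Ω.cell d))) := by
  have hmeas : AEStronglyMeasurable (fun p : EuclideanSpace ℝ (Fin d) × EuclideanSpace ℝ (Fin d) =>
      P p.1 (f (p.2 + p.1)) (f p.2)) (volume.prod (volume.restrict (Ω.cell d))) :=
    hP.comp_aestronglyMeasurable (continuous_fst.aestronglyMeasurable.prodMk
      ((hf.comp_quasiMeasurePreserving (quasiMeasurePreserving_add_swap Ω)).prodMk hf'.1.comp_snd))
  refine ⟨hmeas, ?_⟩
  rw [HasFiniteIntegral, lintegral_prod _ hmeas.enorm]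
  have hN : ∫⁻ y in Ω.cell d, ‖f y‖ₑ ^ (m + 1) < ⊤ := by
    rw [lintegral_enorm_pow_eq]
    exact ENNReal.pow_lt_top hf'.2
  calc ∫⁻ h, ∫⁻ y in Ω.cell d, ‖P h (f (y + h)) (f y)‖ₑ
      ≤ ∫⁻ h, ‖k h‖ₑ * ((∫⁻ y in Ω.cell d, ‖f y‖ₑ ^ (m + 1)) +
          ∫⁻ y in Ω.cell d, ‖f y‖ₑ ^ (m + 1)) := by
        refine lintegral_mono fun h => ?_
        have e1 : ∫⁻ y in Ω.cell d, ‖f (y + h)‖ₑ ^ (m + 1) = ∫⁻ y in Ω.cell d, ‖f y‖ₑ ^ (m + 1) :=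
          FlowDomain.setLIntegral_cell_add (f := fun y => ‖f y‖ₑ ^ (m + 1))
            (fun l hl x => by simp only [hfp l hl x]) h
        have hm2 : AEMeasurable (fun y => ‖f y‖ₑ ^ (m + 1)) (volume.restrict (Ω.cell d)) :=
          hf'.1.enorm.pow_const _
        calc ∫⁻ y in Ω.cell d, ‖P h (f (y + h)) (f y)‖ₑ
            ≤ ∫⁻ y in Ω.cell d, ‖k h‖ₑ * (‖f (y + h)‖ₑ ^ (m + 1) + ‖f y‖ₑ ^ (m + 1)) := by
              refine lintegral_mono fun y => ?_
              have h1 : ‖P h (f (y + h)) (f y)‖ ≤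
                  ‖k h‖ * (‖f (y + h)‖ ^ (m + 1) + ‖f y‖ ^ (m + 1)) :=
                (hPk _ _ _).trans (by gcongr; exact le_abs_self _)
              rw [← ofReal_norm, ← ofReal_norm, ← ofReal_norm, ← ofReal_norm,
                ← ENNReal.ofReal_pow (norm_nonneg _), ← ENNReal.ofReal_pow (norm_nonneg _),
                ← ENNReal.ofReal_add (by positivity) (by positivity),
                ← ENNReal.ofReal_mul (by positivity)]
              exact ENNReal.ofReal_le_ofReal h1
          _ = ‖k h‖ₑ * ((∫⁻ y in Ω.cell d, ‖f (y + h)‖ₑ ^ (m + 1)) +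
              ∫⁻ y in Ω.cell d, ‖f y‖ₑ ^ (m + 1)) := by
              rw [lintegral_const_mul' _ _ enorm_ne_top, lintegral_add_right' _ hm2]
          _ = _ := by rw [e1]
    _ = (∫⁻ h, ‖k h‖ₑ) * ((∫⁻ y in Ω.cell d, ‖f y‖ₑ ^ (m + 1)) +
          ∫⁻ y in Ω.cell d, ‖f y‖ₑ ^ (m + 1)) :=
        lintegral_mul_const' _ _ (ENNReal.add_lt_top.2 ⟨hN, hN⟩).ne
    _ < ⊤ := ENNReal.mul_lt_top hk.2 (ENNReal.add_lt_top.2 ⟨hN, hN⟩)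

/-- Exchange of the two points `y` and `y + h`. -/
lemma integral_twoPoint_flip {F : Type*} [NormedAddCommGroup F] [NormedSpace ℝ F]
    (P : EuclideanSpace ℝ (Fin d) → EuclideanSpace ℝ (Fin d) → EuclideanSpace ℝ (Fin d) → F)
    (hfp : IsFunctionOn Ω f) :
    ∫ h, ∫ y in Ω.cell d, P h (f (y + h)) (f y) =
      ∫ h, ∫ y in Ω.cell d, P (-h) (f y) (f (y + h)) := by
  rw [← integral_neg_eq_self]
  congr 1
  ext h
  rw [← FlowDomain.setIntegral_cell_add (h := h)]
  · simp
  · intro l hl x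
    simp only [add_right_comm x l, hfp l hl]

variable {G K : EuclideanSpace ℝ (Fin d) → ℝ}

lemma fderiv_neg_of_even (hKe : ∀ z, K (-z) = K z) (z : EuclideanSpace ℝ (Fin d)) :
    fderiv ℝ K (-z) = -fderiv ℝ K z := by
  have h := fderiv_comp_smul (𝕜 := ℝ) (f := K) (c := -1) (x := z)
  simp only [neg_one_smul, hKe] at h
  rw [h, neg_neg]

/-- The Kármán–Howarth–Monin form of the energy flux: when the field is weakly divergence free, the
flux is an integral of cubes of velocity increments. -/
lemma flux_eq_integral_increments (hfp : IsFunctionOn Ω f) (hf : AEStronglyMeasurable f volume)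
    (hf' : MemLp f (2 + 1 : ℕ) (volume.restrict (Ω.cell d)))
    (hK : ContDiff ℝ ∞ K) (hKc : HasCompactSupport K) (hKe : ∀ z, K (-z) = K z)
    (hdiv : ∀ᵐ x, ∫ h, fderiv ℝ K h (f (x + h)) = 0) :
    ∫ h, ∫ y in Ω.cell d, fderiv ℝ K h (f (y + h)) * inner ℝ (f (y + h)) (f y) =
      -(1 / 4) * ∫ h, ∫ y in Ω.cell d,
        fderiv ℝ K h (f (y + h) - f y) * ‖f (y + h) - f y‖ ^ 2 := by
  have hDc : Continuous (fderiv ℝ K) := hK.continuous_fderiv (by simp)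
  have hDi : Integrable (fderiv ℝ K) := hDc.integrable_of_hasCompactSupport (hKc.fderiv ℝ)
  have hint : ∀ P : EuclideanSpace ℝ (Fin d) → EuclideanSpace ℝ (Fin d) →
      EuclideanSpace ℝ (Fin d) → ℝ,
      (Continuous fun p : EuclideanSpace ℝ (Fin d) × EuclideanSpace ℝ (Fin d) ×
        EuclideanSpace ℝ (Fin d) => P p.1 p.2.1 p.2.2) →
      (∀ h a b, |P h a b| ≤ ‖fderiv ℝ K h‖ * (‖a‖ + ‖b‖) ^ 3) →
      Integrable (fun p : EuclideanSpace ℝ (Fin d) × EuclideanSpace ℝ (Fin d) =>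
        P p.1 (f (p.2 + p.1)) (f p.2)) (volume.prod (volume.restrict (Ω.cell d))) := by
    intro P hP hb
    refine integrable_twoPoint hP (hDi.norm.const_mul 4) 2 (fun h a b => ?_) hfp hf hf'
    rw [Real.norm_eq_abs]
    refine (hb h a b).trans ?_
    have h1 : (‖a‖ + ‖b‖) ^ 3 ≤ 4 * (‖a‖ ^ 3 + ‖b‖ ^ 3) := by
      nlinarith [mul_nonneg (add_nonneg (norm_nonneg a) (norm_nonneg b)) (sq_nonneg (‖a‖ - ‖b‖))]
    calc ‖fderiv ℝ K h‖ * (‖a‖ + ‖b‖) ^ 3 ≤ ‖fderiv ℝ K h‖ * (4 * (‖a‖ ^ 3 + ‖b‖ ^ 3)) := by gcongr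
      _ = _ := by norm_num; ring
  have hD1 : Continuous fun p : EuclideanSpace ℝ (Fin d) × EuclideanSpace ℝ (Fin d) ×
        EuclideanSpace ℝ (Fin d) => fderiv ℝ K p.1 p.2.1 :=
    (hDc.comp continuous_fst).clm_apply (continuous_fst.comp continuous_snd)
  have hD2 : Continuous fun p : EuclideanSpace ℝ (Fin d) × EuclideanSpace ℝ (Fin d) ×
        EuclideanSpace ℝ (Fin d) => fderiv ℝ K p.1 p.2.2 :=
    (hDc.comp continuous_fst).clm_apply (continuous_snd.comp continuous_snd)
  have hin : Continuous fun p : EuclideanSpace ℝ (Fin d) × EuclideanSpace ℝ (Fin d) ×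
        EuclideanSpace ℝ (Fin d) => (inner ℝ p.2.1 p.2.2 : ℝ) :=
    (continuous_fst.comp continuous_snd).inner (continuous_snd.comp continuous_snd)
  have hn1 : Continuous fun p : EuclideanSpace ℝ (Fin d) × EuclideanSpace ℝ (Fin d) ×
        EuclideanSpace ℝ (Fin d) => ‖p.2.1‖ ^ 2 := by fun_prop
  have hn2 : Continuous fun p : EuclideanSpace ℝ (Fin d) × EuclideanSpace ℝ (Fin d) ×
        EuclideanSpace ℝ (Fin d) => ‖p.2.2‖ ^ 2 := by fun_prop
  have hbd : ∀ (h c : EuclideanSpace ℝ (Fin d)) (r A : ℝ), ‖c‖ ≤ A → |r| ≤ A ^ 2 →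
      |fderiv ℝ K h c * r| ≤ ‖fderiv ℝ K h‖ * A ^ 3 := fun h c r A hc hr => by
    have hA : 0 ≤ A := (norm_nonneg c).trans hc
    rw [abs_mul]
    calc |fderiv ℝ K h c| * |r| ≤ (‖fderiv ℝ K h‖ * A) * A ^ 2 := by
          gcongr
          exact ((fderiv ℝ K h).le_opNorm c).trans (by gcongr)
      _ = _ := by ring
  have ha : ∀ a b : EuclideanSpace ℝ (Fin d), ‖a‖ ≤ ‖a‖ + ‖b‖ := fun a b => by simp
  have hb : ∀ a b : EuclideanSpace ℝ (Fin d), ‖b‖ ≤ ‖a‖ + ‖b‖ := fun a b => by simp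
  have ha2 : ∀ a b : EuclideanSpace ℝ (Fin d), |‖a‖ ^ 2| ≤ (‖a‖ + ‖b‖) ^ 2 := fun a b => by
    rw [abs_of_nonneg (by positivity)]
    gcongr
    exact ha a b
  have hb2 : ∀ a b : EuclideanSpace ℝ (Fin d), |‖b‖ ^ 2| ≤ (‖a‖ + ‖b‖) ^ 2 := fun a b => by
    rw [abs_of_nonneg (by positivity)]
    gcongr
    exact hb a b
  have hab : ∀ a b : EuclideanSpace ℝ (Fin d), |(inner ℝ a b : ℝ)| ≤ (‖a‖ + ‖b‖) ^ 2 := fun a b => by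
    refine (abs_real_inner_le_norm a b).trans ?_
    nlinarith [norm_nonneg a, norm_nonneg b]
  -- The six terms in the expansion of the cube. Two of them are, up to sign, the flux. The others
  -- vanish: `i3` and its mirror image `i4` by incompressibility, `i5` and its mirror image `i6`
  -- because the gradient of an even function is odd.
  have i1 := hint (fun h a b => fderiv ℝ K h a * inner ℝ a b) (hD1.mul hin)
    fun h a b => hbd h a _ _ (ha a b) (hab a b)
  have i2 := hint (fun h a b => fderiv ℝ K h b * inner ℝ a b) (hD2.mul hin)
    fun h a b => hbd h b _ _ (hb a b) (hab a b)
  have i3 := hint (fun h a b => fderiv ℝ K h a * ‖b‖ ^ 2) (hD1.mul hn2)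
    fun h a b => hbd h a _ _ (ha a b) (hb2 a b)
  have i4 := hint (fun h a b => fderiv ℝ K h b * ‖a‖ ^ 2) (hD2.mul hn1)
    fun h a b => hbd h b _ _ (hb a b) (ha2 a b)
  have i5 := hint (fun h a b => fderiv ℝ K h b * ‖b‖ ^ 2) (hD2.mul hn2)
    fun h a b => hbd h b _ _ (hb a b) (hb2 a b)
  have i6 := hint (fun h a b => fderiv ℝ K h a * ‖a‖ ^ 2) (hD1.mul hn1)
    fun h a b => hbd h a _ _ (ha a b) (ha2 a b)
  have e2 : ∫ h, ∫ y in Ω.cell d, fderiv ℝ K h (f y) * inner ℝ (f (y + h)) (f y) =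
      -∫ h, ∫ y in Ω.cell d, fderiv ℝ K h (f (y + h)) * inner ℝ (f (y + h)) (f y) := by
    rw [integral_twoPoint_flip (fun h a b => fderiv ℝ K h a * inner ℝ a b) hfp, ← integral_neg]
    congr 1
    ext h
    rw [← integral_neg]
    congr 1
    ext y
    rw [fderiv_neg_of_even hKe, real_inner_comm]
    simp
  have e3 : ∫ h, ∫ y in Ω.cell d, fderiv ℝ K h (f (y + h)) * ‖f y‖ ^ 2 = 0 := by
    rw [integral_integral_swap i3]
    refine integral_eq_zero_of_ae ?_
    filter_upwards [ae_restrict_of_ae hdiv] with y hy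
    rw [integral_mul_const, hy, zero_mul]
    rfl
  have e4 : ∫ h, ∫ y in Ω.cell d, fderiv ℝ K h (f y) * ‖f (y + h)‖ ^ 2 = 0 := by
    rw [integral_twoPoint_flip (fun h a b => fderiv ℝ K h b * ‖a‖ ^ 2) hfp]
    simp_rw [fderiv_neg_of_even hKe]
    simp only [neg_apply, neg_mul, integral_neg, e3, neg_zero]
  have e5 : ∫ h, ∫ y in Ω.cell d, fderiv ℝ K h (f y) * ‖f y‖ ^ 2 = 0 := by
    have h := integral_neg_eq_self
      (fun h => ∫ y in Ω.cell d, fderiv ℝ K h (f y) * ‖f y‖ ^ 2) volume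
    simp_rw [fderiv_neg_of_even hKe] at h
    simp only [neg_apply, neg_mul, integral_neg] at h
    linarith
  have e6 : ∫ h, ∫ y in Ω.cell d, fderiv ℝ K h (f (y + h)) * ‖f (y + h)‖ ^ 2 = 0 := by
    rw [integral_twoPoint_flip (fun h a b => fderiv ℝ K h a * ‖a‖ ^ 2) hfp]
    simp_rw [fderiv_neg_of_even hKe]
    simp only [neg_apply, neg_mul, integral_neg, e5, neg_zero]
  have c1 := integral_prod _ i1
  have c2 := integral_prod _ i2
  have c3 := integral_prod _ i3
  have c4 := integral_prod _ i4
  have c5 := integral_prod _ i5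
  have c6 := integral_prod _ i6
  simp only at c1 c2 c3 c4 c5 c6
  rw [← c1] at e2 ⊢
  rw [← c2] at e2
  rw [← c3] at e3
  rw [← c4] at e4
  rw [← c5] at e5
  rw [← c6] at e6
  have hexp : ∀ h a b : EuclideanSpace ℝ (Fin d), fderiv ℝ K h (a - b) * ‖a - b‖ ^ 2 =
      ((fderiv ℝ K h a * ‖a‖ ^ 2 + fderiv ℝ K h a * ‖b‖ ^ 2) -
        (fderiv ℝ K h b * ‖a‖ ^ 2 + fderiv ℝ K h b * ‖b‖ ^ 2)) -
        2 * (fderiv ℝ K h a * inner ℝ a b - fderiv ℝ K h b * inner ℝ a b) := fun h a b => by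
    rw [map_sub, norm_sub_sq_real]
    ring
  have itot := ((i6.add i3).sub (i4.add i5)).sub ((i1.sub i2).const_mul 2)
  simp_rw [hexp]
  have ct := integral_prod _ itot
  simp only [Pi.add_apply, Pi.sub_apply] at ct
  rw [← ct]
  have s1 := integral_sub ((i6.add i3).sub (i4.add i5)) ((i1.sub i2).const_mul 2)
  have s2 := integral_sub (i6.add i3) (i4.add i5)
  have s3 := integral_add i6 i3
  have s4 := integral_add i4 i5
  have s5 := integral_sub i1 i2
  simp only [Pi.add_apply, Pi.sub_apply, integral_const_mul] at s1 s2 s3 s4 s5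
  rw [s1, s2, s3, s4, s5, e2, e3, e4, e5, e6]
  ring

end TwoPoint

/-! ### Vanishing of the pressure term at equal times -/

section EqualTimes

variable {d : ℕ} {Ω : FlowDomain} {f : EuclideanSpace ℝ (Fin d) → EuclideanSpace ℝ (Fin d)}
  {G K : EuclideanSpace ℝ (Fin d) → ℝ}

set_option maxSynthPendingDepth 4 in
set_option synthInstance.maxHeartbeats 100000 in
/-- A cubic form of the velocity at two points vanishes if its coefficients are symmetric, and
divergences of test functions when contracted with the velocity once. -/
lemma integral_cubic_eq_zero (hfp : IsFunctionOn Ω f) (hf : AEStronglyMeasurable f volume)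
    (hf' : MemLp f (2 + 1 : ℕ) (volume.restrict (Ω.cell d)))
    {A : EuclideanSpace ℝ (Fin d) → EuclideanSpace ℝ (Fin d) →L[ℝ] EuclideanSpace ℝ (Fin d) →L[ℝ]
      EuclideanSpace ℝ (Fin d) →L[ℝ] ℝ} (hA : Continuous A) (hAi : Integrable A)
    (hrot : ∀ z a b, A z a a b = A z b a a)
    (hdiv : ∀ᵐ x, ∫ h, A (-h) (f (x + h)) = 0) :
    ∫ h, ∫ y in Ω.cell d, A h (f (y + h)) (f (y + h)) (f y) = 0 := by
  have hT : Continuous fun h => A (-h) := hA.comp continuous_neg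
  have hTi : Integrable fun h => A (-h) := hAi.comp_neg
  have hT1 : Continuous fun p : EuclideanSpace ℝ (Fin d) × EuclideanSpace ℝ (Fin d) ×
        EuclideanSpace ℝ (Fin d) => A (-p.1) p.2.1 :=
    (hT.comp continuous_fst).clm_apply (continuous_fst.comp continuous_snd)
  have hle' : ∀ h a b : EuclideanSpace ℝ (Fin d),
      ‖A (-h)‖ * ‖a‖ * ‖b‖ ^ 2 ≤ ‖A (-h)‖ * (‖a‖ ^ (2 + 1) + ‖b‖ ^ (2 + 1)) := fun h a b => by
    have h1 : ‖a‖ * ‖b‖ ^ 2 ≤ ‖a‖ ^ (2 + 1) + ‖b‖ ^ (2 + 1) := by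
      rcases le_total ‖a‖ ‖b‖ with hab | hab
      · calc ‖a‖ * ‖b‖ ^ 2 ≤ ‖b‖ * ‖b‖ ^ 2 := by gcongr
          _ = ‖b‖ ^ (2 + 1) := by ring
          _ ≤ _ := le_add_of_nonneg_left (by positivity)
      · calc ‖a‖ * ‖b‖ ^ 2 ≤ ‖a‖ * ‖a‖ ^ 2 := by gcongr
          _ = ‖a‖ ^ (2 + 1) := by ring
          _ ≤ _ := le_add_of_nonneg_right (by positivity)
    rw [mul_assoc]
    gcongr
  have i1 := integrable_twoPoint (P := fun h a b => A (-h) a b b)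
    ((hT1.clm_apply (continuous_snd.comp continuous_snd)).clm_apply
      (continuous_snd.comp continuous_snd)) hTi.norm 2 (fun h a b => by
        refine le_trans ?_ (hle' h a b)
        refine (ContinuousLinearMap.le_opNorm _ _).trans ?_
        rw [pow_two, ← mul_assoc]
        gcongr
        refine (ContinuousLinearMap.le_opNorm _ _).trans ?_
        gcongr
        exact ContinuousLinearMap.le_opNorm _ _) hfp hf hf'
  have i2 := integrable_twoPoint (P := fun h a b => ‖b‖ ^ 2 • A (-h) a)
    (((continuous_snd.comp continuous_snd).norm.pow 2).smul hT1) hTi.norm 2 (fun h a b => by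
        refine le_trans ?_ (hle' h a b)
        rw [norm_smul, mul_comm, Real.norm_of_nonneg (by positivity)]
        gcongr
        exact ContinuousLinearMap.le_opNorm _ _) hfp hf hf'
  rw [integral_twoPoint_flip (fun h a b => A h a a b) hfp]
  have e : ∫ h, ∫ y in Ω.cell d, A (-h) (f y) (f y) (f (y + h)) =
      ∫ h, ∫ y in Ω.cell d, A (-h) (f (y + h)) (f y) (f y) := by
    congr 1
    ext h
    congr 1
    ext y
    exact hrot _ _ _
  rw [e, integral_integral_swap i1]
  refine integral_eq_zero_of_ae ?_
  filter_upwards [ae_restrict_of_ae hdiv, i2.prod_left_ae] with y hy hy2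
  by_cases hfy : f y = 0
  · simp [hfy]
  have hne : ‖f y‖ ^ 2 ≠ 0 := by simpa using hfy
  -- weighting with `‖f y‖ ^ 2` gives integrability in `h` at the points where it is needed
  have hy3 : Integrable fun h => A (-h) (f (y + h)) := (integrable_fun_smul_iff hne _).1 hy2
  rw [Pi.zero_apply, ← ContinuousLinearMap.integral_apply (hy3.apply_continuousLinearMap _),
    ← ContinuousLinearMap.integral_apply hy3, hy]
  simp

lemma fderiv_neg_comp_neg {E F : Type*} [NormedAddCommGroup E] [NormedSpace ℝ E]
    [NormedAddCommGroup F] [NormedSpace ℝ F] (g : E → F) (h : E) :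
    fderiv ℝ (fun z => -g (-z)) h = fderiv ℝ g (-h) := by
  have h1 := fderiv_comp_smul (𝕜 := ℝ) (f := g) (c := -1) (x := h)
  simp only [neg_one_smul] at h1
  rw [fderiv_fun_neg, h1, neg_neg]

end EqualTimes

section WeakDivergence

variable {d : ℕ} {Ω : FlowDomain} {T : ℝ}
  {u v : ℝ → EuclideanSpace ℝ (Fin d) → EuclideanSpace ℝ (Fin d)}
  {F : Type*} [NormedAddCommGroup F] [NormedSpace ℝ F] [CompleteSpace F]
  {g : EuclideanSpace ℝ (Fin d) → F}

/-- At almost every time the field is weakly divergence free around almost every point. -/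
lemma IsRegularField.ae_ae_integral_fderiv_eq_zero (hu : IsRegularField Ω T u)
    (hv : IsWeakEulerSolution .wholeSpace T v) (huv : ∀ᵐ t, t ∈ Ioo 0 T → u t = v t)
    (hg : ContDiff ℝ ∞ g) (hgc : HasCompactSupport g) :
    ∀ᵐ t, ∀ᵐ x, ∫ h, fderiv ℝ g h (u t (x + h)) = 0 := by
  have hmp : Measure.QuasiMeasurePreserving
      (fun p : (ℝ × EuclideanSpace ℝ (Fin d)) × EuclideanSpace ℝ (Fin d) => (p.1.1, p.1.2 + p.2))
      (((volume : Measure ℝ).prod volume).prod volume) ((volume : Measure ℝ).prod volume) := by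
    have h1 : Measure.QuasiMeasurePreserving
        (fun z : EuclideanSpace ℝ (Fin d) × EuclideanSpace ℝ (Fin d) => z.1 + z.2)
        ((volume : Measure (EuclideanSpace ℝ (Fin d))).prod volume) volume :=
      Measure.quasiMeasurePreserving_snd.comp
        (measurePreserving_prod_add volume volume).quasiMeasurePreserving
    exact (QuasiMeasurePreserving.prodMap (Measure.QuasiMeasurePreserving.id _) h1).comp
      (measurePreserving_prodAssoc (volume : Measure ℝ) volume volume).quasiMeasurePreserving
  have hmeas : AEStronglyMeasurable
      (fun p : (ℝ × EuclideanSpace ℝ (Fin d)) × EuclideanSpace ℝ (Fin d) =>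
        fderiv ℝ g p.2 (u p.1.1 (p.1.2 + p.2)))
      (((volume : Measure ℝ).prod volume).prod volume) := by
    have h2 := hu.aestronglyMeasurable.comp_quasiMeasurePreserving hmp
    have h3 : Continuous fun q : EuclideanSpace ℝ (Fin d) × EuclideanSpace ℝ (Fin d) =>
        fderiv ℝ g q.1 q.2 :=
      ((hg.continuous_fderiv (by simp)).comp continuous_fst).clm_apply continuous_snd
    exact h3.comp_aestronglyMeasurable (continuous_snd.aestronglyMeasurable.prodMk h2)
  have hW := hmeas.integral_prod_right'
  have h0 : ∀ᵐ z ∂((volume : Measure ℝ).prod (volume : Measure (EuclideanSpace ℝ (Fin d)))),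
      ‖∫ h, fderiv ℝ g h (u z.1 (z.2 + h))‖ₑ = 0 := by
    refine (lintegral_eq_zero_iff' hW.enorm).1 ?_
    rw [lintegral_prod_symm _ hW.enorm]
    refine (lintegral_congr fun x => ?_).trans lintegral_zero
    refine (lintegral_congr_ae ?_).trans lintegral_zero
    filter_upwards [hv.ae_integral_fderiv_eq_zero hg hgc x, huv] with t ht htu
    by_cases htT : t ∈ Ioo 0 T
    · have h4 := ht htT
      rw [← integral_add_left_eq_self _ x] at h4
      simp only [add_sub_cancel_left] at h4
      simp only [htu htT, h4, enorm_zero]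
    · simp [hu.eq_zero t htT]
  filter_upwards [Measure.ae_ae_of_ae_prod h0] with t ht
  filter_upwards [ht] with x hx
  simpa using hx

end WeakDivergence

/-! ### The correlation balance in terms of velocity increments -/

section Increments

variable {d : ℕ}

/-- The integral over `Ω` and over all increments `h` of `|DK(h)| |f(y + h) - f(y)|³`, which
dominates the energy flux at the scale of the kernel `K`. -/
noncomputable def cubicDefect (Ω : FlowDomain) (K : EuclideanSpace ℝ (Fin d) → ℝ)
    (f : EuclideanSpace ℝ (Fin d) → EuclideanSpace ℝ (Fin d)) : ℝ≥0∞ :=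
  ∫⁻ h, ∫⁻ y in Ω.cell d, ‖fderiv ℝ K h‖ₑ * ‖f (y + h) - f y‖ₑ ^ 3

/-- The integral over `Ω` and over all increments `h` of `|K(h)| |f(y + h) - f(y)|²`, which for
`K ≥ 0` is twice the difference of `(∫ K) ‖f‖²` and the correlation with kernel `K`. -/
noncomputable def quadraticDefect (Ω : FlowDomain) (K : EuclideanSpace ℝ (Fin d) → ℝ)
    (f : EuclideanSpace ℝ (Fin d) → EuclideanSpace ℝ (Fin d)) : ℝ≥0∞ :=
  ∫⁻ h, ∫⁻ y in Ω.cell d, ‖K h‖ₑ * ‖f (y + h) - f y‖ₑ ^ 2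

variable {Ω : FlowDomain} {f : EuclideanSpace ℝ (Fin d) → EuclideanSpace ℝ (Fin d)}
  {G K K₁ K₂ : EuclideanSpace ℝ (Fin d) → ℝ}

lemma aestronglyMeasurable_increment (hf : AEStronglyMeasurable f volume) :
    AEStronglyMeasurable (fun p : EuclideanSpace ℝ (Fin d) × EuclideanSpace ℝ (Fin d) =>
      f (p.2 + p.1) - f p.2) (volume.prod (volume.restrict (Ω.cell d))) :=
  (hf.comp_quasiMeasurePreserving (quasiMeasurePreserving_add_swap Ω)).sub hf.restrict.comp_snd

set_option maxSynthPendingDepth 4 in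
set_option synthInstance.maxHeartbeats 100000 in
/-- At equal times, the weak time derivative of the correlation is an integral of cubes of velocity
increments. -/
lemma cellPairing_fluxKernel_self (hfp : IsFunctionOn Ω f) (hf : AEStronglyMeasurable f volume)
    (hf' : MemLp f (2 + 1 : ℕ) (volume.restrict (Ω.cell d)))
    (hG : ContDiff ℝ ∞ G) (hK : ContDiff ℝ ∞ K)
    (hGc : HasCompactSupport G) (hKc : HasCompactSupport K) (hKe : ∀ z, K (-z) = K z)
    (hdivK : ∀ᵐ x, ∫ h, fderiv ℝ K h (f (x + h)) = 0)
    (hdivG : ∀ᵐ x, ∫ h, fderiv ℝ (fun z => -fderiv ℝ (fderiv ℝ G) (-z)) h (f (x + h)) = 0) :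
    cellPairing Ω (fluxKernel G K) f f = -(1 / 4) * ∫ h, ∫ y in Ω.cell d,
        fderiv ℝ K h (f (y + h) - f y) * ‖f (y + h) - f y‖ ^ 2 := by
  have hA : Continuous (fderiv ℝ (fderiv ℝ (fderiv ℝ G))) :=
    hG.fderiv_infty.fderiv_infty.continuous_fderiv (by simp)
  have h3 := integral_cubic_eq_zero hfp hf hf' hA
    (hA.integrable_of_hasCompactSupport (((hGc.fderiv ℝ).fderiv ℝ).fderiv ℝ))
    (fun z a b => hG.third_fderiv_rotate z a a b) (by simpa only [fderiv_neg_comp_neg] using hdivG)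
  have hDc : Continuous (fderiv ℝ K) := hK.continuous_fderiv (by simp)
  have i1 := integrable_twoPoint (P := fun h a b => fderiv ℝ K h a * inner ℝ a b)
    (((hDc.comp continuous_fst).clm_apply (continuous_fst.comp continuous_snd)).mul
      ((continuous_fst.comp continuous_snd).inner (continuous_snd.comp continuous_snd)))
    (hDc.integrable_of_hasCompactSupport (hKc.fderiv ℝ)).norm 2 (fun h a b => by
      rw [norm_mul]
      have h1 : ‖a‖ * (‖a‖ * ‖b‖) ≤ ‖a‖ ^ (2 + 1) + ‖b‖ ^ (2 + 1) := by
        rcases le_total ‖a‖ ‖b‖ with hab | hab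
        · calc ‖a‖ * (‖a‖ * ‖b‖) ≤ ‖b‖ * (‖b‖ * ‖b‖) := by gcongr
            _ = ‖b‖ ^ (2 + 1) := by ring
            _ ≤ _ := le_add_of_nonneg_left (by positivity)
        · calc ‖a‖ * (‖a‖ * ‖b‖) ≤ ‖a‖ * (‖a‖ * ‖a‖) := by gcongr
            _ = ‖a‖ ^ (2 + 1) := by ring
            _ ≤ _ := le_add_of_nonneg_right (by positivity)
      calc ‖fderiv ℝ K h a‖ * ‖(inner ℝ a b : ℝ)‖ ≤ (‖fderiv ℝ K h‖ * ‖a‖) * (‖a‖ * ‖b‖) := by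
            gcongr
            · exact (fderiv ℝ K h).le_opNorm a
            · exact norm_inner_le_norm _ _
        _ = ‖fderiv ℝ K h‖ * (‖a‖ * (‖a‖ * ‖b‖)) := by ring
        _ ≤ _ := by gcongr) hfp hf hf'
  have hΨ := isPairingKernel_flux hG hGc hK hKc
  have i2 := hΨ.integrable_prod hfp hf hf' hf'
  have i3 := i2.sub i1
  have e1 := integral_prod _ i1
  have e3 := integral_prod _ i3
  have es := integral_sub i2 i1
  simp only [fluxKernel, Pi.sub_apply, add_apply, smul_apply, innerSL_apply_apply,
    smul_eq_mul, add_sub_cancel_left] at e1 e3 es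
  rw [e3, h3] at es
  rw [← flux_eq_integral_increments hfp hf hf' hK hKc hKe hdivK,
    hΨ.cellPairing_eq_integral_prod hfp hf hf' hf', ← e1]
  simp only [fluxKernel, add_apply, smul_apply, innerSL_apply_apply, smul_eq_mul]
  linarith

lemma enorm_integral_increments_sub_le (hf : AEStronglyMeasurable f volume)
    (hK₁ : ContDiff ℝ ∞ K₁) (hK₂ : ContDiff ℝ ∞ K₂) :
    ‖∫ h, ∫ y in Ω.cell d, fderiv ℝ (fun z => K₁ z - K₂ z) h (f (y + h) - f y) *
        ‖f (y + h) - f y‖ ^ 2‖ₑ ≤ cubicDefect Ω K₁ f + cubicDefect Ω K₂ f := by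
  have hm : AEMeasurable (fun p : EuclideanSpace ℝ (Fin d) × EuclideanSpace ℝ (Fin d) =>
      ‖fderiv ℝ K₁ p.1‖ₑ * ‖f (p.2 + p.1) - f p.2‖ₑ ^ 3)
      (volume.prod (volume.restrict (Ω.cell d))) :=
    ((hK₁.continuous_fderiv (by simp)).comp continuous_fst).enorm.aemeasurable.mul
      ((aestronglyMeasurable_increment hf).enorm.pow_const 3)
  refine (enorm_integral_le_lintegral_enorm _).trans
    ((lintegral_mono fun _ => enorm_integral_le_lintegral_enorm _).trans ?_)
  rw [cubicDefect, cubicDefect, ← lintegral_add_left' hm.lintegral_prod_right']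
  refine lintegral_mono fun h => ?_
  have hδ : AEMeasurable (fun y => ‖fderiv ℝ K₁ h‖ₑ * ‖f (y + h) - f y‖ₑ ^ 3)
      (volume.restrict (Ω.cell d)) :=
    ((((hf.comp_measurePreserving (measurePreserving_add_right volume h)).sub hf).enorm.pow_const
      3).const_mul _).restrict
  rw [← lintegral_add_left' hδ]
  refine lintegral_mono fun y => ?_
  rw [enorm_mul, ← add_mul, pow_succ' _ 2, ← mul_assoc, enorm_pow, enorm_norm]
  gcongr
  rw [fderiv_fun_sub (hK₁.differentiable (by simp) h) (hK₂.differentiable (by simp) h)]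
  exact (ContinuousLinearMap.le_opENorm _ _).trans (by gcongr; exact enorm_sub_le)

/-- The energy that is not seen by the correlation is an integral of squares of velocity
increments. -/
lemma integral_sq_sub_cellPairing (hfp : IsFunctionOn Ω f) (hf : AEStronglyMeasurable f volume)
    (hf' : MemLp f (1 + 1 : ℕ) (volume.restrict (Ω.cell d)))
    (hK : Continuous K) (hKc : HasCompactSupport K) :
    (∫ h, K h) * (∫ y in Ω.cell d, ‖f y‖ ^ 2) - cellPairing Ω (correlationKernel K) f f =
      (1 / 2) * ∫ h, ∫ y in Ω.cell d, K h * ‖f (y + h) - f y‖ ^ 2 := by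
  have hKi := hK.integrable_of_hasCompactSupport hKc (μ := volume)
  have hint : ∀ P : EuclideanSpace ℝ (Fin d) → EuclideanSpace ℝ (Fin d) → ℝ,
      (Continuous fun p : EuclideanSpace ℝ (Fin d) × EuclideanSpace ℝ (Fin d) => P p.1 p.2) →
      (∀ a b, |P a b| ≤ ‖a‖ ^ 2 + ‖b‖ ^ 2) →
      Integrable (fun p : EuclideanSpace ℝ (Fin d) × EuclideanSpace ℝ (Fin d) =>
        K p.1 * P (f (p.2 + p.1)) (f p.2)) (volume.prod (volume.restrict (Ω.cell d))) := by
    intro P hP hb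
    refine integrable_twoPoint (P := fun h a b => K h * P a b)
      ((hK.comp continuous_fst).mul (hP.comp continuous_snd)) hKi.norm 1 (fun h a b => ?_) hfp hf hf'
    rw [norm_mul]
    gcongr
    exact hb a b
  have i1 := hint (fun a b => inner ℝ a b) (continuous_fst.inner continuous_snd) fun a b => by
    refine (abs_real_inner_le_norm a b).trans ?_
    nlinarith [sq_nonneg (‖a‖ - ‖b‖), sq_nonneg ‖a‖, sq_nonneg ‖b‖]
  have i2 := hint (fun a _ => ‖a‖ ^ 2) (by fun_prop) fun a b => by
    rw [abs_of_nonneg (by positivity)]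
    exact le_add_of_nonneg_right (by positivity)
  have i3 := hint (fun _ b => ‖b‖ ^ 2) (by fun_prop) fun a b => by
    rw [abs_of_nonneg (by positivity)]
    exact le_add_of_nonneg_left (by positivity)
  have c1 := integral_prod _ i1
  have c2 := integral_prod _ i2
  have c3 := integral_prod _ i3
  have it := (i2.add i3).sub (i1.const_mul 2)
  have ct := integral_prod _ it
  have s1 := integral_sub (i2.add i3) (i1.const_mul 2)
  have s2 := integral_add i2 i3
  simp only [Pi.add_apply, Pi.sub_apply, integral_const_mul] at c1 c2 c3 ct s1 s2
  have e2 : ∀ h, ∫ y in Ω.cell d, ‖f (y + h)‖ ^ 2 = ∫ y in Ω.cell d, ‖f y‖ ^ 2 := fun h =>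
    FlowDomain.setIntegral_cell_add (f := fun y => ‖f y‖ ^ 2)
      (fun l hl x => by simp only [hfp l hl x]) h
  simp only [e2, integral_mul_const] at c2 c3
  have hexp : ∀ h a b : EuclideanSpace ℝ (Fin d), K h * ‖a - b‖ ^ 2 =
      (K h * ‖a‖ ^ 2 + K h * ‖b‖ ^ 2) - 2 * (K h * inner ℝ a b) := fun h a b => by
    rw [norm_sub_sq_real]
    ring
  simp_rw [hexp]
  rw [← ct, s1, s2, c2, c3, c1, cellPairing]
  simp only [correlationKernel, smul_apply, innerSL_apply_apply, smul_eq_mul, integral_const_mul]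
  ring

lemma enorm_integral_increments_le_quadraticDefect :
    ‖∫ h, ∫ y in Ω.cell d, K h * ‖f (y + h) - f y‖ ^ 2‖ₑ ≤ quadraticDefect Ω K f := by
  refine (enorm_integral_le_lintegral_enorm _).trans
    (lintegral_mono fun h => (enorm_integral_le_lintegral_enorm _).trans_eq ?_)
  simp [enorm_mul]

end Increments

namespace IsRegularField

variable {d : ℕ} {Ω : FlowDomain} {T : ℝ}
  {u v : ℝ → EuclideanSpace ℝ (Fin d) → EuclideanSpace ℝ (Fin d)}
  {G K K₁ K₂ : EuclideanSpace ℝ (Fin d) → ℝ}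

/-- The balance law for the correlation of the velocity with itself. -/
lemma integral_deriv_mul_cellPairing (hu : IsRegularField Ω T u)
    (hv : IsWeakEulerSolution .wholeSpace T v) (huv : ∀ᵐ t, t ∈ Ioo 0 T → u t = v t)
    (hG : ContDiff ℝ ∞ G) (hK : ContDiff ℝ ∞ K)
    (hGc : HasCompactSupport G) (hKc : HasCompactSupport K) (hKe : ∀ z, K (-z) = K z)
    (hGK : ∀ z, K z = -∑ i, fderiv ℝ (fderiv ℝ G) z (EuclideanSpace.single i 1)
      (EuclideanSpace.single i 1))
    {ψ : ℝ → ℝ} (hψ : ContDiff ℝ ∞ ψ) (hψc : HasCompactSupport ψ) (hψT : tsupport ψ ⊆ Ioo 0 T) :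
    ∫ t, deriv ψ t * cellPairing Ω (correlationKernel K) (u t) (u t) =
      (1 / 2) * ∫ t, ψ t * ∫ h, ∫ y in Ω.cell d,
        fderiv ℝ K h (u t (y + h) - u t y) * ‖u t (y + h) - u t y‖ ^ 2 := by
  have hQ := hu.hasDiagonal_cellPairing (Or.inl rfl) (isPairingKernel_correlation hK.continuous hKc)
  have hB := hu.hasDiagonal_cellPairing (Or.inr rfl) (isPairingKernel_flux hG hGc hK hKc)
  rw [hQ.integral_deriv_mul_diag hB
    (fun t s => cellPairing_correlation_symm (hu.periodic t) (hu.periodic s) hKe)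
    (fun s θ hθ hθc hθT =>
      integral_deriv_correlation_add_flux hu hv huv hG hK hGc hKc hGK hθ hθc hθT s) hψ hψc hψT]
  have hg : ContDiff ℝ ∞ fun z => -fderiv ℝ (fderiv ℝ G) (-z) :=
    (hG.fderiv_infty.fderiv_infty.comp contDiff_neg).neg
  have hgc : HasCompactSupport fun z => -fderiv ℝ (fderiv ℝ G) (-z) :=
    (((hGc.fderiv ℝ).fderiv ℝ).comp_homeomorph (Homeomorph.neg _)).neg
  have e : ∫ t, ψ t * cellPairing Ω (fluxKernel G K) (u t) (u t) =
      ∫ t, -(1 / 4) * (ψ t * ∫ h, ∫ y in Ω.cell d,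
        fderiv ℝ K h (u t (y + h) - u t y) * ‖u t (y + h) - u t y‖ ^ 2) := by
    refine integral_congr_ae ?_
    filter_upwards [hu.ae_ae_integral_fderiv_eq_zero hv huv hK hKc,
      hu.ae_ae_integral_fderiv_eq_zero hv huv hg hgc] with t h1 h2
    rw [cellPairing_fluxKernel_self (hu.periodic t) (hu.aestronglyMeasurable_slice t)
      (hu.memLp_slice 2 (Or.inr rfl) t) hG hK hGc hKc hKe h1 h2]
    ring
  rw [e, integral_const_mul]
  ring

end IsRegularField

/-! ### Defects at a given scale and Besov regularity -/

section Rescale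

variable {d : ℕ} {K : EuclideanSpace ℝ (Fin d) → ℝ} {s : ℝ}

lemma contDiff_rescale (hK : ContDiff ℝ ∞ K) (s : ℝ) : ContDiff ℝ ∞ (rescale s K) :=
  contDiff_const.mul (hK.comp (contDiff_const_smul s⁻¹))

lemma hasCompactSupport_rescale (hK : HasCompactSupport K) (hs : 0 < s) :
    HasCompactSupport (rescale s K) :=
  (hK.comp_smul (inv_ne_zero hs.ne')).mul_left

lemma rescale_neg (hKe : ∀ z, K (-z) = K z) (z : EuclideanSpace ℝ (Fin d)) :
    rescale s K (-z) = rescale s K z := by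
  rw [rescale, rescale, smul_neg, hKe]

lemma rescale_eq_zero {R : ℝ} (hK : ∀ z, R < ‖z‖ → K z = 0) (hs : 0 < s)
    {z : EuclideanSpace ℝ (Fin d)} (hz : R * s < ‖z‖) : rescale s K z = 0 := by
  rw [rescale, hK, mul_zero]
  rw [norm_smul, norm_inv, Real.norm_eq_abs, abs_of_pos hs, inv_mul_eq_div, lt_div_iff₀ hs]
  exact hz

lemma fderiv_rescale (z : EuclideanSpace ℝ (Fin d)) (s : ℝ) :
    fderiv ℝ (rescale s K) z = ((s ^ d)⁻¹ * s⁻¹) • fderiv ℝ K (s⁻¹ • z) := by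
  have h1 := fderiv_comp_smul (𝕜 := ℝ) (f := K) (c := s⁻¹) (x := z)
  have h2 : rescale s K = (s ^ d)⁻¹ • fun z => K (s⁻¹ • z) := rfl
  rw [h2, fderiv_const_smul_field, Pi.smul_apply, h1, smul_smul]

lemma fderiv_rescale_eq_zero {R : ℝ} (hK : ∀ z, R < ‖z‖ → K z = 0) (hs : 0 < s)
    {z : EuclideanSpace ℝ (Fin d)} (hz : R * s < ‖z‖) : fderiv ℝ (rescale s K) z = 0 := by
  have h : rescale s K =ᶠ[𝓝 z] fun _ => 0 := by
    filter_upwards [(isOpen_lt continuous_const continuous_norm).mem_nhds hz] with y hy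
    exact rescale_eq_zero hK hs hy
  rw [h.fderiv_eq]
  simp

lemma integral_rescale_comp {F : Type*} [NormedAddCommGroup F] [NormedSpace ℝ F]
    (g : EuclideanSpace ℝ (Fin d) → F) (hs : 0 < s) :
    ∫ z, (s ^ d)⁻¹ • g (s⁻¹ • z) = ∫ z, g z := by
  rw [integral_smul, Measure.integral_comp_inv_smul, finrank_euclideanSpace_fin,
    abs_of_pos (by positivity), smul_smul, inv_mul_cancel₀ (by positivity), one_smul]

lemma integral_rescale (hs : 0 < s) : ∫ z, rescale s K z = ∫ z, K z :=
  integral_rescale_comp K hs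

lemma lintegral_rescale (hK : Continuous K) (hKc : HasCompactSupport K) (hs : 0 < s) :
    ∫⁻ z, ‖rescale s K z‖ₑ = ENNReal.ofReal (∫ z, ‖K z‖) := by
  have h1 : Continuous (rescale s K) := continuous_const.mul (hK.comp (continuous_const_smul _))
  rw [← ofReal_integral_norm_eq_lintegral_enorm
    (h1.integrable_of_hasCompactSupport (hasCompactSupport_rescale hKc hs)),
    ← integral_rescale_comp (fun z => ‖K z‖) hs]
  simp [rescale, abs_of_pos hs]

lemma lintegral_fderiv_rescale (hK : ContDiff ℝ ∞ K) (hKc : HasCompactSupport K) (hs : 0 < s) :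
    ∫⁻ z, ‖fderiv ℝ (rescale s K) z‖ₑ = ENNReal.ofReal (s⁻¹ * ∫ z, ‖fderiv ℝ K z‖) := by
  have h1 : Continuous (fderiv ℝ (rescale s K)) :=
    (contDiff_rescale hK s).continuous_fderiv (by simp)
  rw [← ofReal_integral_norm_eq_lintegral_enorm
    (h1.integrable_of_hasCompactSupport ((hasCompactSupport_rescale hKc hs).fderiv ℝ)),
    ← integral_rescale_comp (fun z => ‖fderiv ℝ K z‖) hs, ← integral_const_mul]
  congr 2
  ext z
  rw [fderiv_rescale, norm_smul, Real.norm_of_nonneg (by positivity), smul_eq_mul]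
  ring

end Rescale

section DefectBounds

variable {d : ℕ} {Ω : FlowDomain} {f : EuclideanSpace ℝ (Fin d) → EuclideanSpace ℝ (Fin d)}
  {K : EuclideanSpace ℝ (Fin d) → ℝ} {s : ℝ}

lemma lintegral_increment_pow (m : ℕ) (c : ℝ≥0∞) (hc : c ≠ ⊤) (h : EuclideanSpace ℝ (Fin d)) :
    ∫⁻ y in Ω.cell d, c * ‖f (y + h) - f y‖ₑ ^ (m + 1) =
      c * eLpNorm (fun y => f (y + h) - f y) (m + 1 : ℕ) (volume.restrict (Ω.cell d)) ^ (m + 1) := by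
  rw [lintegral_const_mul' _ _ hc, lintegral_enorm_pow_eq]

/-- A bound without any regularity of `f`. For kernels of scale `L` it decays like `1 / L`. -/
lemma cubicDefect_le (hK : Continuous (fderiv ℝ K)) (hfp : IsFunctionOn Ω f)
    (hf : AEStronglyMeasurable f volume) :
    cubicDefect Ω K f ≤ (∫⁻ h, ‖fderiv ℝ K h‖ₑ) *
      (2 * eLpNorm f (2 + 1 : ℕ) (volume.restrict (Ω.cell d))) ^ 3 := by
  rw [cubicDefect]
  simp_rw [lintegral_increment_pow 2 _ enorm_ne_top]
  calc _ ≤ ∫⁻ h, ‖fderiv ℝ K h‖ₑ *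
        (2 * eLpNorm f (2 + 1 : ℕ) (volume.restrict (Ω.cell d))) ^ 3 := by
        refine lintegral_mono fun h => ?_
        gcongr
        refine (eLpNorm_sub_le (hf.comp_measurePreserving
          (measurePreserving_add_right volume h)).restrict hf.restrict (by norm_num)).trans ?_
        rw [two_mul, ← FlowDomain.eLpNorm_cell_add hfp (by simp) (by simp) h]
        rfl
    _ = _ := lintegral_mul_const'' _ hK.enorm.aemeasurable

lemma eLpNorm_increment_le_besovNorm {θ : ℝ} {q : ℝ≥0∞}
    (h : EuclideanSpace ℝ (Fin d)) :
    eLpNorm (fun y => f (y + h) - f y) q (volume.restrict (Ω.cell d)) ≤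
      besovNorm Ω θ q f * ENNReal.ofReal (‖h‖ ^ θ) := by
  by_cases h0 : h = 0
  · simp [h0]
  have h1 : 0 < ‖h‖ ^ θ := Real.rpow_pos_of_pos (norm_pos_iff.2 h0) _
  refine (ENNReal.div_le_iff (by simpa using h1) ENNReal.ofReal_ne_top).1 ?_
  refine le_trans ?_ (le_add_left le_rfl)
  exact le_iSup₂ (f := fun (h : EuclideanSpace ℝ (Fin d)) (_ : h ≠ 0) =>
    eLpNorm (fun x => f (x + h) - f x) q (volume.restrict (Ω.cell d)) /
      ENNReal.ofReal (‖h‖ ^ θ)) h h0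

lemma eLpNorm_increment_le_of_norm_le {θ : ℝ} (hθ : 0 < θ) {q : ℝ≥0∞} {r : ℝ}
    {h : EuclideanSpace ℝ (Fin d)} (hr : ‖h‖ ≤ r) :
    eLpNorm (fun y => f (y + h) - f y) q (volume.restrict (Ω.cell d)) ≤
      besovNorm Ω θ q f * ENNReal.ofReal (r ^ θ) :=
  (eLpNorm_increment_le_besovNorm h).trans (by gcongr)

/-- At scale `s` only increments of length at most `R s` matter, and the derivative of the kernel
costs one factor `1 / s`. -/
lemma cubicDefect_rescale_le {θ : ℝ} (hθ : 0 < θ) (hK : ContDiff ℝ ∞ K)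
    (hKc : HasCompactSupport K) {R : ℝ} (hKR : ∀ z, R < ‖z‖ → K z = 0) (hs : 0 < s) :
    cubicDefect Ω (rescale s K) f ≤ ENNReal.ofReal (s⁻¹ * ∫ z, ‖fderiv ℝ K z‖) *
      (besovNorm Ω θ 3 f * ENNReal.ofReal ((R * s) ^ θ)) ^ 3 := by
  rw [cubicDefect, ← lintegral_fderiv_rescale hK hKc hs]
  simp_rw [lintegral_increment_pow 2 _ enorm_ne_top]
  rw [← lintegral_mul_const'' _
    ((contDiff_rescale hK s).continuous_fderiv (by simp)).enorm.aemeasurable]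
  refine lintegral_mono fun h => ?_
  rcases lt_or_ge (R * s) ‖h‖ with hh | hh
  · have h0 : ‖fderiv ℝ (rescale s K) h‖ₑ = 0 := by
      rw [← ofReal_norm, fderiv_rescale_eq_zero hKR hs hh, norm_zero, ENNReal.ofReal_zero]
    rw [h0, zero_mul, zero_mul]
  · gcongr
    exact_mod_cast eLpNorm_increment_le_of_norm_le hθ hh

lemma quadraticDefect_rescale_le {β : ℝ} (hβ : 0 < β) (hK : Continuous K)
    (hKc : HasCompactSupport K) {R : ℝ} (hKR : ∀ z, R < ‖z‖ → K z = 0) (hs : 0 < s) :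
    quadraticDefect Ω (rescale s K) f ≤ ENNReal.ofReal (∫ z, ‖K z‖) *
      (besovNorm Ω β 2 f * ENNReal.ofReal ((R * s) ^ β)) ^ 2 := by
  rw [quadraticDefect, ← lintegral_rescale hK hKc hs]
  simp_rw [lintegral_increment_pow 1 _ enorm_ne_top]
  rw [← lintegral_mul_const'' _
    (show Continuous (rescale s K) from
      continuous_const.mul (hK.comp (continuous_const_smul _))).enorm.aemeasurable]
  refine lintegral_mono fun h => ?_
  rcases lt_or_ge (R * s) ‖h‖ with hh | hh
  · simp [rescale_eq_zero hKR hs hh]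
  · gcongr
    exact_mod_cast eLpNorm_increment_le_of_norm_le hβ hh

end DefectBounds

/-! ### Correlations over large scales -/

section LargeScale

variable {d : ℕ} {f g : EuclideanSpace ℝ (Fin d) → EuclideanSpace ℝ (Fin d)}
  {K : EuclideanSpace ℝ (Fin d) → ℝ}

/-- The correlation of an integrable field is controlled by the maximum of the kernel, which is of
order `L^{-d}` at scale `L`. -/
lemma enorm_cellPairing_correlation_le_sup (hg : Continuous g) {M : ℝ} (hM : ∀ z, ‖K z‖ ≤ M) :
    ‖cellPairing .wholeSpace (correlationKernel K) g g‖ₑ ≤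
      ENNReal.ofReal M * (∫⁻ y, ‖g y‖ₑ) ^ 2 := by
  refine (enorm_integral_le_lintegral_enorm _).trans
    ((lintegral_mono fun _ => enorm_integral_le_lintegral_enorm _).trans ?_)
  simp only [FlowDomain.cell, Measure.restrict_univ]
  calc ∫⁻ h, ∫⁻ y, ‖correlationKernel K h (g (y + h)) (g y)‖ₑ
      ≤ ∫⁻ h, ∫⁻ y, ENNReal.ofReal M * (‖g (y + h)‖ₑ * ‖g y‖ₑ) := by
        refine lintegral_mono fun h => lintegral_mono fun y => ?_
        simp only [correlationKernel, smul_apply, innerSL_apply_apply, smul_eq_mul, enorm_mul]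
        gcongr
        · rw [← ofReal_norm]
          exact ENNReal.ofReal_le_ofReal (hM h)
        · rw [← ofReal_norm, ← ofReal_norm, ← ofReal_norm, ← ENNReal.ofReal_mul (norm_nonneg _)]
          exact ENNReal.ofReal_le_ofReal (norm_inner_le_norm _ _)
    _ = ∫⁻ y, ∫⁻ h, ENNReal.ofReal M * (‖g (y + h)‖ₑ * ‖g y‖ₑ) := by
        refine lintegral_lintegral_swap (AEMeasurable.const_mul ?_ _)
        exact ((hg.comp (continuous_snd.add continuous_fst)).enorm.measurable.mul
          (hg.comp continuous_snd).enorm.measurable).aemeasurable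
    _ = ENNReal.ofReal M * (∫⁻ y, ‖g y‖ₑ) ^ 2 := by
        simp_rw [lintegral_const_mul' _ _ ENNReal.ofReal_ne_top,
          lintegral_mul_const' _ _ enorm_ne_top]
        simp_rw [lintegral_add_left_eq_self (fun x => ‖g x‖ₑ)]
        rw [lintegral_const_mul _ hg.enorm.measurable, pow_two]

/-- On the whole space the correlations over large scales vanish in the limit: up to a small error
in `L²` the field is compactly supported, hence integrable. -/
lemma tendsto_cellPairing_rescale_wholeSpace (hd : d ≠ 0) (hf : MemLp f 2 volume)
    (hK : Continuous K) (hKc : HasCompactSupport K) (hKe : ∀ z, K (-z) = K z) :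
    Tendsto (fun L => cellPairing .wholeSpace (correlationKernel (rescale L K)) f f) atTop (𝓝 0) := by
  refine tendsto_zero_iff_enorm_tendsto_zero.2 (ENNReal.tendsto_nhds_zero.2 fun ε hε => ?_)
  obtain ⟨M, hM⟩ := hKc.exists_bound_of_continuous hK
  set c : ℝ≥0∞ := ENNReal.ofReal (∫ z, ‖K z‖) with hc
  set N : ℝ≥0∞ := eLpNorm f 2 volume with hN
  have hNt : N ≠ ⊤ := hf.2.ne
  obtain ⟨η, hη0, hη⟩ := ENNReal.exists_nnreal_pos_mul_lt (a := c * (N + (N + 1))) (b := ε / 2)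
    (ENNReal.mul_ne_top ENNReal.ofReal_ne_top (by simp [hNt])) (ENNReal.half_pos hε.ne').ne'
  have hη' : min (η : ℝ≥0∞) 1 ≠ 0 := by
    rw [← ENNReal.bot_eq_zero, ← bot_lt_iff_ne_bot, lt_min_iff]
    simp [hη0]
  obtain ⟨g, hgc, hfg, hg, hgL⟩ := hf.exists_hasCompactSupport_eLpNorm_sub_le (by simp) hη'
  have hfgη := hfg.trans (min_le_left _ _)
  have hgN : eLpNorm g 2 volume ≤ N + 1 := by
    have h1 : g = f - (f - g) := by simp
    calc eLpNorm g 2 volume = eLpNorm (f - (f - g)) 2 volume := by rw [← h1]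
      _ ≤ eLpNorm f 2 volume + eLpNorm (f - g) 2 volume :=
        eLpNorm_sub_le hf.1 (hf.1.sub hgL.1) (by norm_num)
      _ ≤ N + 1 := by gcongr; exact hfg.trans (min_le_right _ _)
  have hper : ∀ w : EuclideanSpace ℝ (Fin d) → EuclideanSpace ℝ (Fin d),
      IsFunctionOn .wholeSpace w := fun w k hk x => by
    rw [FlowDomain.periods, mem_singleton_iff] at hk
    rw [hk, add_zero]
  have hcell : (volume : Measure (EuclideanSpace ℝ (Fin d))).restrict
      (FlowDomain.wholeSpace.cell d) = volume := by simp [FlowDomain.cell]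
  have hgi : ∫⁻ y, ‖g y‖ₑ < ⊤ := (hg.integrable_of_hasCompactSupport hgc).2
  have hlim : Tendsto (fun L : ℝ => ENNReal.ofReal ((L ^ d)⁻¹ * M) * (∫⁻ y, ‖g y‖ₑ) ^ 2) atTop
      (𝓝 0) := by
    have h1 : Tendsto (fun L : ℝ => (L ^ d)⁻¹ * M) atTop (𝓝 (0 * M)) :=
      ((tendsto_pow_atTop hd).inv_tendsto_atTop).mul_const M
    have h2 := ENNReal.tendsto_ofReal h1
    rw [zero_mul, ENNReal.ofReal_zero] at h2
    simpa using ENNReal.Tendsto.mul_const h2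
      (Or.inr (ENNReal.pow_lt_top hgi (n := 2)).ne)
  filter_upwards [ENNReal.tendsto_nhds_zero.1 hlim (ε / 2) (ENNReal.half_pos hε.ne'),
    eventually_gt_atTop 0] with L hL hL0
  have hKL : Continuous (rescale L K) := continuous_const.mul (hK.comp (continuous_const_smul _))
  have hΨ := isPairingKernel_correlation hKL (hasCompactSupport_rescale hKc hL0)
  have hf2 : MemLp f (1 + 1 : ℕ) (volume.restrict (FlowDomain.wholeSpace.cell d)) := by
    rw [hcell]; exact_mod_cast hf
  have hg2 : MemLp g (1 + 1 : ℕ) (volume.restrict (FlowDomain.wholeSpace.cell d)) := by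
    rw [hcell]; exact_mod_cast hgL
  have e1 := hΨ.cellPairing_sub (hper f) hf.1 hf2 hf2 hg2
  have e2 := hΨ.cellPairing_sub (hper g) hgL.1 hg2 hf2 hg2
  have e3 := cellPairing_correlation_symm (K := rescale L K) (hper f) (hper g) (rescale_neg hKe)
  have hbound : ∀ w, MemLp w 2 volume →
      ‖cellPairing .wholeSpace (correlationKernel (rescale L K)) w (f - g)‖ₑ ≤
        c * (eLpNorm w 2 volume * η) := fun w hw => by
    refine (hΨ.enorm_cellPairing_le (hper w) hw.1 (hf.1.sub hgL.1).restrict).trans ?_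
    rw [hcell, pow_one]
    simp only [enorm_norm]
    rw [lintegral_rescale hK hKc hL0]
    have e : ((1 + 1 : ℕ) : ℝ≥0∞) = 2 := by norm_num
    rw [e]
    gcongr
  have b1 := hbound f hf
  have b2 := hbound g hgL
  have b3 := enorm_cellPairing_correlation_le_sup (K := rescale L K) hg (M := (L ^ d)⁻¹ * M)
    fun z => by
      rw [rescale, norm_mul, Real.norm_of_nonneg (by positivity)]
      gcongr
      exact hM _
  have e4 : cellPairing .wholeSpace (correlationKernel (rescale L K)) f f =
      cellPairing .wholeSpace (correlationKernel (rescale L K)) f (f - g) +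
      cellPairing .wholeSpace (correlationKernel (rescale L K)) g (f - g) +
      cellPairing .wholeSpace (correlationKernel (rescale L K)) g g := by linarith
  rw [e4]
  calc _ ≤ c * (N * η) + c * ((N + 1) * η) + ε / 2 :=
        (enorm_add_le _ _).trans (add_le_add ((enorm_add_le _ _).trans (add_le_add b1
          (b2.trans (by gcongr)))) (b3.trans hL))
    _ = η * (c * (N + (N + 1))) + ε / 2 := by ring
    _ ≤ ε / 2 + ε / 2 := by gcongr
    _ = ε := ENNReal.add_halves ε

end LargeScale

section Torus

variable {d : ℕ} {f : EuclideanSpace ℝ (Fin d) → EuclideanSpace ℝ (Fin d)}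
  {K : EuclideanSpace ℝ (Fin d) → ℝ}

lemma volume_torus_cell : volume (FlowDomain.torus.cell d) = 1 := by
  have h : FlowDomain.torus.cell d =
      (MeasurableEquiv.toLp 2 (Fin d → ℝ)).symm ⁻¹' (Set.univ.pi fun _ => Ico (0 : ℝ) 1) := by
    ext x
    simp [FlowDomain.cell]
  rw [h, (EuclideanSpace.volume_preserving_symm_measurableEquiv_toLp (Fin d)).measure_preimage
    (MeasurableSet.univ_pi fun _ => measurableSet_Ico).nullMeasurableSet, Real.volume_pi_Ico]
  simp

/-- Averages of a compactly supported kernel over translates by points of a unit cell reproduce the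
mean of a periodic function. -/
lemma integral_average_smul (hfp : IsFunctionOn .torus f) (hf : AEStronglyMeasurable f volume)
    (hf' : MemLp f 2 (volume.restrict (FlowDomain.torus.cell d)))
    (hK : Continuous K) (hKc : HasCompactSupport K) :
    Integrable (fun x => (∫ z in FlowDomain.torus.cell d, K (x - z)) • f x) ∧
    ∫ x, (∫ z in FlowDomain.torus.cell d, K (x - z)) • f x =
      (∫ h, K h) • ∫ y in FlowDomain.torus.cell d, f y := by
  have hfin : IsFiniteMeasure (volume.restrict (FlowDomain.torus.cell d)) :=
    ⟨by simp [volume_torus_cell]⟩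
  have i1 : Integrable (fun p : EuclideanSpace ℝ (Fin d) × EuclideanSpace ℝ (Fin d) =>
      K p.1 • f (p.2 + p.1)) (volume.prod (volume.restrict (FlowDomain.torus.cell d))) :=
    integrable_twoPoint (P := fun h a _ => K h • a)
      ((hK.comp continuous_fst).smul (continuous_fst.comp continuous_snd))
      (hK.integrable_of_hasCompactSupport hKc).norm 0 (fun h a b => by
        rw [norm_smul, zero_add, pow_one, pow_one]
        gcongr
        exact le_add_of_nonneg_right (norm_nonneg b)) hfp hf
      (by simpa using hf'.mono_exponent (p := 1) (by norm_num))
  have hmp := measurePreserving_add_prod (volume : Measure (EuclideanSpace ℝ (Fin d)))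
    (volume.restrict (FlowDomain.torus.cell d))
  have hemb : MeasurableEmbedding
      fun z : EuclideanSpace ℝ (Fin d) × EuclideanSpace ℝ (Fin d) => (z.1 + z.2, z.2) :=
    Measurable.measurableEmbedding (by fun_prop) fun a b hab => by
      simp only [Prod.mk.injEq] at hab
      refine Prod.ext ?_ hab.2
      simpa [hab.2] using hab.1
  have i2 : Integrable (fun p : EuclideanSpace ℝ (Fin d) × EuclideanSpace ℝ (Fin d) =>
      K (p.1 - p.2) • f p.1) (volume.prod (volume.restrict (FlowDomain.torus.cell d))) := by
    rw [← hmp.integrable_comp_emb hemb]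
    simpa [Function.comp_def, add_comm] using i1
  have e2 := hmp.integral_comp hemb fun p => K (p.1 - p.2) • f p.1
  simp only [add_sub_cancel_right] at e2
  have hi := i2.integral_prod_left
  simp only [integral_smul_const] at hi
  refine ⟨hi, ?_⟩
  have e3 := integral_prod _ i2
  have e4 := integral_prod _ i1
  simp only [integral_smul_const, integral_smul] at e3 e4
  simp_rw [FlowDomain.setIntegral_cell_add hfp] at e4
  rw [integral_smul_const] at e4
  rw [← e3, ← e2, ← e4]
  simp_rw [add_comm]

/-- Averaging a kernel of scale `L` over a unit cell changes it by an amount of order `1 / L`. -/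
lemma exists_abs_rescale_sub_average_le (hK : ContDiff ℝ ∞ K) (hKc : HasCompactSupport K)
    {ρ : ℝ} (hKρ : ∀ z, ρ < ‖z‖ → K z = 0) :
    ∃ B L₀ : ℝ, 0 < L₀ ∧ ∀ L, L₀ ≤ L → ∀ y ∈ FlowDomain.torus.cell d, ∀ h,
      |rescale L K h - ∫ z in FlowDomain.torus.cell d, rescale L K (y + h - z)| ≤
        (Metric.closedBall 0 ((ρ + 1) * L)).indicator (fun _ => (L ^ d)⁻¹ * L⁻¹ * B) h := by
  obtain ⟨R, hR⟩ := exists_torus_cell_subset_ball (d := d)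
  obtain ⟨M, hM⟩ := hK.lipschitzWith_of_hasCompactSupport hKc (by simp)
  have hprob : IsProbabilityMeasure (volume.restrict (FlowDomain.torus.cell d)) :=
    ⟨by simp [volume_torus_cell]⟩
  refine ⟨M * (2 * R), max 1 (2 * R), by positivity, fun L hL y hy h => ?_⟩
  have hL0 : 0 < L := lt_of_lt_of_le (by positivity) hL
  have hLR : 2 * R ≤ L := (le_max_right _ _).trans hL
  have hKL : Continuous (rescale L K) := (contDiff_rescale hK L).continuous
  have hKLc := hasCompactSupport_rescale hKc hL0
  have hyz : ∀ z ∈ FlowDomain.torus.cell d, ‖y - z‖ ≤ 2 * R := fun z hz => by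
    have h1 := mem_ball_zero_iff.1 (hR hy)
    have h2 := mem_ball_zero_iff.1 (hR hz)
    linarith [norm_sub_le y z]
  have hint : IntegrableOn (fun z => rescale L K (y + h - z)) (FlowDomain.torus.cell d) := by
    obtain ⟨C, hC⟩ := hKLc.exists_bound_of_continuous hKL
    exact Integrable.of_bound (hKL.comp (by fun_prop)).aestronglyMeasurable C
      (ae_of_all _ fun z => hC _)
  have e : rescale L K h - ∫ z in FlowDomain.torus.cell d, rescale L K (y + h - z) =
      ∫ z in FlowDomain.torus.cell d, (rescale L K h - rescale L K (y + h - z)) := by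
    rw [integral_sub (integrable_const _) hint, integral_const]
    simp
  rw [e, ← Real.norm_eq_abs]
  have hle : ∀ z ∈ FlowDomain.torus.cell d, ‖rescale L K h - rescale L K (y + h - z)‖ ≤
      (Metric.closedBall 0 ((ρ + 1) * L)).indicator
        (fun _ => (L ^ d)⁻¹ * L⁻¹ * (M * (2 * R))) h := fun z hz => by
    have hd1 : h - (y + h - z) = -(y - z) := by abel
    by_cases hh : h ∈ Metric.closedBall 0 ((ρ + 1) * L)
    · rw [indicator_of_mem hh, rescale, rescale, ← mul_sub, norm_mul,
        Real.norm_of_nonneg (by positivity), mul_assoc]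
      gcongr
      rw [← dist_eq_norm]
      refine (hM.dist_le_mul _ _).trans ?_
      rw [dist_eq_norm, ← smul_sub, norm_smul, hd1, norm_neg, norm_inv, Real.norm_of_nonneg hL0.le]
      calc M * (L⁻¹ * ‖y - z‖) ≤ M * (L⁻¹ * (2 * R)) := by gcongr; exact hyz z hz
        _ = _ := by ring
    · rw [indicator_of_notMem hh]
      rw [mem_closedBall_zero_iff, not_le] at hh
      have h1 : ρ * L < ‖h‖ := by nlinarith
      have h2 : ρ * L < ‖y + h - z‖ := by
        have h3 : ‖h‖ ≤ ‖y + h - z‖ + ‖y - z‖ := by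
          calc ‖h‖ = ‖(y + h - z) - (y - z)‖ := by congr 1; abel
            _ ≤ _ := norm_sub_le _ _
        have := hyz z hz
        nlinarith
      rw [rescale_eq_zero hKρ hL0 h1, rescale_eq_zero hKρ hL0 h2]
      simp
  have h2 := norm_setIntegral_le_of_norm_le_const
    (by simp [volume_torus_cell] : volume (FlowDomain.torus.cell d) < ⊤) hle
  rwa [Measure.real, volume_torus_cell, ENNReal.toReal_one, mul_one] at h2

/-- On the torus the correlations over large scales decouple: a kernel of large scale is nearly
constant on the cell, so that `f(y + h)` is replaced by its mean. -/
lemma tendsto_cellPairing_rescale_torus (hfp : IsFunctionOn .torus f)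
    (hf : AEStronglyMeasurable f volume)
    (hf' : MemLp f 2 (volume.restrict (FlowDomain.torus.cell d)))
    (hK : ContDiff ℝ ∞ K) (hKc : HasCompactSupport K) {ρ : ℝ} (hρ : 0 ≤ ρ)
    (hKρ : ∀ z, ρ < ‖z‖ → K z = 0) :
    Tendsto (fun L => cellPairing .torus (correlationKernel (rescale L K)) f f) atTop
      (𝓝 ((∫ z, K z) * ‖∫ y in FlowDomain.torus.cell d, f y‖ ^ 2)) := by
  have hprob : IsProbabilityMeasure (volume.restrict (FlowDomain.torus.cell d)) :=
    ⟨by simp [volume_torus_cell]⟩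
  obtain ⟨B, L₀, hL₀, hB⟩ := exists_abs_rescale_sub_average_le hK hKc hKρ
  have hfi : Integrable f (volume.restrict (FlowDomain.torus.cell d)) := hf'.integrable (by norm_num)
  have hf2 : MemLp f (1 + 1 : ℕ) (volume.restrict (FlowDomain.torus.cell d)) := by
    exact_mod_cast hf'
  set m := ∫ y in FlowDomain.torus.cell d, f y with hm
  set w : ℝ → EuclideanSpace ℝ (Fin d) → ℝ := fun L =>
    (Metric.closedBall 0 ((ρ + 1) * L)).indicator (fun _ => (L ^ d)⁻¹ * L⁻¹ * B) with hw
  set N := eLpNorm f (1 + 1 : ℕ) (volume.restrict (FlowDomain.torus.cell d)) with hN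
  have hwm : ∀ L, Measurable (w L) := fun L =>
    measurable_const.indicator Metric.isClosed_closedBall.measurableSet
  have hbound : ∀ L, L₀ ≤ L →
      ‖cellPairing .torus (correlationKernel (rescale L K)) f f - (∫ z, K z) * ‖m‖ ^ 2‖ₑ ≤
        (∫⁻ h, ‖w L h‖ₑ) * (N ^ 1 * N) := fun L hL => by
    have hL0 : 0 < L := hL₀.trans_le hL
    have hKL := contDiff_rescale hK L
    have hKLc := hasCompactSupport_rescale hKc hL0
    obtain ⟨hκi, hκ⟩ := integral_average_smul hfp hf hf' hKL.continuous hKLc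
    have i1 := (isPairingKernel_correlation hKL.continuous hKLc).integrable_prod hfp hf hf2 hf2
    have e1 : cellPairing .torus (correlationKernel (rescale L K)) f f =
        ∫ y in FlowDomain.torus.cell d, ∫ h, correlationKernel (rescale L K) h (f (y + h)) (f y) :=
      integral_integral_swap i1
    have hb : ∀ y, inner ℝ ((∫ z, K z) • m) (f y) = ∫ h,
        (∫ z in FlowDomain.torus.cell d, rescale L K (y + h - z)) * inner ℝ (f (y + h)) (f y) :=
      fun y => by
        rw [← integral_rescale hL0, ← hκ, real_inner_comm, ← integral_inner hκi,
          ← integral_add_left_eq_self _ y]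
        congr 1
        ext h
        rw [real_inner_smul_right, real_inner_comm]
    have hbi : ∀ y, Integrable fun h =>
        (∫ z in FlowDomain.torus.cell d, rescale L K (y + h - z)) * inner ℝ (f (y + h)) (f y) :=
      fun y => by
        have h1 := (hκi.const_inner (𝕜 := ℝ) (f y)).comp_add_left y
        refine h1.congr (ae_of_all _ fun h => ?_)
        simp only
        rw [real_inner_smul_right, real_inner_comm]
    have e2 : (∫ z, K z) * ‖m‖ ^ 2 =
        ∫ y in FlowDomain.torus.cell d, inner ℝ ((∫ z, K z) • m) (f y) := by
      rw [integral_inner hfi, ← hm, real_inner_smul_left, real_inner_self_eq_norm_sq]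
    rw [e1, e2, ← integral_sub i1.integral_prod_right (hfi.const_inner _)]
    have hmeas : AEMeasurable (fun p : EuclideanSpace ℝ (Fin d) × EuclideanSpace ℝ (Fin d) =>
        ‖w L p.1‖ₑ * (‖f (p.2 + p.1)‖ₑ ^ 1 * ‖f p.2‖ₑ))
        (volume.prod (volume.restrict (FlowDomain.torus.cell d))) :=
      ((hwm L).comp measurable_fst).enorm.aemeasurable.mul
        (((hf.comp_quasiMeasurePreserving (quasiMeasurePreserving_add_swap .torus)).enorm.pow_const
          1).mul hf.restrict.comp_snd.enorm)
    calc _ ≤ ∫⁻ y in FlowDomain.torus.cell d, ∫⁻ h,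
          ‖w L h‖ₑ * (‖f (y + h)‖ₑ ^ 1 * ‖f y‖ₑ) := by
          refine (enorm_integral_le_lintegral_enorm _).trans (lintegral_mono_ae ?_)
          filter_upwards [i1.prod_left_ae,
            ae_restrict_mem (FlowDomain.measurableSet_cell .torus)] with y hy hyc
          rw [hb, ← integral_sub hy (hbi y)]
          refine (enorm_integral_le_lintegral_enorm _).trans (lintegral_mono fun h => ?_)
          simp only [correlationKernel, smul_apply, innerSL_apply_apply, smul_eq_mul]
          rw [← sub_mul, enorm_mul, pow_one]
          gcongr
          · rw [← ofReal_norm, ← ofReal_norm]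
            refine ENNReal.ofReal_le_ofReal ?_
            rw [Real.norm_eq_abs]
            exact (hB L hL y hyc h).trans (le_abs_self _)
          · rw [← ofReal_norm, ← ofReal_norm, ← ofReal_norm, ← ENNReal.ofReal_mul (norm_nonneg _)]
            exact ENNReal.ofReal_le_ofReal (norm_inner_le_norm _ _)
      _ = ∫⁻ h, ∫⁻ y in FlowDomain.torus.cell d, ‖w L h‖ₑ * (‖f (y + h)‖ₑ ^ 1 * ‖f y‖ₑ) :=
          (lintegral_lintegral_swap hmeas).symm
      _ ≤ ∫⁻ h, ‖w L h‖ₑ * (N ^ 1 * N) := by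
          refine lintegral_mono fun h => ?_
          rw [lintegral_const_mul' _ _ enorm_ne_top]
          gcongr
          rw [hN]
          nth_rewrite 1 [← FlowDomain.eLpNorm_cell_add hfp (by simp) (by simp) h]
          exact lintegral_enorm_pow_mul_le 1
            (hf.comp_measurePreserving (measurePreserving_add_right volume h)).restrict hf.restrict
      _ = _ := lintegral_mul_const'' _ (hwm L).enorm.aemeasurable
  have hwi : ∀ L, L₀ ≤ L → ∫⁻ h, ‖w L h‖ₑ =
      ENNReal.ofReal (L⁻¹ * (|B| * (ρ + 1) ^ d)) *
        volume (Metric.ball (0 : EuclideanSpace ℝ (Fin d)) 1) := fun L hL => by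
    have hL0 : 0 < L := hL₀.trans_le hL
    simp_rw [hw, enorm_indicator_eq_indicator_enorm]
    rw [lintegral_indicator_const Metric.isClosed_closedBall.measurableSet,
      Measure.addHaar_closedBall _ _ (by positivity), finrank_euclideanSpace_fin, ← mul_assoc,
      ← ofReal_norm, ← ENNReal.ofReal_mul (norm_nonneg _), norm_mul, Real.norm_eq_abs B,
      Real.norm_of_nonneg (by positivity), mul_pow]
    congr 2
    field_simp
  refine tendsto_sub_nhds_zero_iff.1 (tendsto_zero_iff_enorm_tendsto_zero.2 ?_)
  have hlim : Tendsto (fun L : ℝ => ENNReal.ofReal (L⁻¹ * (|B| * (ρ + 1) ^ d)) *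
      volume (Metric.ball (0 : EuclideanSpace ℝ (Fin d)) 1) * (N ^ 1 * N)) atTop (𝓝 0) := by
    have h1 : Tendsto (fun L : ℝ => L⁻¹ * (|B| * (ρ + 1) ^ d)) atTop
        (𝓝 (0 * (|B| * (ρ + 1) ^ d))) := tendsto_inv_atTop_zero.mul_const _
    have h2 := ENNReal.tendsto_ofReal h1
    rw [zero_mul, ENNReal.ofReal_zero] at h2
    have h3 := ENNReal.Tendsto.mul_const h2 (b := volume (Metric.ball (0 : EuclideanSpace ℝ (Fin d)) 1))
      (Or.inr measure_ball_lt_top.ne)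
    have h4 := ENNReal.Tendsto.mul_const h3 (b := N ^ 1 * N)
      (Or.inr (ENNReal.mul_ne_top (by rw [pow_one]; exact hf2.2.ne) hf2.2.ne))
    simpa using h4
  refine tendsto_of_tendsto_of_tendsto_of_le_of_le' tendsto_const_nhds hlim
    (Eventually.of_forall fun _ => zero_le) ?_
  filter_upwards [eventually_ge_atTop L₀] with L hL
  rw [← hwi L hL]
  exact hbound L hL

end Torus

/-! ### Conservation of momentum on the torus -/

section ConstantDistribution

variable {F : Type*} [NormedAddCommGroup F] [NormedSpace ℝ F] [CompleteSpace F] {T : ℝ}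

/-- A smooth function of integral zero, compactly supported in an interval, has a compactly supported
primitive there. -/
lemma exists_compactly_supported_primitive {g : ℝ → ℝ} (hg : ContDiff ℝ ∞ g)
    (hgc : HasCompactSupport g) (hgT : tsupport g ⊆ Ioo 0 T) (hg0 : ∫ t, g t = 0) :
    ∃ G : ℝ → ℝ, ContDiff ℝ ∞ G ∧ HasCompactSupport G ∧ tsupport G ⊆ Ioo 0 T ∧ deriv G = g := by
  rcases (tsupport g).eq_empty_or_nonempty with h | hne
  · refine ⟨0, contDiff_const, HasCompactSupport.zero, by simp, ?_⟩
    rw [tsupport_eq_empty_iff.1 h]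
    exact deriv_zero
  obtain ⟨a, haS, ha⟩ := hgc.isCompact.exists_isLeast hne
  obtain ⟨b, hbS, hb⟩ := hgc.isCompact.exists_isGreatest hne
  have hsupp : Function.support g ⊆ Icc a b := fun x hx =>
    ⟨ha (subset_tsupport g hx), hb (subset_tsupport g hx)⟩
  have hder : ∀ x, HasDerivAt (fun x => ∫ t in (0 : ℝ)..x, g t) (g x) x := fun x =>
    (hg.continuous.integral_hasStrictDerivAt 0 x).hasDerivAt
  have hderiv : deriv (fun x => ∫ t in (0 : ℝ)..x, g t) = g := funext fun x => (hder x).deriv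
  have hzero : ∀ x ∉ Icc a b, ∫ t in (0 : ℝ)..x, g t = 0 := fun x hx => by
    rcases lt_or_ge x a with hxa | hxa
    · refine intervalIntegral.integral_zero_ae (ae_of_all _ fun t ht => ?_)
      by_contra hne
      have h1 : a ≤ t := (hsupp hne).1
      have h2 : t ≤ max 0 x := ht.2
      have h3 : 0 < a := (hgT haS).1
      rcases max_cases 0 x with h4 | h4 <;> linarith
    · have hxb : b < x := by
        by_contra hxb
        exact hx ⟨hxa, not_lt.1 hxb⟩
      rw [intervalIntegral.integral_eq_integral_of_support_subset, hg0]
      exact fun t ht => ⟨(hgT haS).1.trans_le (hsupp ht).1, ((hsupp ht).2.trans_lt hxb).le⟩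
  have hts : tsupport (fun x => ∫ t in (0 : ℝ)..x, g t) ⊆ Icc a b :=
    closure_minimal (fun x hx => by_contra fun h => hx (hzero x h)) isClosed_Icc
  refine ⟨fun x => ∫ t in (0 : ℝ)..x, g t, ?_, ?_, ?_, hderiv⟩
  · rw [contDiff_infty_iff_deriv, hderiv]
    exact ⟨fun x => (hder x).differentiableAt, hg⟩
  · exact HasCompactSupport.intro isCompact_Icc hzero
  · exact hts.trans (Icc_subset_Ioo (hgT haS).1 (hgT hbS).2)

/-- A function whose distributional derivative on an interval vanishes is constant there. -/
lemma exists_ae_eq_const_of_integral_deriv_smul {m : ℝ → F} (hm : Integrable m)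
    (h : ∀ θ : ℝ → ℝ, ContDiff ℝ ∞ θ → HasCompactSupport θ → tsupport θ ⊆ Ioo 0 T →
      ∫ t, deriv θ t • m t = 0) : ∃ c, ∀ᵐ t, t ∈ Ioo 0 T → m t = c := by
  rcases le_or_gt T 0 with hT | hT
  · exact ⟨0, ae_of_all _ fun t ht => absurd (ht.1.trans ht.2) (not_lt.2 hT)⟩
  let η : ContDiffBump (T / 2) := ⟨T / 8, T / 4, by positivity, by linarith⟩
  have hη : ContDiff ℝ ∞ (η.normed volume) := η.contDiff_normed
  have hηc : HasCompactSupport (η.normed volume) := η.hasCompactSupport_normed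
  have hηT : tsupport (η.normed volume) ⊆ Ioo 0 T := by
    rw [η.tsupport_normed_eq, Real.closedBall_eq_Icc]
    refine Icc_subset_Ioo ?_ ?_ <;> simp only [η] <;> linarith
  refine ⟨∫ t, η.normed volume t • m t, ?_⟩
  have hmul : ∀ θ : ℝ → ℝ, ContDiff ℝ ∞ θ → HasCompactSupport θ →
      Integrable fun t => θ t • m t := fun θ hθ hθc => by
    obtain ⟨C, hC⟩ := hθc.exists_bound_of_continuous hθ.continuous
    exact hm.bdd_smul C hθ.continuous.aestronglyMeasurable (ae_of_all _ hC)
  have := isOpen_Ioo.ae_eq_zero_of_integral_contDiff_smul_eq_zero (μ := (volume : Measure ℝ))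
    (U := Ioo 0 T) (f := fun t => m t - ∫ t, η.normed volume t • m t)
    ((hm.locallyIntegrable.sub (locallyIntegrable_const _)).locallyIntegrableOn _)
    fun θ hθ hθc hθT => by
      have hθi := hθ.continuous.integrable_of_hasCompactSupport hθc (μ := volume)
      have hηi := hη.continuous.integrable_of_hasCompactSupport hηc (μ := volume)
      have hgc : HasCompactSupport fun t => θ t - (∫ t, θ t) * η.normed volume t :=
        hθc.sub hηc.mul_left
      have hgT : tsupport (fun t => θ t - (∫ t, θ t) * η.normed volume t) ⊆ Ioo 0 T := by
        refine (closure_minimal (fun x hx => ?_) ((isClosed_tsupport θ).union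
          (isClosed_tsupport (η.normed volume)))).trans (union_subset hθT hηT)
        by_contra hne
        rw [mem_union, not_or] at hne
        exact hx (by simp [image_eq_zero_of_notMem_tsupport hne.1,
          image_eq_zero_of_notMem_tsupport hne.2])
      -- subtracting a multiple of a fixed bump makes the integral zero
      have hg0 : ∫ t, (θ t - (∫ t, θ t) * η.normed volume t) = 0 := by
        rw [integral_sub hθi (hηi.const_mul _), integral_const_mul, η.integral_normed]
        ring
      obtain ⟨G, hG, hGc, hGT, hGd⟩ := exists_compactly_supported_primitive
        (hθ.sub (contDiff_const.mul hη)) hgc hgT hg0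
      have h1 := h G hG hGc hGT
      simp_rw [hGd, sub_smul, mul_smul] at h1
      have h2 : Integrable fun t => (∫ t, θ t) • η.normed volume t • m t :=
        (hmul _ hη hηc).smul (∫ t, θ t)
      rw [integral_sub (hmul θ hθ hθc) h2, integral_smul] at h1
      simp_rw [smul_sub]
      rw [integral_sub (hmul θ hθ hθc) (hθi.smul_const _), integral_smul_const, h1]
  filter_upwards [this] with t ht htT
  exact sub_eq_zero.1 (ht htT)

end ConstantDistribution

section Momentum

variable {d : ℕ} {T : ℝ} {u v : ℝ → EuclideanSpace ℝ (Fin d) → EuclideanSpace ℝ (Fin d)}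

lemma isTestFunction_smul_const {θ : ℝ → ℝ} (hθ : ContDiff ℝ ∞ θ) (hθc : HasCompactSupport θ)
    (hθT : tsupport θ ⊆ Ioo 0 T) (e : EuclideanSpace ℝ (Fin d)) :
    IsTestFunction .torus T fun t (_ : EuclideanSpace ℝ (Fin d)) => θ t • e where
  smooth := (hθ.comp contDiff_fst).smul contDiff_const
  periodic := fun t k _ x => rfl
  compact_support := by
    obtain ⟨R, hR⟩ := exists_torus_cell_subset_ball (d := d)
    refine ⟨tsupport θ ×ˢ Metric.closedBall 0 R, hθc.isCompact.prod (isCompact_closedBall 0 R),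
      prod_mono hθT (subset_univ _), fun t x hne => ?_⟩
    refine ⟨WithLp.toLp 2 fun i => ((-⌊x i⌋ : ℤ) : ℝ), fun i => ⟨-⌊x i⌋, rfl⟩,
      subset_tsupport θ fun h => hne (by simp [h]), Metric.ball_subset_closedBall (hR fun i => ?_)⟩
    simp only [PiLp.add_apply, Int.cast_neg]
    exact ⟨by linarith [Int.floor_le (x i)], by linarith [Int.lt_floor_add_one (x i)]⟩

/-- The total momentum on the torus is constant in time. -/
lemma IsRegularField.exists_ae_integral_cell_eq (hu : IsRegularField .torus T u)
    (hv : IsWeakEulerSolution .torus T v) (huv : ∀ᵐ t, t ∈ Ioo 0 T → u t = v t) :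
    ∃ c, ∀ᵐ t, t ∈ Ioo 0 T → ∫ y in FlowDomain.torus.cell d, u t y = c := by
  have hfin : IsFiniteMeasure (volume.restrict (FlowDomain.torus.cell d)) :=
    ⟨by simp [volume_torus_cell]⟩
  have hui : Integrable (Function.uncurry u)
      ((volume : Measure ℝ).prod (volume.restrict (FlowDomain.torus.cell d))) := by
    refine ⟨hu.aestronglyMeasurable_cell, ?_⟩
    rw [HasFiniteIntegral, lintegral_prod _ hu.aestronglyMeasurable_cell.enorm]
    refine (lintegral_mono fun t => ?_).trans_lt
      (hu.lintegral_eLpNorm_slice_pow_lt_top (m := 1) (Or.inl rfl) one_ne_zero (by norm_num))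
    rw [pow_one]
    have h1 := eLpNorm_le_eLpNorm_mul_rpow_measure_univ (p := 1) (q := (1 + 1 : ℕ)) (by norm_num)
      (hu.memLp_slice 1 (Or.inl rfl) t).1
    simpa [eLpNorm_one_eq_lintegral_enorm, volume_torus_cell] using h1
  refine exists_ae_eq_const_of_integral_deriv_smul hui.integral_prod_left
    fun θ hθ hθc hθT => ext_inner_right ℝ fun e => ?_
  have hθ' : Continuous (deriv θ) := hθ.continuous_deriv (by simp)
  obtain ⟨C, hC⟩ := hθc.deriv.exists_bound_of_continuous hθ'
  have h := hv.momentum _ (isTestFunction_smul_const hθ hθc hθT e)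
    (fun t x => by simp [divergence])
  have hmi : Integrable fun t => deriv θ t • ∫ y in FlowDomain.torus.cell d, u t y :=
    hui.integral_prod_left.bdd_smul C hθ'.aestronglyMeasurable (ae_of_all _ hC)
  have hvi : Integrable (fun z : ℝ × EuclideanSpace ℝ (Fin d) =>
      deriv θ z.1 * inner ℝ e (Function.uncurry u z))
      ((volume : Measure ℝ).prod (volume.restrict (FlowDomain.torus.cell d))) :=
    (hui.const_inner e).bdd_mul (c := C) (hθ'.comp continuous_fst).aestronglyMeasurable
      (ae_of_all _ fun z => hC _)
  rw [inner_zero_left, real_inner_comm, ← integral_inner hmi]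
  have e1 : ∀ t, inner ℝ e (deriv θ t • ∫ y in FlowDomain.torus.cell d, u t y) =
      ∫ y in FlowDomain.torus.cell d, deriv θ t * inner ℝ e (u t y) := fun t => by
    rw [real_inner_smul_right, integral_const_mul,
      integral_inner ((hu.memLp_slice 1 (Or.inl rfl) t).integrable (by norm_num))]
  simp_rw [e1]
  refine (integral_prod _ hvi).symm.trans (Eq.trans ?_ h)
  rw [← setIntegral_eq_integral_of_forall_compl_eq_zero (s := Ioo 0 T ×ˢ univ),
    ← Measure.prod_restrict, Measure.restrict_univ, Measure.prod_restrict,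
    ← Measure.volume_eq_prod]
  · refine integral_congr_ae ?_
    have hae : ∀ᵐ z : ℝ × EuclideanSpace ℝ (Fin d), z.1 ∈ Ioo 0 T → u z.1 = v z.1 :=
      Measure.quasiMeasurePreserving_fst.ae huv
    filter_upwards [ae_restrict_of_ae hae, ae_restrict_mem
      (measurableSet_Ioo.prod (FlowDomain.measurableSet_cell .torus))] with z hz hzm
    have hd : deriv (fun s => θ s • e) z.1 = deriv θ z.1 • e :=
      ((hθ.differentiable (by simp) z.1).hasDerivAt.smul_const e).deriv
    simp [Function.uncurry, hz hzm.1, hd, real_inner_smul_right, real_inner_comm]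
  · intro z hz
    have hz1 : z.1 ∉ Ioo 0 T := fun h => hz ⟨h, mem_univ _⟩
    simp [Function.uncurry, hu.eq_zero _ hz1]

end Momentum

/-! ### The energy estimate at a single scale -/

section CorrelationLimit

variable {d : ℕ} {Ω : FlowDomain} {T : ℝ}
  {u v : ℝ → EuclideanSpace ℝ (Fin d) → EuclideanSpace ℝ (Fin d)}
  {K : EuclideanSpace ℝ (Fin d) → ℝ}

lemma integral_deriv_eq_zero {ψ : ℝ → ℝ} (hψ : ContDiff ℝ ∞ ψ) (hψc : HasCompactSupport ψ) :
    ∫ t, deriv ψ t = 0 :=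
  integral_eq_zero_of_hasDerivAt_of_integrable
    (fun t => (hψ.differentiable (by simp) t).hasDerivAt)
    ((hψ.continuous_deriv (by simp)).integrable_of_hasCompactSupport hψc.deriv)
    (hψ.continuous.integrable_of_hasCompactSupport hψc)

/-- As the scale of the kernel tends to infinity, the correlations converge to a quantity that is
conserved: zero on the whole space, and the square of the total momentum on the torus. -/
lemma IsRegularField.exists_tendsto_correlation (hu : IsRegularField Ω T u) (hd : d ≠ 0)
    (hv : IsWeakEulerSolution Ω T v) (huv : ∀ᵐ t, t ∈ Ioo 0 T → u t = v t)
    (hK : ContDiff ℝ ∞ K) (hKc : HasCompactSupport K) (hKe : ∀ z, K (-z) = K z)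
    {ρ : ℝ} (hρ : 0 ≤ ρ) (hKρ : ∀ z, ρ < ‖z‖ → K z = 0) :
    ∃ q : ℝ → ℝ, (∀ t, Tendsto (fun L => cellPairing Ω (correlationKernel (rescale L K)) (u t) (u t))
      atTop (𝓝 (q t))) ∧ ∀ ψ : ℝ → ℝ, ContDiff ℝ ∞ ψ → HasCompactSupport ψ → tsupport ψ ⊆ Ioo 0 T →
      ∫ t, deriv ψ t * q t = 0 := by
  have hu2 : ∀ t, MemLp (u t) 2 (volume.restrict (Ω.cell d)) := fun t => by
    exact_mod_cast hu.memLp_slice 1 (Or.inl rfl) t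
  cases Ω with
  | wholeSpace =>
    refine ⟨0, fun t => tendsto_cellPairing_rescale_wholeSpace hd ?_ hK.continuous hKc hKe,
      fun ψ _ _ _ => by simp⟩
    simpa [FlowDomain.cell] using hu2 t
  | torus =>
    refine ⟨_, fun t => tendsto_cellPairing_rescale_torus (hu.periodic t)
      (hu.aestronglyMeasurable_slice t) (hu2 t) hK hKc hρ hKρ, fun ψ hψ hψc hψT => ?_⟩
    obtain ⟨c, hc⟩ := hu.exists_ae_integral_cell_eq hv huv
    have e : ∫ t, deriv ψ t * ((∫ z, K z) * ‖∫ y in FlowDomain.torus.cell d, u t y‖ ^ 2) =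
        ∫ t, deriv ψ t * ((∫ z, K z) * ‖c‖ ^ 2) := by
      refine integral_congr_ae ?_
      filter_upwards [hc] with t ht
      by_cases htT : t ∈ Ioo 0 T
      · rw [ht htT]
      · have h0 : deriv ψ t = 0 :=
          image_eq_zero_of_notMem_tsupport fun h => htT (hψT (tsupport_deriv_subset h))
        rw [h0, zero_mul, zero_mul]
    rw [e, integral_mul_const, integral_deriv_eq_zero hψ hψc, zero_mul]

/-- Correlations over large scales do not change in time. -/
lemma IsRegularField.tendsto_integral_deriv_correlation (hu : IsRegularField Ω T u) (hd : d ≠ 0)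
    (hv : IsWeakEulerSolution Ω T v) (huv : ∀ᵐ t, t ∈ Ioo 0 T → u t = v t)
    (hK : ContDiff ℝ ∞ K) (hKc : HasCompactSupport K) (hKe : ∀ z, K (-z) = K z)
    {ρ : ℝ} (hρ : 0 ≤ ρ) (hKρ : ∀ z, ρ < ‖z‖ → K z = 0)
    {ψ : ℝ → ℝ} (hψ : ContDiff ℝ ∞ ψ) (hψc : HasCompactSupport ψ) (hψT : tsupport ψ ⊆ Ioo 0 T) :
    Tendsto (fun L => ∫ t, deriv ψ t *
      cellPairing Ω (correlationKernel (rescale L K)) (u t) (u t)) atTop (𝓝 0) := by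
  obtain ⟨q, hq, hq0⟩ := hu.exists_tendsto_correlation hd hv huv hK hKc hKe hρ hKρ
  rw [← hq0 ψ hψ hψc hψT]
  have hψ' : Continuous (deriv ψ) := hψ.continuous_deriv (by simp)
  obtain ⟨C, hC⟩ := hψc.deriv.exists_bound_of_continuous hψ'
  set N : ℝ → ℝ≥0∞ := fun t => eLpNorm (u t) (1 + 1 : ℕ) (volume.restrict (Ω.cell d)) with hN
  have hNm : AEMeasurable N := hu.aemeasurable_eLpNorm_slice 1
  have hNi := hu.lintegral_eLpNorm_slice_pow_lt_top (m := 1) (Or.inl rfl) two_ne_zero le_rfl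
  have hbi : Integrable fun t => C * (ENNReal.ofReal (∫ z, ‖K z‖) * N t ^ 2).toReal := by
    refine Integrable.const_mul (integrable_toReal_of_lintegral_ne_top
      ((hNm.pow_const 2).const_mul _) ?_) C
    rw [lintegral_const_mul' _ _ ENNReal.ofReal_ne_top]
    exact ENNReal.mul_ne_top ENNReal.ofReal_ne_top hNi.ne
  refine tendsto_integral_filter_of_dominated_convergence _ ?_ ?_ hbi
    (ae_of_all _ fun t => (hq t).const_mul _)
  · filter_upwards [eventually_gt_atTop 0] with L hL
    exact hψ'.aestronglyMeasurable.mul (hu.integrable_cellPairing_diag (Or.inl rfl)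
      (isPairingKernel_correlation (contDiff_rescale hK L).continuous
        (hasCompactSupport_rescale hKc hL))).1
  · filter_upwards [eventually_gt_atTop 0] with L hL
    refine ae_of_all _ fun t => ?_
    rw [norm_mul]
    refine mul_le_mul (hC t) ?_ (norm_nonneg _) ((norm_nonneg _).trans (hC t))
    have h1 := hu.enorm_cellPairing_le (isPairingKernel_correlation
      (contDiff_rescale hK L).continuous (hasCompactSupport_rescale hKc hL)) t t
    simp only [enorm_norm] at h1
    rw [lintegral_rescale hK.continuous hKc hL, pow_one, ← pow_two] at h1
    have h2 := ENNReal.toReal_mono (ENNReal.mul_ne_top ENNReal.ofReal_ne_top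
      (ENNReal.pow_lt_top (hu.memLp_slice 1 (Or.inl rfl) t).2).ne) h1
    rwa [toReal_enorm] at h2

lemma cellPairing_correlation_sub {K₁ K₂ : EuclideanSpace ℝ (Fin d) → ℝ}
    {f : EuclideanSpace ℝ (Fin d) → EuclideanSpace ℝ (Fin d)} (hfp : IsFunctionOn Ω f)
    (hf : AEStronglyMeasurable f volume) (hf' : MemLp f (1 + 1 : ℕ) (volume.restrict (Ω.cell d)))
    (hK₁ : Continuous K₁) (hK₁c : HasCompactSupport K₁)
    (hK₂ : Continuous K₂) (hK₂c : HasCompactSupport K₂) :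
    cellPairing Ω (correlationKernel fun z => K₁ z - K₂ z) f f =
      cellPairing Ω (correlationKernel K₁) f f - cellPairing Ω (correlationKernel K₂) f f := by
  have h1 := isPairingKernel_correlation hK₁ hK₁c
  have h2 := isPairingKernel_correlation hK₂ hK₂c
  have h3 : IsPairingKernel 1 (correlationKernel fun z => K₁ z - K₂ z) fun z => ‖K₁ z - K₂ z‖ :=
    isPairingKernel_correlation (hK₁.sub hK₂) (hK₁c.sub hK₂c)
  rw [h1.cellPairing_eq_integral_prod hfp hf hf' hf', h2.cellPairing_eq_integral_prod hfp hf hf' hf',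
    h3.cellPairing_eq_integral_prod hfp hf hf' hf',
    ← integral_sub (h1.integrable_prod hfp hf hf' hf') (h2.integrable_prod hfp hf hf' hf')]
  congr 1
  ext p
  simp only [correlationKernel, smul_apply, smul_eq_mul, sub_mul]

end CorrelationLimit

namespace IsRegularField

variable {d : ℕ} {Ω : FlowDomain} {T : ℝ}
  {u v : ℝ → EuclideanSpace ℝ (Fin d) → EuclideanSpace ℝ (Fin d)}
  {K : EuclideanSpace ℝ (Fin d) → ℝ}

lemma aestronglyMeasurable_increment (hu : IsRegularField Ω T u) :
    AEStronglyMeasurable (fun p : ℝ × EuclideanSpace ℝ (Fin d) × EuclideanSpace ℝ (Fin d) =>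
      u p.1 (p.2.2 + p.2.1) - u p.1 p.2.2)
      ((volume : Measure ℝ).prod (volume.prod (volume.restrict (Ω.cell d)))) := by
  have h1 := hu.aestronglyMeasurable.comp_quasiMeasurePreserving
    (QuasiMeasurePreserving.prodMap (Measure.QuasiMeasurePreserving.id (volume : Measure ℝ))
      (quasiMeasurePreserving_add_swap (d := d) Ω))
  have h2 := hu.aestronglyMeasurable_cell.comp_quasiMeasurePreserving
    (QuasiMeasurePreserving.prodMap (Measure.QuasiMeasurePreserving.id (volume : Measure ℝ))
      (Measure.quasiMeasurePreserving_snd (μ := (volume : Measure (EuclideanSpace ℝ (Fin d))))))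
  exact h1.sub h2

lemma aemeasurable_lintegral_increment_pow (hu : IsRegularField Ω T u)
    {k : EuclideanSpace ℝ (Fin d) → ℝ≥0∞} (hk : Measurable k) (m : ℕ) :
    AEMeasurable fun t => ∫⁻ h, ∫⁻ y in Ω.cell d, k h * ‖u t (y + h) - u t y‖ₑ ^ m := by
  have h1 : AEMeasurable (fun p : ℝ × EuclideanSpace ℝ (Fin d) × EuclideanSpace ℝ (Fin d) =>
      k p.2.1 * ‖u p.1 (p.2.2 + p.2.1) - u p.1 p.2.2‖ₑ ^ m)
      ((volume : Measure ℝ).prod (volume.prod (volume.restrict (Ω.cell d)))) :=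
    (hk.comp (measurable_fst.comp measurable_snd)).aemeasurable.mul
      (hu.aestronglyMeasurable_increment.enorm.pow_const m)
  refine h1.lintegral_prod_right'.congr (ae_of_all _ fun t => ?_)
  refine lintegral_prod _ ?_
  exact hk.comp measurable_fst |>.aemeasurable.mul
    ((_root_.aestronglyMeasurable_increment (hu.aestronglyMeasurable_slice t)).enorm.pow_const m)

lemma aemeasurable_cubicDefect (hu : IsRegularField Ω T u) (hK : Continuous (fderiv ℝ K)) :
    AEMeasurable fun t => cubicDefect Ω K (u t) :=
  hu.aemeasurable_lintegral_increment_pow hK.enorm.measurable 3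

lemma aemeasurable_quadraticDefect (hu : IsRegularField Ω T u) (hK : Continuous K) :
    AEMeasurable fun t => quadraticDefect Ω K (u t) :=
  hu.aemeasurable_lintegral_increment_pow hK.enorm.measurable 2

/-- There is no energy flux at infinitely large scales. -/
lemma tendsto_lintegral_cubicDefect_rescale (hu : IsRegularField Ω T u)
    (hK : ContDiff ℝ ∞ K) (hKc : HasCompactSupport K)
    {ψ : ℝ → ℝ} (hψ : Continuous ψ) (hψc : HasCompactSupport ψ) :
    Tendsto (fun L => ∫⁻ t, ‖ψ t‖ₑ * cubicDefect Ω (rescale L K) (u t)) atTop (𝓝 0) := by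
  obtain ⟨C, hC⟩ := hψc.exists_bound_of_continuous hψ
  set N : ℝ → ℝ≥0∞ := fun t => eLpNorm (u t) (2 + 1 : ℕ) (volume.restrict (Ω.cell d)) with hN
  have hNi := hu.lintegral_eLpNorm_slice_pow_lt_top (m := 2) (Or.inr rfl) three_ne_zero le_rfl
  have hfin : ENNReal.ofReal C * (2 ^ 3 * ∫⁻ t, N t ^ 3) ≠ ⊤ :=
    ENNReal.mul_ne_top ENNReal.ofReal_ne_top (ENNReal.mul_ne_top (by simp) hNi.ne)
  have hlim : Tendsto (fun L : ℝ => ENNReal.ofReal (L⁻¹ * ∫ z, ‖fderiv ℝ K z‖) *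
      (ENNReal.ofReal C * (2 ^ 3 * ∫⁻ t, N t ^ 3))) atTop (𝓝 0) := by
    have h1 : Tendsto (fun L : ℝ => L⁻¹ * ∫ z, ‖fderiv ℝ K z‖) atTop
      (𝓝 (0 * ∫ z, ‖fderiv ℝ K z‖)) := tendsto_inv_atTop_zero.mul_const _
    have h2 := ENNReal.tendsto_ofReal h1
    rw [zero_mul, ENNReal.ofReal_zero] at h2
    simpa using ENNReal.Tendsto.mul_const h2 (Or.inr hfin)
  refine tendsto_of_tendsto_of_tendsto_of_le_of_le' tendsto_const_nhds hlim
    (Eventually.of_forall fun _ => zero_le) ?_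
  filter_upwards [eventually_gt_atTop 0] with L hL
  rw [← lintegral_const_mul' _ _ (by simp), ← lintegral_const_mul' _ _ ENNReal.ofReal_ne_top,
    ← lintegral_const_mul' _ _ ENNReal.ofReal_ne_top]
  refine lintegral_mono fun t => ?_
  have h1 := cubicDefect_le ((contDiff_rescale hK L).continuous_fderiv (by simp))
    (hu.periodic t) (hu.aestronglyMeasurable_slice t)
  rw [lintegral_fderiv_rescale hK hKc hL, mul_pow] at h1
  have h2 : ‖ψ t‖ₑ ≤ ENNReal.ofReal C := by
    rw [← ofReal_norm]
    exact ENNReal.ofReal_le_ofReal (hC t)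
  calc _ ≤ ENNReal.ofReal C * _ := mul_le_mul' h2 h1
    _ = _ := by ring

/-- The main estimate: the time derivative of the kinetic energy is controlled by the defects at a
single scale `l`, the cubic one tested with `ψ` and the quadratic one tested with `ψ'`. -/
lemma enorm_integral_deriv_energy_le (hu : IsRegularField Ω T u) (hd : d ≠ 0)
    (hv : IsWeakEulerSolution Ω T v) (huv : ∀ᵐ t, t ∈ Ioo 0 T → u t = v t)
    {l : ℝ} (hl : 0 < l)
    {ψ : ℝ → ℝ} (hψ : ContDiff ℝ ∞ ψ) (hψc : HasCompactSupport ψ) (hψT : tsupport ψ ⊆ Ioo 0 T) :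
    ‖(∫ z, shellKernel d z) * ∫ t, deriv ψ t * ∫ y in Ω.cell d, ‖u t y‖ ^ 2‖ₑ ≤
      (∫⁻ t, ‖deriv ψ t‖ₑ * quadraticDefect Ω (rescale l (shellKernel d)) (u t)) +
      ∫⁻ t, ‖ψ t‖ₑ * cubicDefect Ω (rescale l (shellKernel d)) (u t) := by
  have hvW : IsWeakEulerSolution .wholeSpace T v := by
    cases Ω with
    | wholeSpace => exact hv
    | torus => exact hv.wholeSpace_of_torus
  have hK := contDiff_shellKernel d
  have hKc := hasCompactSupport_shellKernel d
  have hKe := shellKernel_neg d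
  have hKρ : ∀ z : EuclideanSpace ℝ (Fin d), 2 < ‖z‖ → shellKernel d z = 0 :=
    fun z hz => shellKernel_eq_zero d hz
  have hψ' : Continuous (deriv ψ) := hψ.continuous_deriv (by simp)
  obtain ⟨C, hC⟩ := hψc.deriv.exists_bound_of_continuous hψ'
  set Kl := rescale l (shellKernel d) with hKl
  have hKls : ContDiff ℝ ∞ Kl := contDiff_rescale hK l
  have hKlc : HasCompactSupport Kl := hasCompactSupport_rescale hKc hl
  have hQ : ∀ L, 0 < L → Integrable fun t =>
      deriv ψ t * cellPairing Ω (correlationKernel (rescale L (shellKernel d))) (u t) (u t) :=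
    fun L hL => (hu.integrable_cellPairing_diag (Or.inl rfl) (isPairingKernel_correlation
      (contDiff_rescale hK L).continuous (hasCompactSupport_rescale hKc hL))).bdd_mul (c := C)
        hψ'.aestronglyMeasurable (ae_of_all _ hC)
  have hE : Integrable fun t => deriv ψ t * ∫ y in Ω.cell d, ‖u t y‖ ^ 2 := by
    have h1 : Integrable (fun z : ℝ × EuclideanSpace ℝ (Fin d) => ‖Function.uncurry u z‖ ^ 2)
        ((volume : Measure ℝ).prod (volume.restrict (Ω.cell d))) := by
      have h2 := hu.memLp 1 (Or.inl rfl)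
      exact (memLp_two_iff_integrable_sq_norm h2.1).1 (by exact_mod_cast h2)
    exact h1.integral_prod_left.bdd_mul (c := C) hψ'.aestronglyMeasurable (ae_of_all _ hC)
  -- up to the quadratic defect, the energy is the correlation at scale `l`
  have hlow : (∫ z, shellKernel d z) * ∫ t, deriv ψ t * ∫ y in Ω.cell d, ‖u t y‖ ^ 2 =
      (∫ t, deriv ψ t * ((1 / 2) * ∫ h, ∫ y in Ω.cell d, Kl h * ‖u t (y + h) - u t y‖ ^ 2)) +
      ∫ t, deriv ψ t * cellPairing Ω (correlationKernel Kl) (u t) (u t) := by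
    have e : ∀ t, deriv ψ t * ((1 / 2) * ∫ h, ∫ y in Ω.cell d,
        Kl h * ‖u t (y + h) - u t y‖ ^ 2) =
        (∫ z, shellKernel d z) * (deriv ψ t * ∫ y in Ω.cell d, ‖u t y‖ ^ 2) -
        deriv ψ t * cellPairing Ω (correlationKernel Kl) (u t) (u t) := fun t => by
      rw [← integral_sq_sub_cellPairing (hu.periodic t) (hu.aestronglyMeasurable_slice t)
        (hu.memLp_slice 1 (Or.inl rfl) t) hKls.continuous hKlc, hKl, integral_rescale hl]
      ring
    simp_rw [e]
    rw [integral_sub (hE.const_mul _) (hQ l hl), integral_const_mul]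
    ring
  have hquad : ‖∫ t, deriv ψ t * ((1 / 2) * ∫ h, ∫ y in Ω.cell d,
      Kl h * ‖u t (y + h) - u t y‖ ^ 2)‖ₑ ≤ ∫⁻ t, ‖deriv ψ t‖ₑ * quadraticDefect Ω Kl (u t) := by
    refine (enorm_integral_le_lintegral_enorm _).trans (lintegral_mono fun t => ?_)
    rw [enorm_mul, enorm_mul]
    gcongr
    refine le_trans (mul_le_of_le_one_left' ?_) enorm_integral_increments_le_quadraticDefect
    rw [← ofReal_norm]
    exact ENNReal.ofReal_le_one.2 (by norm_num)
  -- the correlations at the scales `l` and `L` are compared through their difference, whose kernel is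
  -- a Laplacian
  have hbal : ∀ L, l ≤ L → ‖∫ t, deriv ψ t * cellPairing Ω (correlationKernel Kl) (u t) (u t)‖ₑ ≤
      ‖∫ t, deriv ψ t *
        cellPairing Ω (correlationKernel (rescale L (shellKernel d))) (u t) (u t)‖ₑ +
      ((∫⁻ t, ‖ψ t‖ₑ * cubicDefect Ω Kl (u t)) +
      ∫⁻ t, ‖ψ t‖ₑ * cubicDefect Ω (rescale L (shellKernel d)) (u t)) := fun L hL => by
    have hL0 : 0 < L := hl.trans_le hL
    obtain ⟨G, hG, hGc, hGK⟩ := exists_laplacian_eq_rescale_sub (d := d) hl hL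
    have hKLs : ContDiff ℝ ∞ (rescale L (shellKernel d)) := contDiff_rescale hK L
    have hKLc := hasCompactSupport_rescale hKc hL0
    have hb := hu.integral_deriv_mul_cellPairing hvW huv hG (hKls.sub hKLs) hGc (hKlc.sub hKLc)
      (fun z => by simp only [hKl, rescale_neg hKe]) (fun z => by
        simp only [← hG.fderiv_infty.fderiv_clm_apply_const]
        rw [hGK, neg_sub]) hψ hψc hψT
    simp_rw [cellPairing_correlation_sub (hu.periodic _) (hu.aestronglyMeasurable_slice _)
      (hu.memLp_slice 1 (Or.inl rfl) _) hKls.continuous hKlc hKLs.continuous hKLc, mul_sub] at hb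
    rw [integral_sub (hQ l hl) (hQ L hL0), sub_eq_iff_eq_add'] at hb
    rw [hb]
    refine (enorm_add_le _ _).trans (add_le_add le_rfl ?_)
    rw [enorm_mul]
    refine (mul_le_of_le_one_left' ?_).trans ?_
    · rw [← ofReal_norm]
      exact ENNReal.ofReal_le_one.2 (by norm_num)
    have hm : AEMeasurable fun t => ‖ψ t‖ₑ * cubicDefect Ω Kl (u t) :=
      hψ.continuous.enorm.aemeasurable.mul
        (hu.aemeasurable_cubicDefect (hKls.continuous_fderiv (by simp)))
    rw [← lintegral_add_left' hm]
    refine (enorm_integral_le_lintegral_enorm _).trans (lintegral_mono fun t => ?_)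
    rw [enorm_mul, ← mul_add]
    gcongr
    exact enorm_integral_increments_sub_le (hu.aestronglyMeasurable_slice t) hKls hKLs
  -- the terms at scale `L` disappear as `L → ∞`
  have hflux : ‖∫ t, deriv ψ t * cellPairing Ω (correlationKernel Kl) (u t) (u t)‖ₑ ≤
      ∫⁻ t, ‖ψ t‖ₑ * cubicDefect Ω Kl (u t) := by
    have h1 := (hu.tendsto_integral_deriv_correlation hd hv huv hK hKc hKe zero_le_two hKρ
      hψ hψc hψT).enorm
    have h2 := hu.tendsto_lintegral_cubicDefect_rescale hK hKc hψ.continuous hψc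
    have h3 := h1.add (h2.const_add (∫⁻ t, ‖ψ t‖ₑ * cubicDefect Ω Kl (u t)))
    rw [enorm_zero, zero_add, add_zero] at h3
    exact ge_of_tendsto h3 ((eventually_ge_atTop l).mono hbal)
  rw [hlow]
  exact (enorm_add_le _ _).trans (add_le_add hquad hflux)

end IsRegularField

/-! ### Hölder's inequality in time and the regular representative -/

section TimeHolder

variable {α : Type*} [MeasurableSpace α] {ν : Measure α}

lemma eLpNorm_const_mul_le {c : ℝ≥0∞} (hc : c ≠ ⊤) (N : α → ℝ≥0∞) (r : ℝ≥0∞) :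
    eLpNorm (fun t => c * N t) r ν ≤ c * eLpNorm N r ν := by
  rcases eq_or_ne r 0 with rfl | hr0
  · simp
  rcases eq_or_ne r ⊤ with rfl | hr
  · simp only [eLpNorm_exponent_top, eLpNormEssSup, enorm_eq_self]
    exact ENNReal.essSup_const_mul.le
  · have hr' : 0 < r.toReal := ENNReal.toReal_pos hr0 hr
    rw [eLpNorm_eq_lintegral_rpow_enorm_toReal hr0 hr, eLpNorm_eq_lintegral_rpow_enorm_toReal hr0 hr]
    simp only [enorm_eq_self, ENNReal.mul_rpow_of_nonneg _ _ hr'.le]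
    rw [lintegral_const_mul' _ _ (ENNReal.rpow_ne_top_of_nonneg hr'.le hc),
      ENNReal.mul_rpow_of_nonneg _ _ (by positivity), ← ENNReal.rpow_mul,
      mul_one_div_cancel hr'.ne', ENNReal.rpow_one]

/-- Hölder's inequality on a set of finite measure for a function dominated by a power of a function
in `L^r`. The dominating function need not be measurable. -/
lemma lintegral_le_of_le_pow (m : ℕ) {a N : α → ℝ≥0∞} {c : ℝ≥0∞} (hc : c ≠ ⊤) {r : ℝ≥0∞}
    (hr : (m + 1 : ℕ) ≤ r) (ha : AEMeasurable a ν) (haN : ∀ᵐ t ∂ν, a t ≤ (c * N t) ^ (m + 1)) :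
    ∫⁻ t, a t ∂ν ≤ (c * eLpNorm N r ν) ^ (m + 1) * ν univ ^ (1 - (m + 1) / r.toReal) := by
  have hm : (0 : ℝ) < m + 1 := by positivity
  set b : α → ℝ≥0∞ := fun t => a t ^ (1 / ((m : ℝ) + 1)) with hb
  have hbpow : ∀ x : ℝ≥0∞, (x ^ (1 / ((m : ℝ) + 1))) ^ (m + 1) = x := fun x => by
    rw [← ENNReal.rpow_natCast, ← ENNReal.rpow_mul]
    push_cast
    rw [one_div_mul_cancel hm.ne', ENNReal.rpow_one]
  have h1 : ∫⁻ t, a t ∂ν = eLpNorm b (m + 1 : ℕ) ν ^ (m + 1) := by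
    rw [eLpNorm_eq_lintegral_rpow_enorm_toReal (by simp) (by simp)]
    simp only [enorm_eq_self, ENNReal.toReal_natCast]
    push_cast
    rw [hbpow]
    refine lintegral_congr fun t => ?_
    rw [hb, ← ENNReal.rpow_mul, one_div_mul_cancel hm.ne', ENNReal.rpow_one]
  have hbm : AEStronglyMeasurable b ν := (ha.pow_const _).aestronglyMeasurable
  have h2 := eLpNorm_le_eLpNorm_mul_rpow_measure_univ hr hbm
  have h3 : eLpNorm b r ν ≤ c * eLpNorm N r ν := by
    refine (eLpNorm_mono_enorm_ae ?_).trans (eLpNorm_const_mul_le hc N r)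
    filter_upwards [haN] with t ht
    simp only [enorm_eq_self, hb]
    calc a t ^ (1 / ((m : ℝ) + 1)) ≤ ((c * N t) ^ (m + 1)) ^ (1 / ((m : ℝ) + 1)) := by gcongr
      _ = c * N t := by
        rw [← ENNReal.rpow_natCast, ← ENNReal.rpow_mul]
        push_cast
        rw [mul_one_div_cancel hm.ne', ENNReal.rpow_one]
  rw [h1]
  calc eLpNorm b (m + 1 : ℕ) ν ^ (m + 1)
      ≤ (c * eLpNorm N r ν * ν univ ^ (1 / ((m + 1 : ℕ) : ℝ≥0∞).toReal - 1 / r.toReal)) ^ (m + 1) := by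
        gcongr
        exact h2.trans (by gcongr)
    _ = _ := by
        rw [mul_pow, ← ENNReal.rpow_natCast (ν univ ^ _), ← ENNReal.rpow_mul]
        congr 2
        rw [ENNReal.toReal_natCast]
        push_cast
        field_simp

end TimeHolder

section RegularRepresentative

variable {d : ℕ} {Ω : FlowDomain} {T : ℝ}
  {v : ℝ → EuclideanSpace ℝ (Fin d) → EuclideanSpace ℝ (Fin d)}

lemma MemTimeBesov.aestronglyMeasurable_prod {r q : ℝ≥0∞} {θ : ℝ} (hv : MemTimeBesov Ω T r θ q v) :
    AEStronglyMeasurable (Function.uncurry v)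
      (((volume : Measure ℝ).restrict (Ioo 0 T)).prod volume) := by
  have h := hv.1
  rwa [Measure.volume_eq_prod, ← Measure.prod_restrict, Measure.restrict_univ] at h

/-- Only the `L^q(Ω)` part of the Besov norm is used, and that `(0, T)` has finite measure. -/
lemma MemTimeBesov.lintegral_eLpNorm_pow_lt_top (m : ℕ) {r : ℝ≥0∞} {θ : ℝ}
    (hv : MemTimeBesov Ω T r θ (m + 1 : ℕ) v) (hr : (m + 1 : ℕ) ≤ r) :
    ∫⁻ t in Ioo 0 T, eLpNorm (v t) (m + 1 : ℕ) (volume.restrict (Ω.cell d)) ^ (m + 1) < ⊤ := by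
  have h1 : AEStronglyMeasurable (Function.uncurry v)
      (((volume : Measure ℝ).restrict (Ioo 0 T)).prod (volume.restrict (Ω.cell d))) :=
    hv.aestronglyMeasurable_prod.mono_ac (Measure.AbsolutelyContinuous.prod
      (Measure.AbsolutelyContinuous.refl _) Measure.restrict_le_self.absolutelyContinuous)
  have hm : AEMeasurable (fun t => eLpNorm (v t) (m + 1 : ℕ) (volume.restrict (Ω.cell d)) ^ (m + 1))
      ((volume : Measure ℝ).restrict (Ioo 0 T)) := by
    simp_rw [← lintegral_enorm_pow_eq]
    exact (h1.enorm.pow_const (m + 1)).lintegral_prod_right'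
  refine (lintegral_le_of_le_pow m (c := 1) ENNReal.one_ne_top hr hm (ae_of_all _ fun t => ?_)
    (N := fun t => besovNorm Ω θ (m + 1 : ℕ) (v t))).trans_lt ?_
  · rw [one_mul]
    gcongr
    exact le_add_right le_rfl
  · rw [one_mul]
    refine ENNReal.mul_lt_top (ENNReal.pow_lt_top hv.2) ?_
    refine ENNReal.rpow_lt_top_of_nonneg ?_ (by simp)
    rw [sub_nonneg]
    rcases eq_or_ne r ⊤ with rfl | hrt
    · simp
    · have h2 := ENNReal.toReal_mono hrt hr
      rw [ENNReal.toReal_natCast] at h2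
      push_cast at h2
      have h3 : (0 : ℝ) < m + 1 := by positivity
      exact (div_le_one (by linarith)).2 h2

open Classical in
/-- The velocity, with the exceptional times at which it is not in `L² ∩ L³(Ω)` removed. -/
noncomputable def regularRepresentative (Ω : FlowDomain) (T : ℝ)
    (v : ℝ → EuclideanSpace ℝ (Fin d) → EuclideanSpace ℝ (Fin d)) (t : ℝ) :
    EuclideanSpace ℝ (Fin d) → EuclideanSpace ℝ (Fin d) :=
  if t ∈ Ioo 0 T ∧ AEStronglyMeasurable (v t) volume ∧
    ∀ m : ℕ, m = 1 ∨ m = 2 → MemLp (v t) (m + 1 : ℕ) (volume.restrict (Ω.cell d)) then v t else 0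

lemma regularRepresentative_eq_or (Ω : FlowDomain) (T : ℝ)
    (v : ℝ → EuclideanSpace ℝ (Fin d) → EuclideanSpace ℝ (Fin d)) (t : ℝ) :
    regularRepresentative Ω T v t = v t ∨ regularRepresentative Ω T v t = 0 := by
  unfold regularRepresentative
  split_ifs <;> simp

lemma lintegral_eLpNorm_pow_lt_top_of_memTimeBesov {p : ℝ≥0∞} {θ β : ℝ} (hp : 3 ≤ p)
    (hv3 : MemTimeBesov Ω T p θ 3 v) (hv2 : MemTimeBesov Ω T (2 * p / 3) β 2 v) (m : ℕ)
    (hm : m = 1 ∨ m = 2) :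
    ∫⁻ t in Ioo 0 T, eLpNorm (v t) (m + 1 : ℕ) (volume.restrict (Ω.cell d)) ^ (m + 1) < ⊤ := by
  rcases hm with rfl | rfl
  · have h2 : ((1 + 1 : ℕ) : ℝ≥0∞) = 2 := by norm_num
    refine MemTimeBesov.lintegral_eLpNorm_pow_lt_top 1 (r := 2 * p / 3) (θ := β) ?_ ?_
    · rwa [h2]
    · rw [h2, ENNReal.le_div_iff_mul_le (by simp) (by simp)]
      gcongr
  · have h3 : ((2 + 1 : ℕ) : ℝ≥0∞) = 3 := by norm_num
    refine MemTimeBesov.lintegral_eLpNorm_pow_lt_top 2 (r := p) (θ := θ) ?_ ?_ <;> rwa [h3]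

lemma ae_regularRepresentative_eq {p : ℝ≥0∞} {θ β : ℝ} (hp : 3 ≤ p)
    (hv3 : MemTimeBesov Ω T p θ 3 v) (hv2 : MemTimeBesov Ω T (2 * p / 3) β 2 v) :
    ∀ᵐ t, t ∈ Ioo 0 T → regularRepresentative Ω T v t = v t := by
  have hfin := lintegral_eLpNorm_pow_lt_top_of_memTimeBesov hp hv3 hv2
  have hmeas := hv3.aestronglyMeasurable_prod
  have hmeas' : AEStronglyMeasurable (Function.uncurry v)
      (((volume : Measure ℝ).restrict (Ioo 0 T)).prod (volume.restrict (Ω.cell d))) :=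
    hmeas.mono_ac (Measure.AbsolutelyContinuous.prod
      (Measure.AbsolutelyContinuous.refl _) Measure.restrict_le_self.absolutelyContinuous)
  have hae : ∀ m : ℕ, m = 1 ∨ m = 2 → ∀ᵐ t ∂((volume : Measure ℝ).restrict (Ioo 0 T)),
      eLpNorm (v t) (m + 1 : ℕ) (volume.restrict (Ω.cell d)) < ⊤ := fun m hm => by
    have hmm : AEMeasurable (fun t => eLpNorm (v t) (m + 1 : ℕ) (volume.restrict (Ω.cell d)) ^ (m + 1))
        ((volume : Measure ℝ).restrict (Ioo 0 T)) := by
      simp_rw [← lintegral_enorm_pow_eq]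
      exact (hmeas'.enorm.pow_const (m + 1)).lintegral_prod_right'
    filter_upwards [ae_lt_top' hmm (hfin m hm).ne] with t ht
    exact (ENNReal.pow_lt_top_iff.1 ht).resolve_right (by simp)
  rw [← ae_restrict_iff' measurableSet_Ioo]
  filter_upwards [hmeas.prodMk_left, hae 1 (Or.inl rfl), hae 2 (Or.inr rfl),
    ae_restrict_mem measurableSet_Ioo] with t h0 h1 h2 h3
  rw [regularRepresentative, if_pos]
  refine ⟨h3, h0, ?_⟩
  rintro m (rfl | rfl)
  exacts [⟨h0.restrict, h1⟩, ⟨h0.restrict, h2⟩]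

lemma isRegularField_regularRepresentative {p : ℝ≥0∞} {θ β : ℝ} (hp : 3 ≤ p)
    (hvp : ∀ t, IsFunctionOn Ω (v t))
    (hv3 : MemTimeBesov Ω T p θ 3 v) (hv2 : MemTimeBesov Ω T (2 * p / 3) β 2 v) :
    IsRegularField Ω T (regularRepresentative Ω T v) := by
  have hfin := lintegral_eLpNorm_pow_lt_top_of_memTimeBesov hp hv3 hv2
  have hae := ae_regularRepresentative_eq hp hv3 hv2
  have hzero : ∀ t ∉ Ioo 0 T, regularRepresentative Ω T v t = 0 := fun t ht => by
    rw [regularRepresentative, if_neg fun h => ht h.1]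
  have hmeas : AEStronglyMeasurable (Function.uncurry (regularRepresentative Ω T v))
      ((volume : Measure ℝ).prod volume) := by
    have h1 : AEStronglyMeasurable ((Ioo 0 T ×ˢ univ).indicator (Function.uncurry v))
        ((volume : Measure ℝ).prod volume) := by
      rw [aestronglyMeasurable_indicator_iff (measurableSet_Ioo.prod MeasurableSet.univ),
        ← Measure.prod_restrict, Measure.restrict_univ]
      exact hv3.aestronglyMeasurable_prod
    refine h1.congr ?_
    have h2 : ∀ᵐ z : ℝ × EuclideanSpace ℝ (Fin d) ∂((volume : Measure ℝ).prod volume),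
        z.1 ∈ Ioo 0 T → regularRepresentative Ω T v z.1 = v z.1 :=
      Measure.quasiMeasurePreserving_fst.ae hae
    filter_upwards [h2] with z hz
    by_cases hz1 : z.1 ∈ Ioo 0 T
    · rw [indicator_of_mem (show z ∈ Ioo 0 T ×ˢ univ from ⟨hz1, mem_univ _⟩), Function.uncurry,
        Function.uncurry, hz hz1]
    · rw [indicator_of_notMem fun h => hz1 h.1, Function.uncurry, hzero _ hz1]
      rfl
  have hmeas' : AEStronglyMeasurable (Function.uncurry (regularRepresentative Ω T v))
      ((volume : Measure ℝ).prod (volume.restrict (Ω.cell d))) :=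
    hmeas.mono_ac (Measure.AbsolutelyContinuous.prod
      (Measure.AbsolutelyContinuous.refl _) Measure.restrict_le_self.absolutelyContinuous)
  refine ⟨fun t => ?_, fun t => ?_, fun m hm t => ?_, hmeas, fun m hm => ⟨hmeas', ?_⟩, hzero⟩
  · rcases regularRepresentative_eq_or Ω T v t with h | h <;> rw [h]
    · exact hvp t
    · exact fun _ _ _ => rfl
  · unfold regularRepresentative
    split_ifs with h
    · exact h.2.1
    · exact aestronglyMeasurable_const
  · unfold regularRepresentative
    split_ifs with h
    · exact h.2.2 m hm
    · exact MemLp.zero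
  · refine ((ENNReal.pow_lt_top_iff (n := m + 1)).1 ?_).resolve_right (by simp)
    rw [← lintegral_enorm_pow_eq, lintegral_prod _ (hmeas'.enorm.pow_const _)]
    refine lt_of_le_of_lt ?_ (hfin m hm)
    rw [← lintegral_indicator measurableSet_Ioo]
    refine lintegral_mono fun t => ?_
    simp only [Function.uncurry]
    rw [lintegral_enorm_pow_eq]
    by_cases ht : t ∈ Ioo 0 T
    · rw [indicator_of_mem ht]
      rcases regularRepresentative_eq_or Ω T v t with h | h <;> rw [h]
      simp
    · rw [hzero t ht]
      simp

end RegularRepresentative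

/-! ### Cutoffs near a set of times and its Minkowski dimension -/

section Cutoff

open scoped Convolution in
/-- Smooth cutoffs to a unit neighbourhood of a set of times, with a universal bound on the
derivative. -/
lemma exists_unit_cutoff : ∃ C : ℝ, 0 ≤ C ∧ ∀ S : Set ℝ, ∃ χ : ℝ → ℝ, ContDiff ℝ ∞ χ ∧
    (∀ t, 0 ≤ χ t ∧ χ t ≤ 1) ∧ (∀ s ∈ S, ∀ t, |t - s| < 1 / 4 → χ t = 1) ∧
    (∀ t, χ t ≠ 0 → ∃ s ∈ S, |t - s| < 1) ∧ ∀ t, |deriv χ t| ≤ C := by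
  let b : ContDiffBump (0 : ℝ) := ⟨1 / 8, 1 / 4, by norm_num, by norm_num⟩
  set η : ℝ → ℝ := b.normed volume with hη
  have hηs : ContDiff ℝ ∞ η := b.contDiff_normed
  have hηc : HasCompactSupport η := b.hasCompactSupport_normed
  have hη0 : ∀ x, 0 ≤ η x := b.nonneg_normed
  have hη1 : ∫ x, η x = 1 := b.integral_normed
  have hηsupp : ∀ x, η x ≠ 0 → |x| < 1 / 4 := fun x hx => by
    have h1 : x ∈ Function.support (b.normed volume) := hx
    rw [b.support_normed_eq, mem_ball_zero_iff, Real.norm_eq_abs] at h1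
    exact h1
  have hηi : Integrable η := hηs.continuous.integrable_of_hasCompactSupport hηc
  have hη'c : Continuous (deriv η) := hηs.continuous_deriv (by simp)
  have hη'i : Integrable (deriv η) := hη'c.integrable_of_hasCompactSupport hηc.deriv
  refine ⟨∫ x, |deriv η x|, integral_nonneg fun x => abs_nonneg _, fun S => ?_⟩
  set U : Set ℝ := Metric.thickening (1 / 2) S with hU
  have hUm : MeasurableSet U := Metric.isOpen_thickening.measurableSet
  -- mollify the indicator function of the neighbourhood
  set f : ℝ → ℝ := U.indicator 1 with hf
  have hfm : Measurable f := measurable_one.indicator hUm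
  have hf01 : ∀ x, 0 ≤ f x ∧ f x ≤ 1 := fun x => by
    by_cases hx : x ∈ U
    · simp [hf, hx]
    · simp [hf, hx]
  have hfl : LocallyIntegrable f volume := by
    refine (locallyIntegrable_const (1 : ℝ)).mono hfm.aestronglyMeasurable (ae_of_all _ fun x => ?_)
    rw [Real.norm_of_nonneg (hf01 x).1, norm_one]
    exact (hf01 x).2
  have hshift : ∀ (g : ℝ → ℝ) t, ∫ x, g (t - x) = ∫ x, g x := fun g t =>
    integral_sub_left_eq_self g volume t
  have hmul : ∀ g : ℝ → ℝ, Integrable g → ∀ t, Integrable fun x => f x * g (t - x) :=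
    fun g hg t => (hg.comp_sub_left t).bdd_mul (c := 1) hfm.aestronglyMeasurable
      (ae_of_all _ fun x => by rw [Real.norm_of_nonneg (hf01 x).1]; exact (hf01 x).2)
  set χ : ℝ → ℝ := f ⋆[ContinuousLinearMap.lsmul ℝ ℝ, volume] η with hχ
  have hχe : ∀ t, χ t = ∫ x, f x * η (t - x) := fun t => rfl
  have hχ' : ∀ t, deriv χ t = ∫ x, f x * deriv η (t - x) := fun t =>
    (hηc.hasDerivAt_convolution_right (ContinuousLinearMap.lsmul ℝ ℝ) hfl
      (hηs.of_le (by simp)) t).deriv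
  refine ⟨χ, hηc.contDiff_convolution_right _ hfl hηs, fun t => ⟨?_, ?_⟩, fun s hs t hst => ?_,
    fun t ht => ?_, fun t => ?_⟩
  · rw [hχe]
    exact integral_nonneg fun x => mul_nonneg (hf01 x).1 (hη0 _)
  · rw [hχe, ← hη1, ← hshift η t]
    exact integral_mono (hmul η hηi t) (hηi.comp_sub_left t) fun x =>
      mul_le_of_le_one_left (hη0 _) (hf01 x).2
  · rw [hχe, ← hη1, ← hshift η t]
    congr 1
    ext x
    by_cases hx : η (t - x) = 0
    · rw [hx, mul_zero]
    · have h1 := hηsupp _ hx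
      have h2 : x ∈ U := by
        rw [hU, Metric.mem_thickening_iff]
        refine ⟨s, hs, ?_⟩
        rw [Real.dist_eq]
        rw [abs_lt] at h1 hst ⊢
        constructor <;> linarith [h1.1, h1.2, hst.1, hst.2]
      rw [hf, indicator_of_mem h2, Pi.one_apply, one_mul]
  · rw [hχe] at ht
    obtain ⟨x, hx⟩ : ∃ x, f x * η (t - x) ≠ 0 := by
      by_contra! h
      exact ht (by simp [h])
    have h1 := hηsupp _ (right_ne_zero_of_mul hx)
    have h2 : x ∈ U := by
      by_contra h
      exact left_ne_zero_of_mul hx (indicator_of_notMem h _)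
    rw [hU, Metric.mem_thickening_iff] at h2
    obtain ⟨s, hs, hxs⟩ := h2
    refine ⟨s, hs, ?_⟩
    rw [Real.dist_eq] at hxs
    rw [abs_lt] at h1 hxs ⊢
    constructor <;> linarith [h1.1, h1.2, hxs.1, hxs.2]
  · rw [hχ', ← hshift (fun x => |deriv η x|) t, ← Real.norm_eq_abs]
    refine norm_integral_le_of_norm_le (hη'i.norm.comp_sub_left t) (ae_of_all _ fun x => ?_)
    rw [norm_mul, Real.norm_of_nonneg (hf01 x).1]
    exact mul_le_of_le_one_left (norm_nonneg _) (hf01 x).2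

/-- Smooth cutoffs to the `δ`-neighbourhood of a set of times. -/
lemma exists_cutoff : ∃ C : ℝ, 0 ≤ C ∧ ∀ (S : Set ℝ) (δ : ℝ), 0 < δ → ∃ χ : ℝ → ℝ,
    ContDiff ℝ ∞ χ ∧ (∀ t, 0 ≤ χ t ∧ χ t ≤ 1) ∧ (∀ s ∈ S, χ =ᶠ[𝓝 s] 1) ∧
    (∀ t, χ t ≠ 0 → t ∈ Metric.cthickening δ S) ∧ ∀ t, |deriv χ t| ≤ C / δ := by
  obtain ⟨C, hC0, hC⟩ := exists_unit_cutoff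
  refine ⟨C, hC0, fun S δ hδ => ?_⟩
  obtain ⟨χ, hχ, h01, h1, hsupp, hd⟩ := hC ((fun s => δ⁻¹ * s) '' S)
  have habs : ∀ t s, |δ⁻¹ * t - δ⁻¹ * s| = δ⁻¹ * |t - s| := fun t s => by
    rw [← mul_sub, abs_mul, abs_of_pos (inv_pos.2 hδ)]
  refine ⟨fun t => χ (δ⁻¹ * t), hχ.comp (contDiff_const.mul contDiff_id), fun t => h01 _,
    fun s hs => ?_, fun t ht => ?_, fun t => ?_⟩
  · filter_upwards [Metric.ball_mem_nhds s (show 0 < δ / 4 by positivity)] with t ht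
    refine h1 _ (mem_image_of_mem _ hs) _ ?_
    rw [Metric.mem_ball, Real.dist_eq] at ht
    rw [habs, inv_mul_lt_iff₀ hδ]
    linarith
  · obtain ⟨_, ⟨s, hs, rfl⟩, hts⟩ := hsupp _ ht
    rw [habs, inv_mul_lt_iff₀ hδ, mul_one] at hts
    exact Metric.mem_cthickening_of_dist_le t s δ S hs (by rw [Real.dist_eq]; exact hts.le)
  · have h2 : deriv (fun t => χ (δ⁻¹ * t)) t = δ⁻¹ • deriv χ (δ⁻¹ * t) :=
      deriv_comp_mul_left δ⁻¹ χ t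
    rw [h2, smul_eq_mul, abs_mul, abs_of_pos (inv_pos.2 hδ), inv_mul_eq_div]
    gcongr
    exact hd _

end Cutoff

section Dimension

variable {S : Set ℝ} {T : ℝ}

/-- The dimension of a bounded set of times controls the measure of its neighbourhoods. -/
lemma exists_volume_cthickening_le (hS : S ⊆ Ioo 0 T) {x : ℝ} (hx : upperMinkowskiDim S < x) :
    ∃ s < x, ∀ᶠ δ in 𝓝[>] (0 : ℝ),
      volume (Metric.cthickening δ S) ≤ ENNReal.ofReal (δ ^ (1 - s)) := by
  have hne : {s : ℝ | 0 ≤ s ∧ upperMinkowskiContent s S = 0}.Nonempty := by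
    -- the content vanishes for `s = 2` since `S` is bounded, so the infimum is not a junk value
    refine ⟨2, zero_le_two, Tendsto.limsup_eq ?_⟩
    have hbd : ∀ᶠ δ in 𝓝[>] (0 : ℝ), volume (Metric.cthickening δ S) /
        ENNReal.ofReal (δ ^ (1 - 2 : ℝ)) ≤ ENNReal.ofReal (δ * (T + 2 * δ)) := by
      filter_upwards [self_mem_nhdsWithin] with δ hδ
      have hδ : 0 < δ := hδ
      have h1 : Metric.cthickening δ S ⊆ Icc (-δ) (T + δ) := by
        intro t ht
        have h2 : t ∈ Metric.cthickening δ (Icc 0 T) :=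
          Metric.cthickening_subset_of_subset δ (hS.trans Ioo_subset_Icc_self) ht
        rw [isCompact_Icc.cthickening_eq_biUnion_closedBall hδ.le] at h2
        simp only [mem_iUnion] at h2
        obtain ⟨s, hs, hts⟩ := h2
        rw [Real.closedBall_eq_Icc] at hts
        exact ⟨by linarith [hs.1, hts.1], by linarith [hs.2, hts.2]⟩
      have h3 : (δ : ℝ) ^ (1 - 2 : ℝ) = δ⁻¹ := by
        rw [show (1 - 2 : ℝ) = -1 by norm_num, Real.rpow_neg_one]
      rw [h3, ENNReal.ofReal_inv_of_pos hδ, div_eq_mul_inv, inv_inv, mul_comm,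
        ENNReal.ofReal_mul hδ.le]
      gcongr
      refine (measure_mono h1).trans ?_
      rw [Real.volume_Icc]
      exact ENNReal.ofReal_le_ofReal (by linarith)
    refine tendsto_of_tendsto_of_tendsto_of_le_of_le' tendsto_const_nhds ?_
      (Eventually.of_forall fun _ => zero_le) hbd
    have hcont : Continuous fun δ : ℝ => ENNReal.ofReal (δ * (T + 2 * δ)) :=
      ENNReal.continuous_ofReal.comp (by fun_prop)
    simpa using (hcont.tendsto 0).mono_left nhdsWithin_le_nhds
  obtain ⟨s, ⟨_, hs⟩, hsx⟩ := exists_lt_of_csInf_lt hne hx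
  refine ⟨s, hsx, ?_⟩
  have h1 : ∀ᶠ δ in 𝓝[>] (0 : ℝ), volume (Metric.cthickening δ S) /
      ENNReal.ofReal (δ ^ (1 - s)) < 1 :=
    eventually_lt_of_limsup_lt (by
      rw [← upperMinkowskiContent, hs]
      exact one_pos)
  filter_upwards [h1, self_mem_nhdsWithin] with δ h2 hδ
  have h3 : 0 < δ ^ (1 - s) := Real.rpow_pos_of_pos hδ _
  have h4 := (ENNReal.div_le_iff (by simpa using h3) ENNReal.ofReal_ne_top).1 h2.le
  rwa [one_mul] at h4

/-- The dimension condition in terms of the Hölder exponent `1 - 3/p`; for `p = ∞` the quotient is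
`3 / 0 = 0`, as it should be. -/
lemma dimension_condition {p : ℝ≥0∞} (hp : 3 ≤ p) {γ a : ℝ} (ha : 0 < a)
    (hdim : (γ : EReal) < 1 - (dualFactor p : EReal) * (a : EReal)) :
    0 < 1 - 3 / p.toReal ∧ a < (1 - 3 / p.toReal) * (1 - γ) := by
  rcases eq_or_ne p ⊤ with rfl | hpt
  · simp only [dualFactor, if_true, EReal.coe_ennreal_one, one_mul, ENNReal.toReal_top, div_zero,
      sub_zero] at hdim ⊢
    have h1 : γ < 1 - a := by exact_mod_cast hdim
    exact ⟨one_pos, by linarith⟩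
  rw [dualFactor, if_neg hpt] at hdim
  have h3 : (3 : ℝ) ≤ p.toReal := by simpa using ENNReal.toReal_mono hpt hp
  rcases h3.eq_or_lt with h3 | h3
  · have hp3 : p = 3 := by
      rw [← ENNReal.ofReal_toReal hpt, ← h3]
      simp
    rw [hp3, tsub_self, ENNReal.div_zero (by simp), EReal.coe_ennreal_top,
      EReal.top_mul_coe_of_pos ha] at hdim
    simp at hdim
  · have h4 : 0 < p.toReal - 3 := by linarith
    have h5 : p / (p - 3) = ENNReal.ofReal (p.toReal / (p.toReal - 3)) := by
      rw [ENNReal.ofReal_div_of_pos h4, ENNReal.ofReal_sub _ (by norm_num),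
        ENNReal.ofReal_toReal hpt]
      simp
    have h6 : 0 < p.toReal / (p.toReal - 3) := by positivity
    rw [h5, EReal.coe_ennreal_ofReal, max_eq_left h6.le] at hdim
    have h7 : γ < 1 - p.toReal / (p.toReal - 3) * a := by exact_mod_cast hdim
    have h8 : 1 - 3 / p.toReal = (p.toReal - 3) / p.toReal := by
      field_simp
    rw [h8]
    refine ⟨by positivity, ?_⟩
    have h9 : p.toReal / (p.toReal - 3) * a < 1 - γ := by linarith
    calc a = (p.toReal - 3) / p.toReal * (p.toReal / (p.toReal - 3) * a) := by
          field_simp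
      _ < _ := by gcongr

end Dimension

/-! ### The defects near the exceptional times and the conclusion -/

section DefectsNearTimes

variable {α : Type*} [MeasurableSpace α] {ν : Measure α}

lemma lintegral_le_of_le_mul_pow (m : ℕ) {a N : α → ℝ≥0∞} {M : ℝ≥0∞} (hM : M ≠ ⊤) {r : ℝ≥0∞}
    (hr : (m + 1 : ℕ) ≤ r) (ha : AEMeasurable a ν) (haN : ∀ᵐ t ∂ν, a t ≤ M * N t ^ (m + 1)) :
    ∫⁻ t, a t ∂ν ≤ M * eLpNorm N r ν ^ (m + 1) * ν univ ^ (1 - (m + 1) / r.toReal) := by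
  have hm : (0 : ℝ) < m + 1 := by positivity
  have hc : (M ^ (1 / ((m : ℝ) + 1))) ^ (m + 1) = M := by
    rw [← ENNReal.rpow_natCast, ← ENNReal.rpow_mul]
    push_cast
    rw [one_div_mul_cancel hm.ne', ENNReal.rpow_one]
  have h := lintegral_le_of_le_pow m (c := M ^ (1 / ((m : ℝ) + 1)))
    (ENNReal.rpow_ne_top_of_nonneg (by positivity) hM) hr ha (N := N) (by
      simpa only [mul_pow, hc] using haN)
  rwa [mul_pow, hc] at h

lemma lintegral_enorm_mul_le {ψ : α → ℝ} {A : Set α} (hA : MeasurableSet A)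
    (h0 : ∀ t ∉ A, ψ t = 0) {M : ℝ} (hM : ∀ t, |ψ t| ≤ M) (a : α → ℝ≥0∞) :
    ∫⁻ t, ‖ψ t‖ₑ * a t ∂ν ≤ ENNReal.ofReal M * ∫⁻ t in A, a t ∂ν := by
  rw [← lintegral_indicator hA, ← lintegral_const_mul' _ _ ENNReal.ofReal_ne_top]
  refine lintegral_mono fun t => ?_
  by_cases ht : t ∈ A
  · rw [indicator_of_mem ht, ← ofReal_norm]
    gcongr
    exact hM t
  · simp [h0 t ht]

variable {d : ℕ} {Ω : FlowDomain} {T θ β l : ℝ} {p : ℝ≥0∞}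
  {v : ℝ → EuclideanSpace ℝ (Fin d) → EuclideanSpace ℝ (Fin d)}

/-- The cubic defect over a set of times, by Hölder in time with exponent `p / 3`. -/
lemma setLIntegral_cubicDefect_le (hu : IsRegularField Ω T (regularRepresentative Ω T v))
    (hp : 3 ≤ p) (hθ : 0 < θ) (hl : 0 < l) {A : Set ℝ} (hA : A ⊆ Ioo 0 T) :
    ∫⁻ t in A, cubicDefect Ω (rescale l (shellKernel d)) (regularRepresentative Ω T v t) ≤
      ENNReal.ofReal ((∫ z, ‖fderiv ℝ (shellKernel d) z‖) * 2 ^ (3 * θ) * l ^ (3 * θ - 1)) *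
        eLpNorm (fun t => besovNorm Ω θ 3 (v t)) p (volume.restrict (Ioo 0 T)) ^ 3 *
        volume A ^ (1 - 3 / p.toReal) := by
  have hK := contDiff_shellKernel d
  have hKl := contDiff_rescale hK l
  have hC : ENNReal.ofReal (l⁻¹ * ∫ z, ‖fderiv ℝ (shellKernel d) z‖) *
      ENNReal.ofReal ((2 * l) ^ θ) ^ 3 =
      ENNReal.ofReal ((∫ z, ‖fderiv ℝ (shellKernel d) z‖) * 2 ^ (3 * θ) * l ^ (3 * θ - 1)) := by
    rw [← ENNReal.ofReal_pow (by positivity), ← ENNReal.ofReal_mul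
      (mul_nonneg (by positivity) (integral_nonneg fun z => norm_nonneg _))]
    congr 1
    rw [← Real.rpow_natCast, ← Real.rpow_mul (by positivity), Real.mul_rpow (by norm_num) hl.le,
      Real.rpow_sub hl, Real.rpow_one]
    push_cast
    rw [mul_comm θ 3]
    field_simp
  have h := lintegral_le_of_le_mul_pow (ν := (volume : Measure ℝ).restrict A) 2
    (M := ENNReal.ofReal ((∫ z, ‖fderiv ℝ (shellKernel d) z‖) * 2 ^ (3 * θ) * l ^ (3 * θ - 1)))
    (N := fun t => besovNorm Ω θ 3 (v t)) ENNReal.ofReal_ne_top (r := p)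
    (by exact_mod_cast hp)
    (hu.aemeasurable_cubicDefect (hKl.continuous_fderiv (by simp))).restrict
    (ae_of_all _ fun t => by
      rcases regularRepresentative_eq_or Ω T v t with h | h <;> rw [h]
      · refine (cubicDefect_rescale_le hθ hK (hasCompactSupport_shellKernel d)
          (fun z hz => shellKernel_eq_zero d hz) hl).trans_eq ?_
        rw [← hC]
        ring
      · simp [cubicDefect])
  refine h.trans ?_
  rw [Measure.restrict_apply_univ]
  norm_num
  gcongr

/-- The quadratic defect over a set of times, by Hölder in time with exponent
`(2p/3) / 2 = p / 3`. -/
lemma setLIntegral_quadraticDefect_le (hu : IsRegularField Ω T (regularRepresentative Ω T v))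
    (hp : 3 ≤ p) (hβ : 0 < β) (hl : 0 < l) {A : Set ℝ} (hA : A ⊆ Ioo 0 T) :
    ∫⁻ t in A, quadraticDefect Ω (rescale l (shellKernel d)) (regularRepresentative Ω T v t) ≤
      ENNReal.ofReal ((∫ z, ‖shellKernel d z‖) * 2 ^ (2 * β) * l ^ (2 * β)) *
        eLpNorm (fun t => besovNorm Ω β 2 (v t)) (2 * p / 3) (volume.restrict (Ioo 0 T)) ^ 2 *
        volume A ^ (1 - 3 / p.toReal) := by
  have hK := contDiff_shellKernel d
  have hKl := contDiff_rescale hK l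
  have hC : ENNReal.ofReal (∫ z, ‖shellKernel d z‖) * ENNReal.ofReal ((2 * l) ^ β) ^ 2 =
      ENNReal.ofReal ((∫ z, ‖shellKernel d z‖) * 2 ^ (2 * β) * l ^ (2 * β)) := by
    rw [← ENNReal.ofReal_pow (by positivity), ← ENNReal.ofReal_mul
      (integral_nonneg fun z => norm_nonneg _)]
    congr 1
    rw [← Real.rpow_natCast, ← Real.rpow_mul (by positivity), Real.mul_rpow (by norm_num) hl.le]
    push_cast
    rw [mul_comm β 2]
    ring
  have hr : (1 - ((1 : ℕ) + 1 : ℝ) / (2 * p / 3).toReal) = 1 - 3 / p.toReal := by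
    rw [ENNReal.toReal_div, ENNReal.toReal_mul]
    norm_num
    rcases eq_or_ne p.toReal 0 with h | h
    · simp [h]
    · field_simp
  have h := lintegral_le_of_le_mul_pow (ν := (volume : Measure ℝ).restrict A) 1
    (M := ENNReal.ofReal ((∫ z, ‖shellKernel d z‖) * 2 ^ (2 * β) * l ^ (2 * β)))
    (N := fun t => besovNorm Ω β 2 (v t)) ENNReal.ofReal_ne_top (r := 2 * p / 3)
    (by
      rw [ENNReal.le_div_iff_mul_le (by simp) (by simp)]
      norm_num
      calc (6 : ℝ≥0∞) = 2 * 3 := by norm_num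
        _ ≤ 2 * p := by gcongr)
    (hu.aemeasurable_quadraticDefect hKl.continuous).restrict
    (ae_of_all _ fun t => by
      rcases regularRepresentative_eq_or Ω T v t with h | h <;> rw [h]
      · refine (quadraticDefect_rescale_le hβ hK.continuous (hasCompactSupport_shellKernel d)
          (fun z hz => shellKernel_eq_zero d hz) hl).trans_eq ?_
        rw [← hC]
        ring
      · simp [quadraticDefect])
  rw [hr] at h
  refine h.trans ?_
  rw [Measure.restrict_apply_univ]
  gcongr

end DefectsNearTimes

section Conclusion

variable {d : ℕ} {Ω : FlowDomain} {T : ℝ} {S : Set ℝ}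
  {v : ℝ → EuclideanSpace ℝ (Fin d) → EuclideanSpace ℝ (Fin d)}

/-- Only the part of a test function near the exceptional times matters. -/
lemma IsConservativeOn.setIntegral_deriv_eq_cutoff
    (hcons : IsConservativeOn Ω v (Ioo 0 T \ S))
    (hint : IntegrableOn (kineticEnergy Ω v) (Ioo 0 T))
    {φ χ : ℝ → ℝ} (hφ : ContDiff ℝ ∞ φ) (hφc : HasCompactSupport φ) (hφT : tsupport φ ⊆ Ioo 0 T)
    (hχ : ContDiff ℝ ∞ χ) (hχS : ∀ s ∈ S, χ =ᶠ[𝓝 s] 1) :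
    ∫ t in Ioo 0 T, kineticEnergy Ω v t * deriv φ t =
      ∫ t in Ioo 0 T, kineticEnergy Ω v t * deriv (fun t => χ t * φ t) t := by
  set ζ : ℝ → ℝ := fun t => (1 - χ t) * φ t with hζ
  have hζs : ContDiff ℝ ∞ ζ := (contDiff_const.sub hχ).mul hφ
  have hζc : HasCompactSupport ζ := hφc.mul_left
  have hζ0 : ∀ s ∈ S, ζ =ᶠ[𝓝 s] 0 := fun s hs => by
    filter_upwards [hχS s hs] with t ht
    simp [hζ, ht]
  have hζT : tsupport ζ ⊆ Ioo 0 T \ S := fun t ht =>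
    ⟨hφT (closure_mono (Function.support_mul_subset_right _ _) ht),
      fun hs => notMem_tsupport_iff_eventuallyEq.2 (hζ0 t hs) ht⟩
  have hψs : ContDiff ℝ ∞ fun t => χ t * φ t := hχ.mul hφ
  have hψc : HasCompactSupport fun t => χ t * φ t := hφc.mul_left
  have h0 : ∫ t in Ioo 0 T, kineticEnergy Ω v t * deriv ζ t = 0 := by
    refine Eq.trans ?_ (hcons.2 ζ hζs hζc hζT)
    refine setIntegral_eq_of_subset_of_forall_sdiff_eq_zero measurableSet_Ioo sdiff_subset
      fun t ht => ?_
    have hs : t ∈ S := by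
      by_contra h
      exact ht.2 ⟨ht.1, h⟩
    rw [(hζ0 t hs).deriv_eq]
    simp
  have hmul : ∀ g : ℝ → ℝ, ContDiff ℝ ∞ g → HasCompactSupport g →
      IntegrableOn (fun t => kineticEnergy Ω v t * deriv g t) (Ioo 0 T) := fun g hg hgc => by
    have hg' : Continuous (deriv g) := hg.continuous_deriv (by simp)
    obtain ⟨C, hC⟩ := hgc.deriv.exists_bound_of_continuous hg'
    exact hint.mul_bdd (c := C) hg'.aestronglyMeasurable (ae_of_all _ hC)
  have e : ∀ t, deriv φ t = deriv (fun t => χ t * φ t) t + deriv ζ t := fun t => by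
    rw [← deriv_fun_add (hψs.differentiable (by simp) t) (hζs.differentiable (by simp) t)]
    congr 1
    ext t
    simp only [hζ]
    ring
  simp_rw [e, mul_add]
  rw [integral_add (hmul _ hψs hψc) (hmul _ hζs hζc), h0, add_zero]

end Conclusion

theorem theorem2p3 (d : ℕ) (hd : 2 ≤ d) (Ω : FlowDomain) (T : ℝ) (hT : 0 < T)
    (p : ℝ≥0∞) (hp : 3 ≤ p) (θ β : ℝ) (hθ : θ ∈ Ioo (0 : ℝ) (1 / 3)) (hβ : β ∈ Ioo (0 : ℝ) 1)
    (v : ℝ → EuclideanSpace ℝ (Fin d) → EuclideanSpace ℝ (Fin d))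
    (hv : IsWeakEulerSolution Ω T v)
    (hv3 : MemTimeBesov Ω T p θ 3 v)
    (hv2 : MemTimeBesov Ω T (2 * p / 3) β 2 v)
    (S : Set ℝ) (hS : S ⊆ Ioo 0 T) (hS_closed : IsOpen (Ioo 0 T \ S))
    (γ : ℝ) (hγ : upperMinkowskiDim S = γ) (hγ1 : γ < 1)
    (hcons : IsConservativeOn Ω v (Ioo 0 T \ S))
    (hdim : (γ : EReal) <
      1 - (dualFactor p : EReal) * ((1 - 2 * β / (1 - 3 * θ + 2 * β) : ℝ) : EReal)) :
    IsConservativeOn Ω v (Ioo 0 T) := by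
  have huv := ae_regularRepresentative_eq hp hv3 hv2
  have hu := isRegularField_regularRepresentative hp hv.periodic hv3 hv2
  set u := regularRepresentative Ω T v with hudef
  have hE : Integrable fun t => ∫ y in Ω.cell d, ‖u t y‖ ^ 2 := by
    have h2 := hu.memLp 1 (Or.inl rfl)
    have h1 : Integrable (fun z : ℝ × EuclideanSpace ℝ (Fin d) => ‖Function.uncurry u z‖ ^ 2)
        ((volume : Measure ℝ).prod (volume.restrict (Ω.cell d))) :=
      (memLp_two_iff_integrable_sq_norm h2.1).1 (by exact_mod_cast h2)
    exact h1.integral_prod_left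
  have hkin : ∀ᵐ t ∂((volume : Measure ℝ).restrict (Ioo 0 T)),
      kineticEnergy Ω v t = (1 / 2) * ∫ y in Ω.cell d, ‖u t y‖ ^ 2 := by
    filter_upwards [ae_restrict_of_ae huv, ae_restrict_mem measurableSet_Ioo] with t h1 h2
    rw [h1 h2, kineticEnergy]
  have hint : IntegrableOn (kineticEnergy Ω v) (Ioo 0 T) :=
    (hE.const_mul (1 / 2)).integrableOn.congr (hkin.mono fun t ht => ht.symm)
  refine ⟨hint.locallyIntegrableOn, fun φ hφ hφc hφT => ?_⟩
  set X := ∫ t in Ioo 0 T, kineticEnergy Ω v t * deriv φ t with hX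
  set σ : ℝ := 1 / (1 - 3 * θ + 2 * β) with hσ
  have hden : 0 < 1 - 3 * θ + 2 * β := by linarith [hθ.2, hβ.1]
  have hσ0 : 0 < σ := by positivity
  set a : ℝ := 1 - 2 * β / (1 - 3 * θ + 2 * β) with ha
  have ha1 : a = (1 - 3 * θ) * σ := by
    rw [ha, hσ]
    field_simp
    ring
  have ha2 : a = 1 - 2 * β * σ := by
    rw [ha, hσ]
    ring
  have ha0 : 0 < a := by
    rw [ha1]
    exact mul_pos (by linarith [hθ.2]) hσ0
  obtain ⟨hκ0, hκ⟩ := dimension_condition hp ha0 hdim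
  set κ : ℝ := 1 - 3 / p.toReal with hκdef
  -- room for an exponent `s` of the measure of the neighbourhoods with `(1 - s) κ > a`
  obtain ⟨x, hγx, hxa⟩ : ∃ x, γ < x ∧ x < 1 - a / κ := exists_between (by
    rw [lt_sub_comm, div_lt_iff₀ hκ0]
    linarith)
  obtain ⟨s, hsx, hvol⟩ := exists_volume_cthickening_le hS (hγ.trans_lt hγx)
  have hexp : 0 < (1 - s) * κ - a := by
    have h1 : a / κ < 1 - s := by linarith
    rw [div_lt_iff₀ hκ0] at h1
    linarith
  have hφ' : Continuous (deriv φ) := hφ.continuous_deriv (by simp)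
  obtain ⟨M₀, hM₀⟩ := hφc.exists_bound_of_continuous hφ.continuous
  obtain ⟨M₁, hM₁⟩ := hφc.deriv.exists_bound_of_continuous hφ'
  have hM₀0 : 0 ≤ M₀ := (norm_nonneg _).trans (hM₀ 0)
  have hM₁0 : 0 ≤ M₁ := (norm_nonneg _).trans (hM₁ 0)
  obtain ⟨C, hC0, hC⟩ := exists_cutoff
  set c := ∫ z, shellKernel d z with hc
  have hcpos : 0 < c := integral_shellKernel_pos (by omega)
  set C₂ : ℝ := (∫ z, ‖shellKernel d z‖) * 2 ^ (2 * β) with hC₂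
  set C₃ : ℝ := (∫ z, ‖fderiv ℝ (shellKernel d) z‖) * 2 ^ (3 * θ) with hC₃
  have hC₂0 : 0 ≤ C₂ := mul_nonneg (integral_nonneg fun z => norm_nonneg _) (by positivity)
  have hC₃0 : 0 ≤ C₃ := mul_nonneg (integral_nonneg fun z => norm_nonneg _) (by positivity)
  set N₂ := eLpNorm (fun t => besovNorm Ω β 2 (v t)) (2 * p / 3) (volume.restrict (Ioo 0 T)) ^ 2
  set N₃ := eLpNorm (fun t => besovNorm Ω θ 3 (v t)) p (volume.restrict (Ioo 0 T)) ^ 3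
  have hN₂ : N₂ < ⊤ := ENNReal.pow_lt_top hv2.2
  have hN₃ : N₃ < ⊤ := ENNReal.pow_lt_top hv3.2
  set Λ : ℝ≥0∞ := ENNReal.ofReal ((C * M₀ + M₁) * C₂) * N₂ + ENNReal.ofReal (M₀ * C₃) * N₃ with hΛ
  have hΛt : Λ ≠ ⊤ := (ENNReal.add_lt_top.2 ⟨ENNReal.mul_lt_top ENNReal.ofReal_lt_top hN₂,
    ENNReal.mul_lt_top ENNReal.ofReal_lt_top hN₃⟩).ne
  -- apply the energy estimate to `χ φ`, with `χ` a cutoff to the `δ`-neighbourhood of `S`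
  have hbound : ∀ᶠ δ in 𝓝[>] (0 : ℝ),
      ‖c * (2 * X)‖ₑ ≤ Λ * ENNReal.ofReal (δ ^ ((1 - s) * κ - a)) := by
    filter_upwards [hvol, self_mem_nhdsWithin, Ioo_mem_nhdsGT one_pos] with δ hδv hδ hδ1
    have hδ : 0 < δ := hδ
    obtain ⟨χ, hχ, hχ01, hχS, hχsupp, hχ'⟩ := hC S δ hδ
    set ψ : ℝ → ℝ := fun t => χ t * φ t with hψdef
    have hψ : ContDiff ℝ ∞ ψ := hχ.mul hφ
    have hψc : HasCompactSupport ψ := hφc.mul_left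
    set A := Metric.cthickening δ S ∩ Ioo 0 T with hA
    have hAm : MeasurableSet A := Metric.isClosed_cthickening.measurableSet.inter measurableSet_Ioo
    have hψA : tsupport ψ ⊆ A := fun t ht =>
      ⟨closure_minimal (fun t ht => hχsupp t (left_ne_zero_of_mul ht))
        Metric.isClosed_cthickening ht,
        hφT (closure_mono (Function.support_mul_subset_right _ _) ht)⟩
    have hψT : tsupport ψ ⊆ Ioo 0 T := hψA.trans inter_subset_right
    have hXψ : 2 * X = ∫ t, deriv ψ t * ∫ y in Ω.cell d, ‖u t y‖ ^ 2 := by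
      have h1 : (∫ t in Ioo 0 T, deriv ψ t * ∫ y in Ω.cell d, ‖u t y‖ ^ 2) =
          ∫ t, deriv ψ t * ∫ y in Ω.cell d, ‖u t y‖ ^ 2 :=
        setIntegral_eq_integral_of_forall_compl_eq_zero fun t ht => by
          rw [image_eq_zero_of_notMem_tsupport fun h => ht (hψT (tsupport_deriv_subset h)),
            zero_mul]
      rw [hX, hcons.setIntegral_deriv_eq_cutoff hint hφ hφc hφT hχ hχS, ← h1,
        ← integral_const_mul]
      refine integral_congr_ae ?_
      filter_upwards [hkin] with t ht
      rw [ht]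
      ring
    have hl : 0 < δ ^ σ := Real.rpow_pos_of_pos hδ _
    have hmain := hu.enorm_integral_deriv_energy_le (by omega) hv huv hl hψ hψc hψT
    rw [← hXψ] at hmain
    have hψ0 : ∀ t ∉ A, ψ t = 0 := fun t ht => image_eq_zero_of_notMem_tsupport fun h => ht (hψA h)
    have hψ'0 : ∀ t ∉ A, deriv ψ t = 0 := fun t ht =>
      image_eq_zero_of_notMem_tsupport fun h => ht (hψA (tsupport_deriv_subset h))
    have hψM : ∀ t, |ψ t| ≤ M₀ := fun t => by
      rw [hψdef, abs_mul, abs_of_nonneg (hχ01 t).1]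
      exact (mul_le_of_le_one_left (abs_nonneg _) (hχ01 t).2).trans (hM₀ t)
    have hψ'M : ∀ t, |deriv ψ t| ≤ (C * M₀ + M₁) / δ := fun t => by
      have h1 : deriv ψ t = deriv χ t * φ t + χ t * deriv φ t :=
        deriv_fun_mul (hχ.differentiable (by simp) t) (hφ.differentiable (by simp) t)
      have h2 : M₁ ≤ M₁ / δ := (le_div_iff₀ hδ).2 (mul_le_of_le_one_right hM₁0 hδ1.2.le)
      calc |deriv ψ t| ≤ |deriv χ t| * |φ t| + |χ t| * |deriv φ t| := by
            rw [h1, ← abs_mul, ← abs_mul]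
            exact abs_add_le _ _
        _ ≤ C / δ * M₀ + 1 * M₁ := by
            gcongr
            · exact hχ' t
            · exact hM₀ t
            · rw [abs_of_nonneg (hχ01 t).1]
              exact (hχ01 t).2
            · exact hM₁ t
        _ ≤ C / δ * M₀ + M₁ / δ := by rw [one_mul]; gcongr
        _ = _ := by ring
    have hVκ : volume A ^ κ ≤ ENNReal.ofReal (δ ^ ((1 - s) * κ)) := by
      rw [Real.rpow_mul hδ.le, ← ENNReal.ofReal_rpow_of_nonneg (by positivity) hκ0.le]
      exact ENNReal.rpow_le_rpow ((measure_mono inter_subset_left).trans hδv) hκ0.le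
    have hq := (lintegral_enorm_mul_le hAm hψ'0 hψ'M _ (ν := (volume : Measure ℝ))).trans
      (mul_le_mul' le_rfl (setLIntegral_quadraticDefect_le hu hp hβ.1 hl
        (inter_subset_right : A ⊆ Ioo 0 T)))
    have hcu := (lintegral_enorm_mul_le hAm hψ0 hψM _ (ν := (volume : Measure ℝ))).trans
      (mul_le_mul' le_rfl (setLIntegral_cubicDefect_le hu hp hθ.1 hl
        (inter_subset_right : A ⊆ Ioo 0 T)))
    -- the scale `l = δ ^ σ` balances the two defects: `l ^ (2β) / δ = l ^ (3θ - 1) = δ ^ (-a)`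
    have hp2 : (C * M₀ + M₁) / δ * (C₂ * (δ ^ σ) ^ (2 * β)) = (C * M₀ + M₁) * C₂ * δ ^ (-a) := by
      rw [← Real.rpow_mul hδ.le, show -a = σ * (2 * β) - 1 by rw [ha2]; ring, Real.rpow_sub hδ,
        Real.rpow_one]
      ring
    have hp3 : M₀ * (C₃ * (δ ^ σ) ^ (3 * θ - 1)) = M₀ * C₃ * δ ^ (-a) := by
      rw [← Real.rpow_mul hδ.le, show -a = σ * (3 * θ - 1) by rw [ha1]; ring]
      ring
    have hδa : 0 ≤ δ ^ (-a) := by positivity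
    calc ‖c * (2 * X)‖ₑ
        ≤ ENNReal.ofReal ((C * M₀ + M₁) / δ) *
            (ENNReal.ofReal (C₂ * (δ ^ σ) ^ (2 * β)) * N₂ * volume A ^ κ) +
          ENNReal.ofReal M₀ * (ENNReal.ofReal (C₃ * (δ ^ σ) ^ (3 * θ - 1)) * N₃ * volume A ^ κ) :=
          hmain.trans (add_le_add hq hcu)
      _ = (ENNReal.ofReal ((C * M₀ + M₁) / δ * (C₂ * (δ ^ σ) ^ (2 * β))) * N₂ +
          ENNReal.ofReal (M₀ * (C₃ * (δ ^ σ) ^ (3 * θ - 1))) * N₃) * volume A ^ κ := by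
          rw [ENNReal.ofReal_mul (p := (C * M₀ + M₁) / δ) (by positivity), ENNReal.ofReal_mul hM₀0]
          ring
      _ = Λ * ENNReal.ofReal (δ ^ (-a)) * volume A ^ κ := by
          rw [hp2, hp3, ENNReal.ofReal_mul (p := (C * M₀ + M₁) * C₂) (by positivity),
            ENNReal.ofReal_mul (p := M₀ * C₃) (by positivity), hΛ]
          ring
      _ ≤ Λ * ENNReal.ofReal (δ ^ (-a)) * ENNReal.ofReal (δ ^ ((1 - s) * κ)) := by gcongr
      _ = _ := by
          rw [mul_assoc, ← ENNReal.ofReal_mul hδa, ← Real.rpow_add hδ]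
          congr 3
          ring
  have hlim : Tendsto (fun δ : ℝ => Λ * ENNReal.ofReal (δ ^ ((1 - s) * κ - a))) (𝓝[>] 0) (𝓝 0) := by
    have h1 : Tendsto (fun δ : ℝ => δ ^ ((1 - s) * κ - a)) (𝓝[>] 0) (𝓝 0) := by
      have h2 := (Real.continuousAt_rpow_const 0 ((1 - s) * κ - a) (Or.inr hexp.le)).tendsto
      rw [Real.zero_rpow hexp.ne'] at h2
      exact h2.mono_left nhdsWithin_le_nhds
    have h3 := ENNReal.tendsto_ofReal h1
    rw [ENNReal.ofReal_zero] at h3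
    simpa using ENNReal.Tendsto.const_mul h3 (Or.inr hΛt)
  have hzero : ‖c * (2 * X)‖ₑ ≤ 0 := ge_of_tendsto hlim hbound
  rw [nonpos_iff_eq_zero, enorm_eq_zero] at hzero
  simpa [hcpos.ne'] using hzero
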